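/- Let $c>0$ and let $\rho$ be a Borel probability measure on $\mathbb R$ with $\int\log(1+x^2)\,\rho(dx)<\infty$. Then there is a unique probability measure $\rho^{(c)}$ on $\mathbb R$ in Markov–Krein correspondence with $\rho$, i.e. with $$\int\frac{\rho^{(c)}(dx)}{(z-x)^c}=\exp\Big(-c\int\log(z-s)\,\rho(ds)\Big)\quad\text{for all }z\in\mathbb C\setminus\mathbb R$$ (principal branches). For $M>0$ put $\rho^{[M]}=\rho((-\infty,-M])\,\delta_{-M}+\mathbf 1_{(-M,M)}\rho+\rho([M,\infty))\,\delta_M$. For $u\in\mathbb C\setminus\{0\}$ let $\mathrm{sgn}(u)=1$ if $\mathrm{Re}\,u>0$, $-1$ if $\mathrm{Re}\,u<0$, $-i$ if $\mathrm{Re}\,u=0<\mathrm{Im}\,u$, and $i$ if $\mathrm{Re}\,u=0>\mathrm{Im}\,u$. For $a,b>0$ let $\mathcal C_{a,b}$ be the Hankel loop that goes along straight lines from $-\infty-ib$ to $a-ib$, to $a+ib$, to $-\infty+ib$. In the formulas (1) and (2), $u^{c-1}$ is the principal power, and $\log$ is the branch of the logarithm on $\mathbb C\setminus\mathrm{sgn}(u)(-\infty,0]$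 whose value at $1/u$ is minus the principal value of $\log u$ (the analytic continuation of $\log(uz)-\log u$; it is the principal branch if $\mathrm{Re}\,u>0$, and also on the lines considered below). Let $u\in\mathbb C\setminus\{0\}$ with $\int e^{x\,\mathrm{Re}\,u}\,\rho(dx)<\infty$. Then $\int e^{xu}\rho^{(c)}(dx)$ converges absolutely and the following holds. (a) For all $a_M,b_M>M$ (for every $M>0$), the contour integrals below converge absolutely and $$\int e^{xu}\rho^{(c)}(dx)=\lim_{M\to\infty}\frac{\Gamma(c)}{u^{c-1}}\frac1{2\pi i}\int_{\mathrm{sgn}(u)\,\mathcal C_{a_M,b_M}}\exp\Big(uz-c\int\log(z-s)\,\rho^{[M]}(ds)\Big)dz.\tag{1}$$ (b) If $\rho$ is supported in $[-M,M]$ with $M\ge0$, then for all $a,b>M$ the contour integral below converges absolutely and $$\int e^{xu}\rho^{(c)}(dx)=\frac{\Gamma(c)}{u^{c-1}}\frac1{2\pi i}\int_{\mathrm{sgn}(u)\,\mathcal C_{a,b}}\exp\Big(uz-c\int\log(z-s)\,\rho(ds)\Big)dz.\tag{2}$$ (c) If $u=it$ with $t\in\mathbb R\setminus\{0\}$, then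 for every $\delta>0$ the contours in (1) (for each $M$) and in (2) can be replaced, without changing the value of the integral, by the line $\mathbb R-i\delta\,\mathrm{sgn}(t)$, oriented from left to right if $t>0$ and from right to left if $t<0$, where the integral over the line is the limit of the integrals over $[-A,B]-i\delta\,\mathrm{sgn}(t)$ as $A,B\to\infty$ independently. If moreover $c>1$, then for every $\rho$ as above, compactly supported or not, the integral over this line of the integrand in (2) is absolutely convergent and (2) holds with this line as its contour. -/

import Mathlib

open MeasureTheory Filter Topology

/-- `ν` is a probability measure in Markov-Krein correspondence with `ρ`, with parameter `c`:
`∫ (z - x)^{-c} dν(x) = exp (-c ∫ log (z - s) dρ(s))` for all non-real `z`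
(principal branches on both sides). -/
def IsMarkovKrein (c : ℝ) (ρ ν : Measure ℝ) : Prop :=
  IsProbabilityMeasure ν ∧
    ∀ z : ℂ, z.im ≠ 0 →
      ∫ x : ℝ, 1 / (z - (x : ℂ)) ^ (c : ℂ) ∂ν
        = Complex.exp (-(c : ℂ) * ∫ s : ℝ, Complex.log (z - (s : ℂ)) ∂ρ)

/-- The truncation of `ρ` to `[-M, M]`; the mass outside `(-M, M)` is moved to the end points. -/
noncomputable def truncMeasure (ρ : Measure ℝ) (M : ℝ) : Measure ℝ :=
  ρ (Set.Iic (-M)) • Measure.dirac (-M) + ρ.restrict (Set.Ioo (-M) M)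
    + ρ (Set.Ici M) • Measure.dirac M

/-- The unit by which the Hankel loop is rotated. -/
noncomputable def contourSign (u : ℂ) : ℂ :=
  if 0 < u.re then 1
  else if u.re < 0 then -1
  else if 0 < u.im then -Complex.I
  else Complex.I

/-- The branch of the logarithm with cut `contourSign u * (-∞, 0]`, normalised by
`branchLog u (1 / u) = - log u` with the principal value of `log u`.
In other words, it is `log (u z) - log u`, continued analytically to the plane slit along the
direction into which the Hankel loop is rotated. -/
noncomputable def branchLog (u z : ℂ) : ℂ :=
  Complex.log (z / contourSign u) + Complex.log (u * contourSign u) - Complex.log u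

theorem contourSign_ne_zero (u : ℂ) : contourSign u ≠ 0 := by
  unfold contourSign
  split_ifs <;> simp

/-- `branchLog u` is a logarithm. -/
theorem exp_branchLog {u z : ℂ} (hu : u ≠ 0) (hz : z ≠ 0) :
    Complex.exp (branchLog u z) = z := by
  have h := contourSign_ne_zero u
  rw [branchLog, Complex.exp_sub, Complex.exp_add, Complex.exp_log (div_ne_zero hz h),
    Complex.exp_log (mul_ne_zero hu h), Complex.exp_log hu]
  field_simp

/-- For `Re u > 0`, where the loop is not rotated, `branchLog u` is the principal logarithm. -/
theorem branchLog_of_re_pos {u : ℂ} (hu : 0 < u.re) (z : ℂ) :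
    branchLog u z = Complex.log z := by
  simp [branchLog, contourSign, hu]

/-- For `u = i t` and `z` in the half-plane that contains the lines `ℝ - i δ sgn t`, `branchLog u`
is the principal logarithm. -/
theorem branchLog_of_imaginary {t : ℝ} (ht : t ≠ 0) {z : ℂ} (hz : t * z.im < 0) :
    branchLog (Complex.I * t) z = Complex.log z := by
  have hu : Complex.I * (t : ℂ) ≠ 0 := by simp [ht]
  have hz0 : z ≠ 0 := by rintro rfl; simp at hz
  have hpi := Real.pi_pos
  have key : (branchLog (Complex.I * t) z).im ∈ Set.Ioc (-Real.pi) Real.pi := by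
    rcases lt_or_gt_of_ne ht with h | h
    · have hzi : 0 < z.im := by by_contra hh; nlinarith [not_lt.mp hh]
      have e1 : Complex.I * (t : ℂ) = ((-t : ℝ) : ℂ) * (-Complex.I) := by push_cast; ring
      have e2 : Complex.I * (t : ℂ) * Complex.I = ((-t : ℝ) : ℂ) := by
        push_cast; linear_combination (t : ℂ) * Complex.I_mul_I
      have hs : contourSign (Complex.I * t) = Complex.I := by
        simp [contourSign, h.le]
      have ha : |(z / Complex.I).arg| < Real.pi / 2 := by
        rw [Complex.abs_arg_lt_pi_div_two_iff]; left; simpa [Complex.div_I] using hzi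
      have h3 : (Complex.I * (t : ℂ)).arg = -(Real.pi / 2) := by
        rw [e1, Complex.arg_real_mul _ (by linarith), Complex.arg_neg_I]
      rw [abs_lt] at ha
      simp only [branchLog, hs, e2, Complex.add_im, Complex.sub_im, Complex.log_im, h3,
        Complex.arg_ofReal_of_nonneg (show (0 : ℝ) ≤ -t by linarith)]
      constructor <;> linarith [ha.1, ha.2]
    · have hzi : z.im < 0 := by by_contra hh; nlinarith [not_lt.mp hh]
      have e1 : Complex.I * (t : ℂ) = (t : ℂ) * Complex.I := by ring
      have e2 : Complex.I * (t : ℂ) * -Complex.I = (t : ℂ) := by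
        linear_combination -(t : ℂ) * Complex.I_mul_I
      have hs : contourSign (Complex.I * t) = -Complex.I := by
        simp [contourSign, h]
      have ha : |(z / -Complex.I).arg| < Real.pi / 2 := by
        rw [Complex.abs_arg_lt_pi_div_two_iff]; left
        simpa [div_neg, Complex.div_I] using hzi
      have h3 : (Complex.I * (t : ℂ)).arg = Real.pi / 2 := by
        rw [e1, Complex.arg_real_mul _ h, Complex.arg_I]
      rw [abs_lt] at ha
      simp only [branchLog, hs, e2, Complex.add_im, Complex.sub_im, Complex.log_im, h3,
        Complex.arg_ofReal_of_nonneg h.le]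
      constructor <;> linarith [ha.1, ha.2]
  rw [← exp_branchLog hu hz0, Complex.log_exp key.1 key.2, exp_branchLog hu hz0]

/-- `exp (u z - c ∫ log (z - s) dμ(s))`, with the branch `branchLog u` of the logarithm. -/
noncomputable def hankelIntegrand (c : ℝ) (u : ℂ) (μ : Measure ℝ) (z : ℂ) : ℂ :=
  Complex.exp (u * z - (c : ℂ) * ∫ s : ℝ, branchLog u (z - (s : ℂ)) ∂μ)

/-- Absolute convergence of the integral of `f` over the rotated Hankel loop `ω 𝒞`, where `𝒞` goes
from `-∞ - i b` to `a - i b`, to `a + i b`, to `-∞ + i b` along straight lines. -/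
def HankelIntegrable (ω : ℂ) (a b : ℝ) (f : ℂ → ℂ) : Prop :=
  IntegrableOn (fun x : ℝ => f (ω * ((x : ℂ) - b * Complex.I))) (Set.Iic a) ∧
  IntervalIntegrable (fun y : ℝ => f (ω * ((a : ℂ) + y * Complex.I))) volume (-b) b ∧
  IntegrableOn (fun x : ℝ => f (ω * ((x : ℂ) + b * Complex.I))) (Set.Iic a)

/-- The contour integral of `f` over the rotated Hankel loop `ω 𝒞` with parameters `a`, `b`. -/
noncomputable def hankelIntegral (ω : ℂ) (a b : ℝ) (f : ℂ → ℂ) : ℂ :=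
  ω * ((∫ x in Set.Iic a, f (ω * ((x : ℂ) - b * Complex.I)))
    + Complex.I * (∫ y in (-b)..b, f (ω * ((a : ℂ) + y * Complex.I)))
    - ∫ x in Set.Iic a, f (ω * ((x : ℂ) + b * Complex.I)))

/-- The point with abscissa `y` on the line `ℝ - i δ sgn t`. -/
noncomputable def linePoint (t δ y : ℝ) : ℂ :=
  (y : ℂ) - Complex.I * δ * Real.sign t

/-- The improper contour integral of `f` over the line `ℝ - i δ sgn t` converges to `J`. The line
has the orientation of the rotated Hankel loop: left to right if `t > 0`, right to left
if `t < 0`. -/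
def HasLineIntegral (t δ : ℝ) (f : ℂ → ℂ) (J : ℂ) : Prop :=
  Tendsto (fun p : ℝ × ℝ => (Real.sign t : ℂ) * ∫ y in (-p.1)..p.2, f (linePoint t δ y))
    (atTop ×ˢ atTop) (𝓝 J)

/-- The contour integral of `f` over the line `ℝ - i δ sgn t`, oriented as in `HasLineIntegral`. -/
noncomputable def lineIntegral (t δ : ℝ) (f : ℂ → ℂ) : ℂ :=
  (Real.sign t : ℂ) * ∫ y : ℝ, f (linePoint t δ y)

/-- The factor `Γ(c) / u^{c-1} * 1 / (2 π i)`, with the principal power. -/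
noncomputable def hankelFactor (c : ℝ) (u : ℂ) : ℂ :=
  (Real.Gamma c : ℂ) / u ^ ((c : ℂ) - 1) * (1 / (2 * Real.pi * Complex.I))

/-! Existence. With `z = i w` the upper half-plane becomes `Re w > 0`, and the correspondence reads
`∫ (w + i x)^(-c) dν = exp (-c ∫ log (w + i s) dρ)`. A point mass corresponds to itself. If `X` and
`Y` realise the transforms with exponents `c` and `d`, and `b` is an independent Beta(c, d)
variable, then `b X + (1 - b) Y` realises their product with exponent `c + d`, by Feynman's formula
(`exists_beta_mixture`). Induction gives every finitely supported `ρ`. A general `ρ` is a limit of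
images of `ρ` under simple functions: the logarithmic moment gives a uniform tail bound, hence
tightness, and both sides of the identity pass to the limit.

Convex order. Since `b` has mean `c / (c + d)`, convexity survives each mixture and the limit: `∫ f
dν ≤ ∫ f dρ` for every continuous convex `f ≥ 0`. This one inequality gives the exponential moments
of `ν`, the inclusion of its support in `[-M, M]` when `ρ` lives there, and uniform integrability of
`e^(x u)` along the truncations.

Uniqueness. By Euler's integral, `Γ(c)` times the transform of `ν` is the Laplace transform of
`r^(c-1)` times the characteristic function of `ν` at `-r`; Fourier inversion recovers the latter.

Inversion formula. Hankel's integral says that `e^(v (w - ζ)) (w - ζ)^(-c)` integrates over the loop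
to `2 π i v^(c-1) / Γ(c)`, for `Re v > 0`. For `c > 1` and real `v` it is Fourier inversion on a
vertical line; it extends to complex `v` by the identity theorem, and to `c > 0` by differentiating
the formula for `c + 1` in `v`. For compactly supported `ρ`, rotate by `ω = sgn u`, so that `Re (u
ω) > 0`, replace the exponential of the potential by `∫ (w - x/ω)^(-c) dν`, and exchange integrals
(`IsMarkovKrein.hankel`). The truncation `ρ^[M]` is the image of `ρ` under projection to `[-M, M]`,
so continuity of the correspondence and uniform integrability give the limit formula.

Lines. For imaginary `u` the points `x/ω` lie on the imaginary axis. The half-plane `Re w > 0` is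
then free of singularities, and Cauchy's theorem opens the loop into any line `Re w = δ > 0`. For `c
> 1` the integral over the line converges absolutely, and the exchange of integrals needs neither
compact support nor truncation. -/

/-! ### The principal power `w ^ (-c)` -/

/-- The principal branch of `w ^ (-c)`. -/
noncomputable def negPow (c : ℝ) (w : ℂ) : ℂ := Complex.exp (-(c : ℂ) * Complex.log w)

theorem norm_negPow {c : ℝ} {w : ℂ} (hw : w ≠ 0) : ‖negPow c w‖ = ‖w‖ ^ (-c) := by
  rw [negPow, Complex.norm_exp, Real.rpow_def_of_pos (norm_pos_iff.2 hw)]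
  simp [Complex.log_re, mul_comm]

theorem norm_negPow_le {c r : ℝ} (hc : 0 ≤ c) (hr : 0 < r) {w : ℂ} (hw : r ≤ ‖w‖) :
    ‖negPow c w‖ ≤ r ^ (-c) := by
  rw [norm_negPow (norm_pos_iff.1 (hr.trans_le hw))]
  exact Real.rpow_le_rpow_of_nonpos hr hw (by linarith)

theorem negPow_eq_cpow (c : ℝ) {w : ℂ} (hw : w ≠ 0) : negPow c w = w ^ (-(c : ℂ)) := by
  rw [negPow, Complex.cpow_def_of_ne_zero hw, mul_comm]

theorem one_div_cpow_eq_negPow (c : ℝ) {w : ℂ} (hw : w ≠ 0) : 1 / w ^ (c : ℂ) = negPow c w := by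
  rw [negPow_eq_cpow c hw, Complex.cpow_neg, one_div]

theorem negPow_add (c d : ℝ) (w : ℂ) : negPow (c + d) w = negPow c w * negPow d w := by
  rw [negPow, negPow, negPow, ← Complex.exp_add]; push_cast; ring_nf

theorem mul_negPow_add_one (c : ℝ) {w : ℂ} (hw : w ≠ 0) : w * negPow (c + 1) w = negPow c w := by
  rw [negPow_add, negPow, negPow, Complex.ofReal_one, neg_one_mul, Complex.exp_neg,
    Complex.exp_log hw]
  field_simp

theorem differentiableAt_negPow (c : ℝ) {w : ℂ} (hw : w ∈ Complex.slitPlane) :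
    DifferentiableAt ℂ (negPow c) w :=
  ((differentiableAt_const _).mul (Complex.differentiableAt_log hw)).cexp

@[fun_prop]
theorem measurable_negPow (c : ℝ) : Measurable (negPow c) := by
  unfold negPow; fun_prop

theorem negPow_ofReal (c : ℝ) {x : ℝ} (hx : 0 < x) : negPow c x = ((x ^ (-c) : ℝ) : ℂ) := by
  rw [negPow_eq_cpow c (by exact_mod_cast hx.ne'), Complex.ofReal_cpow hx.le]; simp

/-! ### Holomorphic parameter integrals and Euler's integral -/

/-- Holomorphy of integrals of exponentials over a curve that stays in a left half-plane and in a
horizontal strip. -/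
theorem hasDerivAt_integral_cexp_mul {μ : Measure ℝ} {γ k : ℝ → ℂ} (hγ : Measurable γ)
    (hk : Measurable k) {D : ℝ} (hre : ∀ᵐ x ∂μ, (γ x).re ≤ D) (him : ∀ᵐ x ∂μ, |(γ x).im| ≤ D)
    (hint : ∀ ε : ℝ, 0 < ε → Integrable (fun x => Real.exp (ε * (γ x).re) * ‖k x‖) μ)
    {u : ℂ} (hu : 0 < u.re) :
    Integrable (fun x => Complex.exp (u * γ x) * k x) μ ∧
    HasDerivAt (fun v : ℂ => ∫ x, Complex.exp (v * γ x) * k x ∂μ)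
      (∫ x, γ x * Complex.exp (u * γ x) * k x ∂μ) u := by
  -- On the ball of radius `ε` around `u` the real part of `v` is at least `3 ε`. The bound `key`
  -- keeps two decaying factors with rate `ε`: one absorbs the linear growth of `‖γ x‖`, the other
  -- is integrated by `hint`.
  set ε := u.re / 4 with hε
  have hε0 : 0 < ε := by positivity
  set C := (2 / ε) * Real.exp ((|u.im| + 2 * ε) * D + 6 * ε * D) with hC
  have hmeas : ∀ v : ℂ, AEStronglyMeasurable (fun x => Complex.exp (v * γ x) * k x) μ :=
    fun v => Measurable.aestronglyMeasurable (by fun_prop)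
  have key : ∀ᵐ x ∂μ, ∀ v ∈ Metric.ball u ε,
      Real.exp (v.re * (γ x).re - v.im * (γ x).im) ≤
        Real.exp ((|u.im| + 2 * ε) * D + 6 * ε * D) * Real.exp (ε * ((γ x).re - D)) *
          Real.exp (ε * (γ x).re) := by
    filter_upwards [hre, him] with x h1 h2 v hv
    rw [← Real.exp_add, ← Real.exp_add, Real.exp_le_exp]
    have hD : 0 ≤ D := (abs_nonneg _).trans h2
    rw [Metric.mem_ball, dist_eq_norm] at hv
    have a1 : |v.re - u.re| ≤ ε := ((Complex.abs_re_le_norm (v - u)).trans hv.le)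
    have a2 : |v.im - u.im| ≤ ε := ((Complex.abs_im_le_norm (v - u)).trans hv.le)
    have a3 : |v.im| ≤ |u.im| + ε := by
      have := abs_add_le (v.im - u.im) u.im
      simp only [sub_add_cancel] at this; linarith
    have a4 : -(v.im * (γ x).im) ≤ (|u.im| + ε) * D := by
      calc -(v.im * (γ x).im) ≤ |v.im * (γ x).im| := neg_le_abs _
        _ = |v.im| * |(γ x).im| := abs_mul _ _
        _ ≤ _ := by gcongr
    rw [abs_le] at a1
    have a5 : (v.re - 2 * ε) * (γ x).re ≤ (v.re - 2 * ε) * D := by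
      apply mul_le_mul_of_nonneg_left h1; linarith [a1.1]
    have a6 : (v.re - 2 * ε) * D ≤ 5 * ε * D := by
      apply mul_le_mul_of_nonneg_right _ hD; linarith [a1.2]
    nlinarith
  have hF' : ∀ᵐ x ∂μ, ∀ v ∈ Metric.ball u ε,
      ‖γ x * Complex.exp (v * γ x) * k x‖ ≤
        ((2 * D + 1 / ε) * Real.exp ((|u.im| + 2 * ε) * D + 6 * ε * D)) *
          (Real.exp (ε * (γ x).re) * ‖k x‖) := by
    filter_upwards [hre, him, key] with x h1 h2 h3 v hv
    have hD : 0 ≤ D := (abs_nonneg _).trans h2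
    have h4 := h3 v hv
    rw [norm_mul, norm_mul, Complex.norm_exp, Complex.mul_re]
    have h5 : ‖γ x‖ ≤ 2 * D + (D - (γ x).re) := by
      have := Complex.norm_le_abs_re_add_abs_im (γ x)
      have : |(γ x).re| ≤ D + (D - (γ x).re) := abs_le.2 ⟨by linarith, by linarith⟩
      linarith
    have h6 : ‖γ x‖ * Real.exp (ε * ((γ x).re - D)) ≤ 2 * D + 1 / ε := by
      have e1 : Real.exp (ε * ((γ x).re - D)) ≤ 1 := by
        rw [Real.exp_le_one_iff]; nlinarith
      have e2 : (D - (γ x).re) * Real.exp (ε * ((γ x).re - D)) ≤ 1 / ε := by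
        rw [le_div_iff₀ hε0]
        have := Real.add_one_le_exp (ε * (D - (γ x).re))
        calc (D - (γ x).re) * Real.exp (ε * ((γ x).re - D)) * ε
            = (ε * (D - (γ x).re)) * Real.exp (-(ε * (D - (γ x).re))) := by ring_nf
          _ ≤ Real.exp (ε * (D - (γ x).re)) * Real.exp (-(ε * (D - (γ x).re))) := by
              gcongr; linarith
          _ = 1 := by rw [← Real.exp_add]; simp
      calc ‖γ x‖ * Real.exp (ε * ((γ x).re - D))
          ≤ (2 * D + (D - (γ x).re)) * Real.exp (ε * ((γ x).re - D)) := by gcongr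
        _ = 2 * D * Real.exp (ε * ((γ x).re - D))
            + (D - (γ x).re) * Real.exp (ε * ((γ x).re - D)) := by ring
        _ ≤ 2 * D * 1 + 1 / ε := by gcongr
        _ = _ := by ring
    calc ‖γ x‖ * Real.exp (v.re * (γ x).re - v.im * (γ x).im) * ‖k x‖
        ≤ ‖γ x‖ * (Real.exp ((|u.im| + 2 * ε) * D + 6 * ε * D) *
            Real.exp (ε * ((γ x).re - D)) * Real.exp (ε * (γ x).re)) * ‖k x‖ := by gcongr
      _ = (‖γ x‖ * Real.exp (ε * ((γ x).re - D))) *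
            Real.exp ((|u.im| + 2 * ε) * D + 6 * ε * D) *
            (Real.exp (ε * (γ x).re) * ‖k x‖) := by ring
      _ ≤ _ := by gcongr
  have hI : Integrable (fun x => Complex.exp (u * γ x) * k x) μ := by
    refine Integrable.mono' ((hint ε hε0).const_mul
      (Real.exp ((|u.im| + 2 * ε) * D + 6 * ε * D))) (hmeas u) ?_
    filter_upwards [hre, key] with x h1 h3
    have h4 := h3 u (Metric.mem_ball_self hε0)
    rw [norm_mul, Complex.norm_exp, Complex.mul_re]
    have e1 : Real.exp (ε * ((γ x).re - D)) ≤ 1 := by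
      rw [Real.exp_le_one_iff]; nlinarith
    calc Real.exp (u.re * (γ x).re - u.im * (γ x).im) * ‖k x‖
        ≤ (Real.exp ((|u.im| + 2 * ε) * D + 6 * ε * D) *
            Real.exp (ε * ((γ x).re - D)) * Real.exp (ε * (γ x).re)) * ‖k x‖ := by gcongr
      _ ≤ (Real.exp ((|u.im| + 2 * ε) * D + 6 * ε * D) *
            1 * Real.exp (ε * (γ x).re)) * ‖k x‖ := by gcongr
      _ = _ := by ring
  refine ⟨hI, ?_⟩
  refine (hasDerivAt_integral_of_dominated_loc_of_deriv_le (Metric.ball_mem_nhds u hε0)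
    (Eventually.of_forall hmeas) hI (Measurable.aestronglyMeasurable (by fun_prop)) hF'
    ((hint ε hε0).const_mul _) ?_).2
  refine Eventually.of_forall fun x v _ => ?_
  have := (((hasDerivAt_id v).mul_const (γ x)).cexp).mul_const (k x)
  simpa [mul_comm, mul_left_comm, mul_assoc] using this

theorem convex_re_pos : Convex ℝ {z : ℂ | 0 < z.re} :=
  convex_halfSpace_gt (f := Complex.re) ⟨fun _ _ => rfl, fun _ _ => by simp⟩ 0

theorem isOpen_re_pos : IsOpen {z : ℂ | 0 < z.re} :=
  isOpen_lt continuous_const Complex.continuous_re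

/-- Identity theorem in the right half-plane, from the positive half-line. -/
theorem eqOn_re_pos_of_eq_ofReal {f g : ℂ → ℂ}
    (hf : ∀ z : ℂ, 0 < z.re → DifferentiableAt ℂ f z)
    (hg : ∀ z : ℂ, 0 < z.re → DifferentiableAt ℂ g z)
    (h : ∀ x : ℝ, 0 < x → f x = g x) {z : ℂ} (hz : 0 < z.re) : f z = g z := by
  have hf' : AnalyticOnNhd ℂ f {z : ℂ | 0 < z.re} :=
    DifferentiableOn.analyticOnNhd (fun z hz => (hf z hz).differentiableWithinAt) isOpen_re_pos
  have hg' : AnalyticOnNhd ℂ g {z : ℂ | 0 < z.re} :=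
    DifferentiableOn.analyticOnNhd (fun z hz => (hg z hz).differentiableWithinAt) isOpen_re_pos
  refine hf'.eqOn_of_preconnected_of_frequently_eq hg' convex_re_pos.isPreconnected
    (z₀ := 1) (by simp) ?_ hz
  have ht : Tendsto (fun n : ℕ => ((1 + 1 / ((n : ℝ) + 1) : ℝ) : ℂ)) atTop (𝓝[≠] 1) := by
    refine tendsto_nhdsWithin_iff.2 ⟨?_, Eventually.of_forall fun n => ?_⟩
    · have := (tendsto_one_div_add_atTop_nhds_zero_nat (𝕜 := ℝ)).const_add 1
      rw [add_zero] at this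
      have h2 := (Complex.continuous_ofReal.tendsto 1).comp this
      rwa [Complex.ofReal_one] at h2
    · rw [Set.mem_compl_singleton_iff]
      have : (0 : ℝ) < 1 / ((n : ℝ) + 1) := by positivity
      intro h
      have : (1 + 1 / ((n : ℝ) + 1) : ℝ) = 1 := by exact_mod_cast h
      linarith
  exact ht.frequently (Frequently.of_forall fun n => h _ (by positivity))

theorem integrableOn_rpow_mul_exp {c r : ℝ} (hc : 0 < c) (hr : 0 < r) :
    IntegrableOn (fun t : ℝ => t ^ (c - 1) * Real.exp (-r * t)) (Set.Ioi 0) := by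
  have := integrableOn_rpow_mul_exp_neg_mul_rpow (s := c - 1) (p := 1) (b := r)
    (by linarith) (by norm_num) hr
  simpa using this

theorem integrableOn_rpow_mul_cexp {c : ℝ} (hc : 0 < c) {A : ℂ} (hA : 0 < A.re) :
    IntegrableOn (fun t : ℝ => Complex.exp (A * (-(t : ℂ))) * ((t ^ (c - 1) : ℝ) : ℂ))
      (Set.Ioi 0) := by
  refine Integrable.mono' (integrableOn_rpow_mul_exp hc hA)
    (Measurable.aestronglyMeasurable (by fun_prop)) ?_
  refine (ae_restrict_iff' measurableSet_Ioi).2 (Eventually.of_forall fun t (ht : 0 < t) => ?_)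
  rw [norm_mul, Complex.norm_exp, Complex.norm_real,
    Real.norm_of_nonneg (Real.rpow_nonneg ht.le _), mul_comm]
  simp

/-- Euler's integral for `A ^ (-c)`. -/
theorem integral_rpow_mul_cexp {c : ℝ} (hc : 0 < c) {A : ℂ} (hA : 0 < A.re) :
    ∫ t : ℝ in Set.Ioi 0, Complex.exp (A * (-(t : ℂ))) * ((t ^ (c - 1) : ℝ) : ℂ) =
      Real.Gamma c * negPow c A := by
  refine eqOn_re_pos_of_eq_ofReal
    (f := fun A => ∫ t : ℝ in Set.Ioi 0, Complex.exp (A * (-(t : ℂ))) * ((t ^ (c - 1) : ℝ) : ℂ))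
    (g := fun A => Real.Gamma c * negPow c A) ?_ ?_ ?_ hA
  · intro z hz
    refine (hasDerivAt_integral_cexp_mul (D := 0) (by fun_prop) (by fun_prop) ?_ ?_ ?_
      hz).2.differentiableAt
    · refine (ae_restrict_iff' measurableSet_Ioi).2 (Eventually.of_forall fun t (ht : 0 < t) => ?_)
      simp [ht.le]
    · simp
    · intro ε hε
      refine (integrableOn_rpow_mul_exp hc hε).congr ?_
      refine (ae_restrict_iff' measurableSet_Ioi).2 (Eventually.of_forall fun t (ht : 0 < t) => ?_)
      simp only [Complex.norm_real, Real.norm_of_nonneg (Real.rpow_nonneg ht.le (c - 1))]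
      simp [mul_comm]
  · intro z hz
    exact (differentiableAt_const _).mul (differentiableAt_negPow c (Or.inl hz))
  · intro x hx
    have h := Real.integral_rpow_mul_exp_neg_mul_Ioi hc hx
    rw [negPow_ofReal c hx, ← Complex.ofReal_mul]
    have e : Real.Gamma c * x ^ (-c) = (1 / x) ^ c * Real.Gamma c := by
      rw [Real.rpow_neg hx.le, one_div, Real.inv_rpow hx.le]; ring
    rw [e, ← h, ← integral_complex_ofReal]
    refine integral_congr_ae (Eventually.of_forall fun t => ?_)
    simp [mul_comm]

/-! ### Beta averages and Feynman's formula -/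

theorem ae_betaMeasure_mem_Ioo (c d : ℝ) :
    ∀ᵐ b ∂ProbabilityTheory.betaMeasure c d, b ∈ Set.Ioo (0 : ℝ) 1 := by
  rw [ProbabilityTheory.betaMeasure, ae_withDensity_iff
    (by unfold ProbabilityTheory.betaPDF; fun_prop)]
  refine Eventually.of_forall fun b hb => ?_
  by_contra h
  apply hb
  rw [ProbabilityTheory.betaPDF_eq, if_neg (by simpa using h)]
  simp

theorem integral_betaMeasure {c d : ℝ} (hc : 0 < c) (hd : 0 < d) (F : ℝ → ℂ) :
    ∫ b, F b ∂ProbabilityTheory.betaMeasure c d =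
      ((1 / ProbabilityTheory.beta c d : ℝ) : ℂ) *
        ∫ b in (0 : ℝ)..1, ((b ^ (c - 1) * (1 - b) ^ (d - 1) : ℝ) : ℂ) * F b := by
  rw [ProbabilityTheory.betaMeasure, integral_withDensity_eq_integral_toReal_smul
    (by unfold ProbabilityTheory.betaPDF; fun_prop)
    (Eventually.of_forall fun _ => by simp [ProbabilityTheory.betaPDF]),
    intervalIntegral.integral_of_le zero_le_one, integral_Ioc_eq_integral_Ioo,
    ← integral_const_mul, ← integral_indicator measurableSet_Ioo]
  refine integral_congr_ae (Eventually.of_forall fun b => ?_)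
  dsimp only
  by_cases hb : b ∈ Set.Ioo (0 : ℝ) 1
  · rw [Set.indicator_of_mem hb, ProbabilityTheory.betaPDF, ENNReal.toReal_ofReal
      (ProbabilityTheory.betaPDFReal_pos hb.1 hb.2 hc hd).le, ProbabilityTheory.betaPDFReal,
      if_pos (by simpa using hb), Complex.real_smul]
    push_cast
    ring
  · rw [Set.indicator_of_notMem hb, ProbabilityTheory.betaPDF_eq, if_neg (by simpa using hb)]
    simp

/-- Feynman's formula: the average of `(b A + (1 - b) B) ^ (-(c + d))` over the beta
distribution. -/
theorem integral_negPow_betaMeasure {c d : ℝ} (hc : 0 < c) (hd : 0 < d) {A B : ℂ}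
    (hA : 0 < A.re) (hB : 0 < B.re) :
    ∫ b : ℝ, negPow (c + d) (b * A + (1 - b) * B) ∂ProbabilityTheory.betaMeasure c d =
      negPow c A * negPow d B := by
  have hcd : 0 < c + d := by positivity
  have hβ := ProbabilityTheory.beta_pos hc hd
  have := ProbabilityTheory.isProbabilityMeasureBeta hc hd
  set β := ProbabilityTheory.betaMeasure c d
  set m := min A.re B.re with hm
  have hm0 : 0 < m := lt_min hA hB
  have hre : ∀ b ∈ Set.Ioo (0 : ℝ) 1, m ≤ ((b : ℂ) * A + (1 - b) * B).re := by
    intro b hb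
    have e : ((b : ℂ) * A + (1 - b) * B).re = b * A.re + (1 - b) * B.re := by simp
    rw [e]
    nlinarith [min_le_left A.re B.re, min_le_right A.re B.re, hb.1, hb.2,
      mul_le_mul_of_nonneg_left (min_le_left A.re B.re) hb.1.le,
      mul_le_mul_of_nonneg_left (min_le_right A.re B.re) (sub_nonneg.2 hb.2.le)]
  -- The product of the Euler integrals of `A ^ (-c)` and `B ^ (-d)` is the integral of the
  -- convolution of their integrands.
  have conv := integral_posConvolution (integrableOn_rpow_mul_cexp hc hA)
    (integrableOn_rpow_mul_cexp hd hB) (ContinuousLinearMap.mul ℝ ℂ)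
  simp_rw [ContinuousLinearMap.mul_apply', integral_rpow_mul_cexp hc hA,
    integral_rpow_mul_cexp hd hB] at conv
  -- The substitution `t = x b` turns the convolution at `x` into `x ^ (c + d - 1)` times a beta
  -- average. Integrating over `x` first is then Euler's integral with exponent `c + d`.
  have inner : ∀ x ∈ Set.Ioi (0 : ℝ),
      (∫ t in (0 : ℝ)..x, Complex.exp (A * -(t : ℂ)) * ((t ^ (c - 1) : ℝ) : ℂ) *
        (Complex.exp (B * -((x - t : ℝ) : ℂ)) * (((x - t) ^ (d - 1) : ℝ) : ℂ))) =
      ∫ b : ℝ, (ProbabilityTheory.beta c d : ℂ) *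
        (Complex.exp ((b * A + (1 - b) * B) * -(x : ℂ)) * ((x ^ (c + d - 1) : ℝ) : ℂ)) ∂β := by
    intro x (hx : 0 < x)
    rw [integral_betaMeasure hc hd, ← intervalIntegral.integral_const_mul]
    have h := intervalIntegral.integral_comp_mul_left (a := 0) (b := 1)
      (fun t : ℝ => Complex.exp (A * -(t : ℂ)) * ((t ^ (c - 1) : ℝ) : ℂ) *
        (Complex.exp (B * -((x - t : ℝ) : ℂ)) * (((x - t) ^ (d - 1) : ℝ) : ℂ))) hx.ne'
    rw [mul_zero, mul_one, eq_inv_smul_iff₀ hx.ne', ← intervalIntegral.integral_smul] at h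
    rw [← h, intervalIntegral.integral_of_le zero_le_one,
      intervalIntegral.integral_of_le zero_le_one, integral_Ioc_eq_integral_Ioo,
      integral_Ioc_eq_integral_Ioo]
    refine setIntegral_congr_fun measurableSet_Ioo fun b hb => ?_
    have e1 : x - x * b = x * (1 - b) := by ring
    have e2 : x ^ (c + d - 1) = x * (x ^ (c - 1) * x ^ (d - 1)) := by
      rw [show c + d - 1 = 1 + (c - 1) + (d - 1) by ring, Real.rpow_add hx, Real.rpow_add hx,
        Real.rpow_one, mul_assoc]
    have e3 : Complex.exp ((b * A + (1 - b) * B) * -(x : ℂ)) =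
        Complex.exp (A * -((x * b : ℝ) : ℂ)) * Complex.exp (B * -((x * (1 - b) : ℝ) : ℂ)) := by
      rw [← Complex.exp_add]; push_cast; ring_nf
    rw [e1, e2, e3, Real.mul_rpow hx.le hb.1.le, Real.mul_rpow hx.le (sub_nonneg.2 hb.2.le),
      Complex.real_smul]
    have hβ' : (ProbabilityTheory.beta c d : ℂ) ≠ 0 := by exact_mod_cast hβ.ne'
    push_cast
    field_simp
  rw [setIntegral_congr_fun measurableSet_Ioi inner, integral_integral_swap] at conv
  · have hG : (Real.Gamma (c + d) : ℂ) ≠ 0 := by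
      exact_mod_cast (Real.Gamma_pos_of_pos hcd).ne'
    have e : ∫ b : ℝ, (∫ x : ℝ in Set.Ioi 0, (ProbabilityTheory.beta c d : ℂ) *
        (Complex.exp ((b * A + (1 - b) * B) * -(x : ℂ)) * ((x ^ (c + d - 1) : ℝ) : ℂ))) ∂β =
        (ProbabilityTheory.beta c d : ℂ) * Real.Gamma (c + d) *
          ∫ b : ℝ, negPow (c + d) (b * A + (1 - b) * B) ∂β := by
      rw [← integral_const_mul]
      refine integral_congr_ae ?_
      filter_upwards [ae_betaMeasure_mem_Ioo c d] with b hb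
      rw [integral_const_mul, integral_rpow_mul_cexp hcd (hm0.trans_le (hre b hb)), mul_assoc]
    rw [e, ProbabilityTheory.beta] at conv
    have hGc : (Real.Gamma c : ℂ) ≠ 0 := by exact_mod_cast (Real.Gamma_pos_of_pos hc).ne'
    have hGd : (Real.Gamma d : ℂ) ≠ 0 := by exact_mod_cast (Real.Gamma_pos_of_pos hd).ne'
    push_cast at conv
    rw [div_mul_cancel₀ _ hG] at conv
    apply mul_left_cancel₀ (mul_ne_zero hGc hGd)
    rw [conv]; ring
  · have hx := (integrableOn_rpow_mul_exp hcd hm0).const_mul (ProbabilityTheory.beta c d)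
    refine Integrable.mono' (hx.comp_fst β) (Measurable.aestronglyMeasurable (by
      unfold Function.uncurry; fun_prop)) ?_
    have h1 : ∀ᵐ p ∂((volume.restrict (Set.Ioi (0 : ℝ))).prod β), p.1 ∈ Set.Ioi (0 : ℝ) :=
      Measure.quasiMeasurePreserving_fst.ae (ae_restrict_mem measurableSet_Ioi)
    have h2 : ∀ᵐ p ∂((volume.restrict (Set.Ioi (0 : ℝ))).prod β), p.2 ∈ Set.Ioo (0 : ℝ) 1 :=
      Measure.quasiMeasurePreserving_snd.ae (ae_betaMeasure_mem_Ioo c d)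
    filter_upwards [h1, h2] with p hp1 hp2
    have hp1' : 0 < p.1 := hp1
    have := hre p.2 hp2
    simp only [Function.uncurry, norm_mul, Complex.norm_exp, Complex.norm_real,
      Real.norm_of_nonneg hβ.le, Real.norm_of_nonneg (Real.rpow_nonneg hp1'.le _)]
    rw [mul_comm (Real.exp _)]
    gcongr
    rw [← Complex.ofReal_neg, Complex.re_mul_ofReal]
    nlinarith

/-- Multiplying a beta density by `b` gives, up to the mean, the density with `c` raised by one;
likewise for `1 - b` and `d`. These means are the weights in the convex inequality for beta
mixtures. -/
theorem lintegral_ofReal_betaMeasure {c d : ℝ} (hc : 0 < c) (hd : 0 < d) :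
    ∫⁻ b, ENNReal.ofReal b ∂ProbabilityTheory.betaMeasure c d = ENNReal.ofReal (c / (c + d)) ∧
    ∫⁻ b, ENNReal.ofReal (1 - b) ∂ProbabilityTheory.betaMeasure c d =
      ENNReal.ofReal (d / (c + d)) := by
  have hcd : 0 < c + d := by positivity
  have hm : ∀ a b, Measurable (ProbabilityTheory.betaPDF a b) := fun a b => by
    unfold ProbabilityTheory.betaPDF; fun_prop
  have G0 := (Real.Gamma_pos_of_pos hcd).ne'
  have G1 := (Real.Gamma_pos_of_pos hc).ne'
  have G2 := (Real.Gamma_pos_of_pos hd).ne'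
  have e1 : ProbabilityTheory.beta (c + 1) d = ProbabilityTheory.beta c d * (c / (c + d)) := by
    rw [ProbabilityTheory.beta, ProbabilityTheory.beta, show c + 1 + d = c + d + 1 by ring,
      Real.Gamma_add_one hc.ne', Real.Gamma_add_one hcd.ne']
    field_simp
  have e2 : ProbabilityTheory.beta c (d + 1) = ProbabilityTheory.beta c d * (d / (c + d)) := by
    rw [ProbabilityTheory.beta, ProbabilityTheory.beta, ← add_assoc,
      Real.Gamma_add_one hd.ne', Real.Gamma_add_one hcd.ne']
    field_simp
  have hβ := ProbabilityTheory.beta_pos hc hd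
  constructor
  · rw [ProbabilityTheory.betaMeasure, lintegral_withDensity_eq_lintegral_mul _ (hm c d)
      (by fun_prop), ← mul_one (ENNReal.ofReal (c / (c + d))),
      ← ProbabilityTheory.lintegral_betaPDF_eq_one (show 0 < c + 1 by positivity) hd,
      ← lintegral_const_mul _ (hm _ _)]
    refine lintegral_congr fun b => ?_
    rw [Pi.mul_apply, ProbabilityTheory.betaPDF_eq, ProbabilityTheory.betaPDF_eq]
    split_ifs with hb
    · rw [← ENNReal.ofReal_mul (by have := Real.rpow_nonneg hb.1.le (c - 1)
                                   have := Real.rpow_nonneg (sub_nonneg.2 hb.2.le) (d - 1)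
                                   positivity),
        ← ENNReal.ofReal_mul (by positivity), e1,
        show b ^ (c + 1 - 1) = b ^ (c - 1) * b by
          rw [← Real.rpow_add_one hb.1.ne']; ring_nf]
      congr 1
      field_simp
    · simp
  · rw [ProbabilityTheory.betaMeasure, lintegral_withDensity_eq_lintegral_mul _ (hm c d)
      (by fun_prop), ← mul_one (ENNReal.ofReal (d / (c + d))),
      ← ProbabilityTheory.lintegral_betaPDF_eq_one hc (show 0 < d + 1 by positivity),
      ← lintegral_const_mul _ (hm _ _)]
    refine lintegral_congr fun b => ?_
    rw [Pi.mul_apply, ProbabilityTheory.betaPDF_eq, ProbabilityTheory.betaPDF_eq]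
    split_ifs with hb
    · rw [← ENNReal.ofReal_mul (by have := Real.rpow_nonneg hb.1.le (c - 1)
                                   have := Real.rpow_nonneg (sub_nonneg.2 hb.2.le) (d - 1)
                                   positivity),
        ← ENNReal.ofReal_mul (by positivity), e2,
        show (1 - b) ^ (d + 1 - 1) = (1 - b) ^ (d - 1) * (1 - b) by
          rw [← Real.rpow_add_one (sub_pos.2 hb.2).ne']; ring_nf]
      congr 1
      field_simp
    · simp

/-! ### Beta mixtures and finitely supported measures -/

theorem re_le_norm_add_mul_I (w : ℂ) (x : ℝ) : w.re ≤ ‖w + x * Complex.I‖ := by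
  have := Complex.re_le_norm (w + x * Complex.I)
  simpa using this

theorem norm_negPow_add_mul_I_le {c : ℝ} (hc : 0 ≤ c) {w : ℂ} (hw : 0 < w.re) (x : ℝ) :
    ‖negPow c (w + x * Complex.I)‖ ≤ w.re ^ (-c) :=
  norm_negPow_le hc hw (re_le_norm_add_mul_I w x)

theorem integrable_negPow_add_mul_I {c : ℝ} (hc : 0 ≤ c) {w : ℂ} (hw : 0 < w.re) {α : Type*}
    [MeasurableSpace α] {ν : Measure α} [IsFiniteMeasure ν] {X : α → ℝ} (hX : Measurable X) :
    Integrable (fun x => negPow c (w + X x * Complex.I)) ν :=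
  Integrable.of_bound (Measurable.aestronglyMeasurable (by fun_prop)) _
    (Eventually.of_forall fun x => norm_negPow_add_mul_I_le hc hw (X x))

/-- Mixing two probability measures with a beta-distributed weight multiplies the generalised
Cauchy-Stieltjes transforms. -/
theorem exists_beta_mixture {c d : ℝ} (hc : 0 < c) (hd : 0 < d) (ν₁ ν₂ : Measure ℝ)
    [IsProbabilityMeasure ν₁] [IsProbabilityMeasure ν₂] :
    ∃ ν : Measure ℝ, IsProbabilityMeasure ν ∧
      (∀ w : ℂ, 0 < w.re → ∫ x : ℝ, negPow (c + d) (w + x * Complex.I) ∂ν =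
        (∫ x : ℝ, negPow c (w + x * Complex.I) ∂ν₁) *
          ∫ x : ℝ, negPow d (w + x * Complex.I) ∂ν₂) ∧
      ∀ f : ℝ → ℝ, ConvexOn ℝ Set.univ f → Continuous f → (∀ x, 0 ≤ f x) →
        ENNReal.ofReal (c + d) * ∫⁻ x, ENNReal.ofReal (f x) ∂ν ≤
          ENNReal.ofReal c * ∫⁻ x, ENNReal.ofReal (f x) ∂ν₁ +
            ENNReal.ofReal d * ∫⁻ x, ENNReal.ofReal (f x) ∂ν₂ := by
  have hcd : 0 < c + d := by positivity
  have := ProbabilityTheory.isProbabilityMeasureBeta hc hd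
  set β := ProbabilityTheory.betaMeasure c d with hβ
  -- The measure is the law of `b X + (1 - b) Y` with independent `X ∼ ν₁`, `Y ∼ ν₂` and `b ∼ β`.
  -- Feynman's formula is applied for fixed `X` and `Y`, with `A = w + i X` and `B = w + i Y`.
  let T : (ℝ × ℝ) × ℝ → ℝ := fun p => p.2 * p.1.1 + (1 - p.2) * p.1.2
  have hT : Measurable T := by fun_prop
  refine ⟨((ν₁.prod ν₂).prod β).map T, Measure.isProbabilityMeasure_map hT.aemeasurable, ?_, ?_⟩
  · intro w hw
    rw [integral_map hT.aemeasurable (Measurable.aestronglyMeasurable (by fun_prop)),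
      integral_prod _ (integrable_negPow_add_mul_I hcd.le hw hT), ← integral_prod_mul]
    refine integral_congr_ae (Eventually.of_forall fun p => ?_)
    dsimp only
    rw [← integral_negPow_betaMeasure hc hd (A := w + p.1 * Complex.I) (B := w + p.2 * Complex.I)
      (by simpa using hw) (by simpa using hw)]
    refine integral_congr_ae (Eventually.of_forall fun b => ?_)
    simp only [T]
    push_cast
    ring_nf
  · intro f hf hfc hf0
    have hfm : Measurable f := hfc.measurable
    rw [lintegral_map (by fun_prop) hT, lintegral_prod _ (by fun_prop)]
    -- Convexity between the two points, followed by the mean of the beta weight.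
    have hle : ∀ p : ℝ × ℝ, ∫⁻ b, ENNReal.ofReal (f (T (p, b))) ∂β ≤
        ENNReal.ofReal (c / (c + d)) * ENNReal.ofReal (f p.1) +
          ENNReal.ofReal (d / (c + d)) * ENNReal.ofReal (f p.2) := by
      intro p
      rw [← (lintegral_ofReal_betaMeasure hc hd).1, ← (lintegral_ofReal_betaMeasure hc hd).2,
        ← lintegral_mul_const _ (by fun_prop), ← lintegral_mul_const _ (by fun_prop),
        ← lintegral_add_left (by fun_prop)]
      refine lintegral_mono_ae ?_
      filter_upwards [ae_betaMeasure_mem_Ioo c d] with b hb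
      rw [← ENNReal.ofReal_mul hb.1.le, ← ENNReal.ofReal_mul (sub_nonneg.2 hb.2.le),
        ← ENNReal.ofReal_add (mul_nonneg hb.1.le (hf0 _))
          (mul_nonneg (sub_nonneg.2 hb.2.le) (hf0 _))]
      refine ENNReal.ofReal_le_ofReal ?_
      exact hf.2 (Set.mem_univ p.1) (Set.mem_univ p.2) hb.1.le (sub_nonneg.2 hb.2.le) (by ring)
    calc ENNReal.ofReal (c + d) * ∫⁻ p, (∫⁻ b, ENNReal.ofReal (f (T (p, b))) ∂β) ∂(ν₁.prod ν₂)
        ≤ ENNReal.ofReal (c + d) * ∫⁻ p : ℝ × ℝ,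
            (ENNReal.ofReal (c / (c + d)) * ENNReal.ofReal (f p.1) +
              ENNReal.ofReal (d / (c + d)) * ENNReal.ofReal (f p.2)) ∂(ν₁.prod ν₂) := by
          gcongr with p
          exact hle p
      _ = _ := by
          rw [lintegral_add_left (by fun_prop), lintegral_const_mul _ (by fun_prop),
            lintegral_const_mul _ (by fun_prop), mul_add, ← mul_assoc, ← mul_assoc,
            ← ENNReal.ofReal_mul hcd.le, ← ENNReal.ofReal_mul hcd.le,
            mul_div_cancel₀ _ hcd.ne', mul_div_cancel₀ _ hcd.ne',
            lintegral_prod _ (by fun_prop), lintegral_prod _ (by fun_prop)]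
          simp

/-- The Markov-Krein transform of a finitely supported measure. -/
theorem exists_markovKrein_finset {ι : Type*} {S : Finset ι} (hS : S.Nonempty) (p s : ι → ℝ)
    (hp : ∀ i ∈ S, 0 < p i) :
    ∃ ν : Measure ℝ, IsProbabilityMeasure ν ∧
      (∀ w : ℂ, 0 < w.re → ∫ x : ℝ, negPow (∑ i ∈ S, p i) (w + x * Complex.I) ∂ν =
        Complex.exp (-∑ i ∈ S, (p i : ℂ) * Complex.log (w + s i * Complex.I))) ∧
      ∀ f : ℝ → ℝ, ConvexOn ℝ Set.univ f → Continuous f → (∀ x, 0 ≤ f x) →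
        ENNReal.ofReal (∑ i ∈ S, p i) * ∫⁻ x, ENNReal.ofReal (f x) ∂ν ≤
          ∑ i ∈ S, ENNReal.ofReal (p i) * ENNReal.ofReal (f (s i)) := by
  induction hS using Finset.Nonempty.cons_induction with
  | singleton i =>
    refine ⟨Measure.dirac (s i), inferInstance, fun w _ => ?_, fun f _ hf _ => ?_⟩
    · simp [negPow]
    · have hfm := hf.measurable
      simp
  | cons i S hi hS ih =>
    obtain ⟨ν₂, h1, h2, h3⟩ := ih fun j hj => hp j (Finset.mem_cons_of_mem hj)
    have hd : 0 < ∑ j ∈ S, p j :=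
      Finset.sum_pos (fun j hj => hp j (Finset.mem_cons_of_mem hj)) hS
    obtain ⟨ν, g1, g2, g3⟩ := exists_beta_mixture (hp i (Finset.mem_cons_self i S)) hd
      (Measure.dirac (s i)) ν₂
    refine ⟨ν, g1, fun w hw => ?_, fun f hf hfc hf0 => ?_⟩
    · rw [Finset.sum_cons, g2 w hw, h2 w hw, integral_dirac, negPow, ← Complex.exp_add,
        Finset.sum_cons]
      ring_nf
    · have hfm := hfc.measurable
      rw [Finset.sum_cons, Finset.sum_cons]
      refine (g3 f hf hfc hf0).trans ?_
      rw [lintegral_dirac]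
      gcongr
      exact h3 f hf hfc hf0

/-! ### The transform determines the measure -/

theorem continuous_charFun_real (ν : Measure ℝ) [IsFiniteMeasure ν] :
    Continuous fun t : ℝ => charFun ν t := by
  simp_rw [charFun_apply_real]
  refine continuous_of_dominated (bound := fun _ => 1)
    (fun t => Measurable.aestronglyMeasurable (by fun_prop)) (fun t => ?_) (integrable_const _) ?_
  · refine Eventually.of_forall fun x => ?_
    rw [← Complex.ofReal_mul, Complex.norm_exp_ofReal_mul_I]
  · exact Eventually.of_forall fun x => by fun_prop

/-- The generalised Cauchy-Stieltjes transform as a Laplace transform of the characteristic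
function. -/
theorem Gamma_mul_integral_negPow {c : ℝ} (hc : 0 < c) (ν : Measure ℝ) [IsFiniteMeasure ν] {w : ℂ}
    (hw : 0 < w.re) :
    Real.Gamma c * ∫ x : ℝ, negPow c (w + x * Complex.I) ∂ν =
      ∫ r : ℝ in Set.Ioi 0,
        Complex.exp (w * (-(r : ℂ))) * ((r ^ (c - 1) : ℝ) : ℂ) * charFun ν (-r) := by
  calc Real.Gamma c * ∫ x : ℝ, negPow c (w + x * Complex.I) ∂ν
      = ∫ x : ℝ, (∫ r : ℝ in Set.Ioi 0, Complex.exp ((w + x * Complex.I) * (-(r : ℂ))) *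
          ((r ^ (c - 1) : ℝ) : ℂ)) ∂ν := by
        rw [← integral_const_mul]
        refine integral_congr_ae (Eventually.of_forall fun x => ?_)
        dsimp only
        rw [integral_rpow_mul_cexp hc (by simpa using hw)]
    _ = ∫ r : ℝ in Set.Ioi 0, (∫ x : ℝ, Complex.exp ((w + x * Complex.I) * (-(r : ℂ))) *
          ((r ^ (c - 1) : ℝ) : ℂ) ∂ν) := by
        refine integral_integral_swap ?_
        refine Integrable.mono' ((integrableOn_rpow_mul_exp hc hw).comp_snd ν)
          (Measurable.aestronglyMeasurable (by unfold Function.uncurry; fun_prop)) ?_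
        have h1 : ∀ᵐ p ∂(ν.prod (volume.restrict (Set.Ioi (0 : ℝ)))), p.2 ∈ Set.Ioi (0 : ℝ) :=
          Measure.quasiMeasurePreserving_snd.ae (ae_restrict_mem measurableSet_Ioi)
        filter_upwards [h1] with p hp
        have hp' : 0 < p.2 := hp
        simp [Function.uncurry, Complex.norm_exp, abs_of_nonneg (Real.rpow_nonneg hp'.le _),
          mul_comm]
    _ = _ := by
        refine integral_congr_ae (Eventually.of_forall fun r => ?_)
        dsimp only
        rw [charFun_apply_real, ← integral_const_mul]
        refine integral_congr_ae (Eventually.of_forall fun x => ?_)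
        dsimp only
        rw [mul_right_comm, ← Complex.exp_add]
        push_cast
        ring_nf

/-- The generalised Cauchy-Stieltjes transform determines the measure. -/
theorem eq_of_integral_negPow_eq {c : ℝ} (hc : 0 < c) {ν₁ ν₂ : Measure ℝ}
    [IsProbabilityMeasure ν₁] [IsProbabilityMeasure ν₂]
    (h : ∀ w : ℂ, 0 < w.re → ∫ x : ℝ, negPow c (w + x * Complex.I) ∂ν₁ =
      ∫ x : ℝ, negPow c (w + x * Complex.I) ∂ν₂) : ν₁ = ν₂ := by
  -- The choice `w = 1` supplies the damping `e^(-r)` that makes `G` integrable on the half-line.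
  -- The Fourier transform at `ξ` is then the difference of the Laplace transforms at `w = 1 + 2 π i
  -- ξ`, which vanishes by hypothesis.
  set G : ℝ → ℂ := fun r => Complex.exp (1 * (-(r : ℂ))) * ((r ^ (c - 1) : ℝ) : ℂ) *
    (charFun ν₁ (-r) - charFun ν₂ (-r)) with hG
  set g : ℝ → ℂ := (Set.Ioi (0 : ℝ)).indicator G with hg
  have c1 := continuous_charFun_real ν₁
  have c2 := continuous_charFun_real ν₂
  have hint : ∀ (ν : Measure ℝ) [IsProbabilityMeasure ν] {w : ℂ}, 0 < w.re → IntegrableOn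
      (fun r : ℝ => Complex.exp (w * (-(r : ℂ))) * ((r ^ (c - 1) : ℝ) : ℂ) * charFun ν (-r))
      (Set.Ioi 0) := by
    intro ν _ w hw
    have hcc := continuous_charFun_real ν
    refine (integrableOn_rpow_mul_cexp hc hw).mul_bdd (c := 1)
      (Continuous.aestronglyMeasurable (by fun_prop)) (Eventually.of_forall fun r => ?_)
    exact norm_charFun_le_one _
  have hgi : Integrable g := by
    rw [hg, integrable_indicator_iff measurableSet_Ioi]
    refine ((hint ν₁ (w := 1) (by simp)).sub (hint ν₂ (w := 1) (by simp))).congr ?_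
    refine Eventually.of_forall fun r => ?_
    simp only [hG, Pi.sub_apply]
    ring
  have hF : FourierTransform.fourier g = 0 := by
    ext ξ
    rw [Real.fourier_real_eq_integral_exp_smul, Pi.zero_apply]
    have hw : 0 < (1 + 2 * Real.pi * ξ * Complex.I : ℂ).re := by simp
    have e1 := Gamma_mul_integral_negPow hc ν₁ hw
    have e2 := Gamma_mul_integral_negPow hc ν₂ hw
    rw [h _ hw, e2, eq_comm, ← sub_eq_zero, ← integral_sub (hint ν₁ hw) (hint ν₂ hw)] at e1
    rw [← e1, ← integral_indicator measurableSet_Ioi]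
    refine integral_congr_ae (Eventually.of_forall fun r => ?_)
    simp only [hg, Set.indicator_apply]
    split_ifs with hr
    · simp only [hG, smul_eq_mul]
      rw [show ∀ a b c d : ℂ, a * (b * c * d) = (a * b) * c * d by intros; ring,
        ← Complex.exp_add, ← mul_sub]
      push_cast
      ring_nf
    · simp
  -- At `r > 0` the function `g` is continuous, so Fourier inversion gives its value at that very
  -- point, and the factors in front of the difference do not vanish.
  have hpos : ∀ r : ℝ, 0 < r → charFun ν₁ (-r) = charFun ν₂ (-r) := by
    intro r hr
    have hcont : ContinuousAt g r := by
      have h1 : ContinuousAt G r := by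
        have hp : ContinuousAt (fun r : ℝ => r ^ (c - 1)) r :=
          Real.continuousAt_rpow_const _ _ (Or.inl hr.ne')
        have hp' : ContinuousAt (fun r : ℝ => ((r ^ (c - 1) : ℝ) : ℂ)) r :=
          Complex.continuous_ofReal.continuousAt.comp hp
        exact (ContinuousAt.mul (by fun_prop) hp').mul (by fun_prop)
      refine h1.congr ?_
      filter_upwards [lt_mem_nhds hr] with x hx
      rw [hg, Set.indicator_of_mem (by exact hx)]
    have hinv := hgi.fourierInv_fourier_eq (by rw [hF]; exact integrable_zero _ _ _) hcont
    rw [hF, Real.fourierInv_eq'] at hinv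
    simp only [Pi.zero_apply, smul_zero, integral_zero] at hinv
    rw [hg, Set.indicator_of_mem (by exact hr), hG, eq_comm, mul_eq_zero, mul_eq_zero] at hinv
    rcases hinv with (h1 | h1) | h1
    · exact absurd h1 (Complex.exp_ne_zero _)
    · exact absurd (by exact_mod_cast h1) (Real.rpow_pos_of_pos hr _).ne'
    · exact sub_eq_zero.1 h1
  refine Measure.ext_of_charFun (funext fun t => ?_)
  rcases lt_trichotomy t 0 with ht | rfl | ht
  · simpa using hpos (-t) (by linarith)
  · simp
  · have := congrArg (starRingEnd ℂ) (hpos t ht)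
    rwa [← charFun_neg, ← charFun_neg, neg_neg] at this

/-! ### The correspondence in the right half-plane -/

/-- The Markov-Krein correspondence in terms of `w` with `z = i w` in the upper half-plane. -/
def HalfPlaneMarkovKrein (c : ℝ) (ρ ν : Measure ℝ) : Prop :=
  ∀ w : ℂ, 0 < w.re → ∫ x : ℝ, negPow c (w + x * Complex.I) ∂ν =
    Complex.exp (-(c : ℂ) * ∫ s : ℝ, Complex.log (w + s * Complex.I) ∂ρ)

/-- The dependence on `s` is only through `log (1 + s ^ 2)`, so the logarithmic moment makes the
potential converge. The bound increases with `|s|` and therefore also dominates approximations that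
move `s` towards `0`. -/
theorem norm_log_add_mul_I_le {w : ℂ} (hw : 0 < w.re) (s : ℝ) :
    ‖Complex.log (w + s * Complex.I)‖ ≤
      |Real.log w.re| + Real.log (2 * (1 + ‖w‖)) + Real.pi + Real.log (1 + s ^ 2) := by
  have h1 := re_le_norm_add_mul_I w s
  have h0 : 0 < ‖w + s * Complex.I‖ := hw.trans_le h1
  have h2 : ‖w + s * Complex.I‖ ≤ 2 * (1 + ‖w‖) * (1 + s ^ 2) := by
    have h3 : ‖w + s * Complex.I‖ ≤ ‖w‖ + |s| := by
      simpa using norm_add_le w (s * Complex.I)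
    have h4 : |s| ≤ 1 + s ^ 2 := by nlinarith [sq_abs s, sq_nonneg (|s| - 1), abs_nonneg s]
    nlinarith [norm_nonneg w, mul_nonneg (norm_nonneg w) (sq_nonneg s)]
  have hl1 : Real.log w.re ≤ Real.log ‖w + s * Complex.I‖ := Real.log_le_log hw h1
  have hl2 : Real.log ‖w + s * Complex.I‖ ≤ Real.log (2 * (1 + ‖w‖)) + Real.log (1 + s ^ 2) := by
    rw [← Real.log_mul (by positivity) (by positivity)]
    exact Real.log_le_log h0 h2
  have hp1 : 0 ≤ Real.log (2 * (1 + ‖w‖)) := Real.log_nonneg (by linarith [norm_nonneg w])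
  have hp2 : 0 ≤ Real.log (1 + s ^ 2) := Real.log_nonneg (by nlinarith [sq_nonneg s])
  have h5 := Complex.norm_le_abs_re_add_abs_im (Complex.log (w + s * Complex.I))
  rw [Complex.log_re, Complex.log_im] at h5
  have h6 := Complex.abs_arg_le_pi (w + s * Complex.I)
  have h7 : |Real.log ‖w + s * Complex.I‖| ≤
      |Real.log w.re| + Real.log (2 * (1 + ‖w‖)) + Real.log (1 + s ^ 2) :=
    abs_le.2 ⟨by linarith [neg_abs_le (Real.log w.re)], by linarith [abs_nonneg (Real.log w.re)]⟩
  linarith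

theorem integrable_log_add_mul_I {ρ : Measure ℝ} [IsFiniteMeasure ρ]
    (hρ : Integrable (fun x : ℝ => Real.log (1 + x ^ 2)) ρ) {w : ℂ} (hw : 0 < w.re) :
    Integrable (fun s : ℝ => Complex.log (w + s * Complex.I)) ρ :=
  Integrable.mono' ((integrable_const _).add hρ) (Measurable.aestronglyMeasurable (by fun_prop))
    (Eventually.of_forall fun s => norm_log_add_mul_I_le hw s)

theorem log_I_mul {v : ℂ} (hv : 0 < v.re) :
    Complex.log (Complex.I * v) = Complex.log v + (Real.pi / 2 : ℝ) * Complex.I := by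
  have hv0 : v ≠ 0 := by rintro rfl; simp at hv
  have ha := Complex.abs_arg_lt_pi_div_two_iff.2 (Or.inl hv)
  rw [abs_lt] at ha
  have hpi := Real.pi_pos
  rw [(Complex.log_mul_eq_add_log_iff Complex.I_ne_zero hv0).2
    (by rw [Complex.arg_I]; constructor <;> linarith [ha.1, ha.2]), Complex.log_I]
  push_cast; ring

theorem log_neg_I_mul {v : ℂ} (hv : 0 < v.re) :
    Complex.log (-Complex.I * v) = Complex.log v - (Real.pi / 2 : ℝ) * Complex.I := by
  have hv0 : v ≠ 0 := by rintro rfl; simp at hv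
  have ha := Complex.abs_arg_lt_pi_div_two_iff.2 (Or.inl hv)
  rw [abs_lt] at ha
  have hpi := Real.pi_pos
  rw [(Complex.log_mul_eq_add_log_iff (neg_ne_zero.2 Complex.I_ne_zero) hv0).2
    (by rw [Complex.arg_neg_I]; constructor <;> linarith [ha.1, ha.2]), Complex.log_neg_I]
  push_cast; ring

theorem conj_add_mul_I (w : ℂ) (x : ℝ) :
    starRingEnd ℂ w + x * Complex.I = starRingEnd ℂ (w - x * Complex.I) := by
  simp

theorem log_conj_of_re_pos {v : ℂ} (hv : 0 < v.re) :
    Complex.log (starRingEnd ℂ v) = starRingEnd ℂ (Complex.log v) := by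
  refine Complex.log_conj v fun h => ?_
  have := Complex.abs_arg_lt_pi_div_two_iff.2 (Or.inl hv)
  rw [h, abs_of_pos Real.pi_pos] at this
  linarith [Real.pi_pos]

theorem negPow_conj_of_re_pos (c : ℝ) {v : ℂ} (hv : 0 < v.re) :
    negPow c (starRingEnd ℂ v) = starRingEnd ℂ (negPow c v) := by
  rw [negPow, negPow, log_conj_of_re_pos hv, ← Complex.exp_conj]
  simp

/-- Complex conjugation of the identity at the conjugate of `w`. It covers the lower half-plane of
`z`. -/
theorem HalfPlaneMarkovKrein.integral_negPow_sub {c : ℝ} {ρ ν : Measure ℝ}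
    (h : HalfPlaneMarkovKrein c ρ ν) {w : ℂ} (hw : 0 < w.re) :
    ∫ x : ℝ, negPow c (w - x * Complex.I) ∂ν =
      Complex.exp (-(c : ℂ) * ∫ s : ℝ, Complex.log (w - s * Complex.I) ∂ρ) := by
  have h1 := congrArg (starRingEnd ℂ) (h (starRingEnd ℂ w) (by simpa using hw))
  have e : ∀ x : ℝ, 0 < (w - x * Complex.I).re := fun x => by simpa using hw
  simp_rw [conj_add_mul_I, negPow_conj_of_re_pos c (e _), log_conj_of_re_pos (e _),
    integral_conj] at h1
  rw [Complex.conj_conj, ← Complex.exp_conj] at h1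
  simpa using h1

/-- For `z = i w` one has `z - x = i (w + i x)`, and `log (i v) = log v + i π / 2` when `Re v > 0`.
As `ρ` has mass one, both sides acquire the same factor `e^(-i π c / 2)`. The lower half-plane is
the conjugate case. -/
theorem isMarkovKrein_iff {c : ℝ} {ρ ν : Measure ℝ} [IsProbabilityMeasure ρ]
    (hρ : Integrable (fun x : ℝ => Real.log (1 + x ^ 2)) ρ) :
    IsMarkovKrein c ρ ν ↔ IsProbabilityMeasure ν ∧ HalfPlaneMarkovKrein c ρ ν := by
  have key : ∀ w : ℂ, 0 < w.re →
      ((∫ x : ℝ, 1 / (Complex.I * w - (x : ℂ)) ^ (c : ℂ) ∂ν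
        = Complex.exp (-(c : ℂ) * ∫ s : ℝ, Complex.log (Complex.I * w - (s : ℂ)) ∂ρ)) ↔
      ∫ x : ℝ, negPow c (w + x * Complex.I) ∂ν =
        Complex.exp (-(c : ℂ) * ∫ s : ℝ, Complex.log (w + s * Complex.I) ∂ρ)) := by
    intro w hw
    have hre : ∀ x : ℝ, 0 < (w + x * Complex.I).re := fun x => by simpa using hw
    have e1 : ∀ x : ℝ, Complex.I * w - (x : ℂ) = Complex.I * (w + x * Complex.I) := fun x => by
      linear_combination -(x : ℂ) * Complex.I_mul_I
    have e2 : ∀ x : ℝ, 1 / (Complex.I * (w + x * Complex.I)) ^ (c : ℂ) =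
        Complex.exp (-(c : ℂ) * ((Real.pi / 2 : ℝ) * Complex.I)) *
          negPow c (w + x * Complex.I) := fun x => by
      rw [one_div_cpow_eq_negPow c (mul_ne_zero Complex.I_ne_zero
        (fun h => by have := hre x; rw [h] at this; simp at this)), negPow, log_I_mul (hre x),
        mul_add, Complex.exp_add, negPow, mul_comm]
    simp_rw [e1, e2, log_I_mul (hre _)]
    rw [integral_const_mul, integral_add (integrable_log_add_mul_I hρ hw) (integrable_const _),
      integral_const, probReal_univ, one_smul, mul_add, Complex.exp_add, mul_comm,
      mul_left_inj' (Complex.exp_ne_zero _)]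
  constructor
  · rintro ⟨h1, h2⟩
    exact ⟨h1, fun w hw => (key w hw).1 (h2 _ (by simpa using hw.ne'))⟩
  · rintro ⟨h1, h2⟩
    refine ⟨h1, fun z hz => ?_⟩
    rcases lt_or_gt_of_ne hz with hz | hz
    · set w := Complex.I * z with hw
      have hwre : 0 < w.re := by simpa [hw] using hz
      have hre : ∀ x : ℝ, 0 < (w - x * Complex.I).re := fun x => by simpa using hwre
      have e1 : ∀ x : ℝ, z - (x : ℂ) = -Complex.I * (w - x * Complex.I) := fun x => by
        rw [hw]; linear_combination (z - x) * Complex.I_mul_I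
      have e2 : ∀ x : ℝ, 1 / (-Complex.I * (w - x * Complex.I)) ^ (c : ℂ) =
          Complex.exp ((c : ℂ) * ((Real.pi / 2 : ℝ) * Complex.I)) *
            negPow c (w - x * Complex.I) := fun x => by
        rw [one_div_cpow_eq_negPow c (mul_ne_zero (neg_ne_zero.2 Complex.I_ne_zero)
          (fun h => by have := hre x; rw [h] at this; simp at this)), negPow,
          log_neg_I_mul (hre x), negPow, ← Complex.exp_add]
        ring_nf
      have hint : Integrable (fun s : ℝ => Complex.log (w - s * Complex.I)) ρ := by
        refine (integrable_log_add_mul_I hρ (w := starRingEnd ℂ w) (by simpa using hwre)).mono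
          (Measurable.aestronglyMeasurable (by fun_prop)) (Eventually.of_forall fun s => ?_)
        rw [conj_add_mul_I, log_conj_of_re_pos (hre s), RCLike.norm_conj]
      simp_rw [e1, e2, log_neg_I_mul (hre _)]
      rw [integral_const_mul, h2.integral_negPow_sub hwre, integral_sub hint (integrable_const _),
        integral_const, probReal_univ, one_smul, mul_sub, ← Complex.exp_add]
      ring_nf
    · have e : z = Complex.I * (-Complex.I * z) := by
        linear_combination z * Complex.I_mul_I
      rw [e]
      exact (key _ (by simpa using hz)).2 (h2 _ (by simpa using hz))

/-! ### Tightness and compactness -/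

/-- Tail bound for the Markov-Krein transform. -/
theorem HalfPlaneMarkovKrein.measureReal_le {c : ℝ} (hc : 0 < c) {ρ ν : Measure ℝ}
    [IsProbabilityMeasure ρ] [IsProbabilityMeasure ν]
    (hρ : Integrable (fun x : ℝ => Real.log (1 + x ^ 2)) ρ) (h : HalfPlaneMarkovKrein c ρ ν)
    {y : ℝ} (hy : 0 < y) :
    (1 - 2 ^ (-(c / 2))) * ν.real {x | y ≤ |x|} ≤
      1 - Real.exp (-(c / 2) * ∫ s, Real.log (1 + (s / y) ^ 2) ∂ρ) := by
  have hyre : 0 < (y : ℂ).re := by simpa using hy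
  have hnorm : ∀ x : ℝ, ‖(y : ℂ) + x * Complex.I‖ = y * (1 + (x / y) ^ 2) ^ (1 / 2 : ℝ) := by
    intro x
    rw [Complex.norm_add_mul_I, ← Real.sqrt_eq_rpow,
      show y ^ 2 + x ^ 2 = y ^ 2 * (1 + (x / y) ^ 2) by field_simp,
      Real.sqrt_mul (sq_nonneg y), Real.sqrt_sq hy.le]
  have hpos : ∀ x : ℝ, 0 < 1 + (x / y) ^ 2 := fun x => by positivity
  have hint := integrable_log_add_mul_I hρ hyre
  have hre : ∀ s : ℝ, (Complex.log ((y : ℂ) + s * Complex.I)).re =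
      Real.log y + (1 / 2) * Real.log (1 + (s / y) ^ 2) := by
    intro s
    rw [Complex.log_re, hnorm, Real.log_mul hy.ne' (Real.rpow_pos_of_pos (hpos s) _).ne',
      Real.log_rpow (hpos s)]
  have hre_int : (∫ s : ℝ, Complex.log ((y : ℂ) + s * Complex.I) ∂ρ).re =
      Real.log y + (1 / 2) * ∫ s, Real.log (1 + (s / y) ^ 2) ∂ρ := by
    have e := integral_re hint
    rw [RCLike.re_eq_complex_re] at e
    rw [← e]
    have hi2 := hint.re
    rw [RCLike.re_eq_complex_re] at hi2
    simp_rw [hre] at hi2 ⊢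
    have hi3 : Integrable (fun s => (1 / 2) * Real.log (1 + (s / y) ^ 2)) ρ := by
      refine (hi2.sub (integrable_const (Real.log y))).congr (Eventually.of_forall fun s => ?_)
      simp
    rw [integral_add (integrable_const _) hi3, integral_const, probReal_univ, one_smul,
      integral_const_mul]
  -- The left side is the modulus of the transform at the real point `w = y`.
  have h1 : y ^ (-c) * Real.exp (-(c / 2) * ∫ s, Real.log (1 + (s / y) ^ 2) ∂ρ) ≤
      ∫ x : ℝ, ‖negPow c (y + x * Complex.I)‖ ∂ν := by
    refine le_trans (le_of_eq ?_) (norm_integral_le_integral_norm _)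
    rw [h y hyre, Complex.norm_exp, ← Complex.ofReal_neg, Complex.re_ofReal_mul, hre_int,
      Real.rpow_def_of_pos hy, ← Real.exp_add]
    generalize (∫ s, Real.log (1 + (s / y) ^ 2) ∂ρ) = J
    ring_nf
  have hmeas : MeasurableSet {x : ℝ | y ≤ |x|} :=
    measurableSet_le measurable_const (by fun_prop)
  -- The integrand is at most `y ^ (-c)` everywhere, and smaller by a factor `2 ^ (-(c / 2))` where
  -- `|x| ≥ y`. Mass in the tail therefore lowers the integral, which `h1` bounds from below.
  have h2 : ∫ x : ℝ, ‖negPow c (y + x * Complex.I)‖ ∂ν ≤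
      ∫ x : ℝ, y ^ (-c) * (1 - Set.indicator {x : ℝ | y ≤ |x|}
        (fun _ => 1 - (2 : ℝ) ^ (-(c / 2))) x) ∂ν := by
    refine integral_mono (integrable_negPow_add_mul_I hc.le hyre measurable_id).norm
      (((integrable_const _).sub ((integrable_const _).indicator hmeas)).const_mul _) fun x => ?_
    dsimp only
    rw [norm_negPow (norm_pos_iff.1 (hyre.trans_le (re_le_norm_add_mul_I _ x))), hnorm,
      Real.mul_rpow hy.le (Real.rpow_nonneg (hpos x).le _)]
    refine mul_le_mul_of_nonneg_left ?_ (Real.rpow_nonneg hy.le _)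
    rw [← Real.rpow_mul (hpos x).le, show 1 / 2 * -c = -(c / 2) by ring]
    by_cases hx : y ≤ |x|
    · rw [Set.indicator_of_mem (by exact hx), sub_sub_cancel]
      refine Real.rpow_le_rpow_of_nonpos (by norm_num) ?_ (by linarith)
      have : 1 ≤ (x / y) ^ 2 := by
        rw [div_pow, le_div_iff₀ (by positivity), one_mul, ← sq_abs x]
        exact pow_le_pow_left₀ hy.le hx 2
      linarith
    · rw [Set.indicator_of_notMem (by exact hx), sub_zero]
      exact Real.rpow_le_one_of_one_le_of_nonpos (by nlinarith [sq_nonneg (x / y)]) (by linarith)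
  have h3 := h1.trans h2
  rw [integral_const_mul, integral_sub (integrable_const _) ((integrable_const _).indicator hmeas),
    integral_indicator_const _ hmeas, integral_const, probReal_univ, one_smul] at h3
  have h4 := le_of_mul_le_mul_left h3 (Real.rpow_pos_of_pos hy _)
  rw [smul_eq_mul] at h4
  linarith

theorem integrable_log_comp {ρ : Measure ℝ}
    (hρ : Integrable (fun x : ℝ => Real.log (1 + x ^ 2)) ρ) {a : ℝ → ℝ} (ha : Measurable a)
    (hle : ∀ s, |a s| ≤ |s|) :
    Integrable (fun x : ℝ => Real.log (1 + x ^ 2)) (ρ.map a) := by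
  rw [integrable_map_measure (Measurable.aestronglyMeasurable (by fun_prop)) ha.aemeasurable]
  refine hρ.mono (Measurable.aestronglyMeasurable (by fun_prop)) (Eventually.of_forall fun s => ?_)
  have h0 : 0 ≤ a s ^ 2 := sq_nonneg _
  have h1 : a s ^ 2 ≤ s ^ 2 := sq_le_sq.2 (hle s)
  have h2 : 0 ≤ s ^ 2 := sq_nonneg _
  rw [Function.comp_apply, Real.norm_of_nonneg (Real.log_nonneg (by linarith)),
    Real.norm_of_nonneg (Real.log_nonneg (by linarith))]
  exact Real.log_le_log (by positivity) (by linarith)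

theorem integrable_log_one_add_div_sq {ρ : Measure ℝ}
    (hρ : Integrable (fun x : ℝ => Real.log (1 + x ^ 2)) ρ) {y : ℝ} (hy : 1 ≤ y) :
    Integrable (fun x : ℝ => Real.log (1 + (x / y) ^ 2)) ρ := by
  have := integrable_log_comp hρ (a := fun s => s / y) (by fun_prop) (fun s => by
    rw [abs_div, abs_of_pos (by linarith : 0 < y)]
    exact div_le_self (abs_nonneg _) hy)
  rwa [integrable_map_measure (Measurable.aestronglyMeasurable (by fun_prop)) (by fun_prop)] at this

/-- This is where the logarithmic moment yields tightness: it makes the tail bound tend to `0`. -/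
theorem tendsto_integral_log_one_add_div_sq {ρ : Measure ℝ}
    (hρ : Integrable (fun x : ℝ => Real.log (1 + x ^ 2)) ρ) :
    Tendsto (fun y : ℝ => ∫ x, Real.log (1 + (x / y) ^ 2) ∂ρ) atTop (𝓝 0) := by
  rw [← integral_zero ℝ ℝ (μ := ρ)]
  refine tendsto_integral_filter_of_dominated_convergence _
    (Eventually.of_forall fun y => Measurable.aestronglyMeasurable (by fun_prop)) ?_ hρ ?_
  · filter_upwards [eventually_ge_atTop 1] with y hy
    refine Eventually.of_forall fun x => ?_
    have h1 : (x / y) ^ 2 ≤ x ^ 2 := by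
      rw [div_pow]; exact div_le_self (sq_nonneg _) (by nlinarith)
    have h0 : 0 ≤ (x / y) ^ 2 := sq_nonneg _
    rw [Real.norm_of_nonneg (Real.log_nonneg (by linarith))]
    exact Real.log_le_log (by positivity) (by linarith)
  · refine Eventually.of_forall fun x => ?_
    have h1 : Tendsto (fun y : ℝ => x / y) atTop (𝓝 0) := tendsto_const_nhds.div_atTop tendsto_id
    have h2 := ((h1.pow 2).const_add 1).log (by norm_num)
    simpa using h2

/-- Compactness of Markov-Krein transforms and continuity of the correspondence. -/
theorem exists_tendsto_halfPlaneMarkovKrein {c : ℝ} (hc : 0 < c) {ρ : Measure ℝ}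
    [IsProbabilityMeasure ρ] (hρ : Integrable (fun x : ℝ => Real.log (1 + x ^ 2)) ρ)
    {ι : Type*} {l : Filter ι} [l.IsCountablyGenerated] {a : ι → ℝ → ℝ}
    (ha : ∀ i, Measurable (a i)) (hle : ∀ i s, |a i s| ≤ |s|)
    (hlim : ∀ s, Tendsto (fun i => a i s) l (𝓝 s)) {ν : ι → ProbabilityMeasure ℝ}
    (hν : ∀ i, HalfPlaneMarkovKrein c (ρ.map (a i)) (ν i)) (U : Ultrafilter ι) (hU : U ≤ l) :
    ∃ ν₀ : ProbabilityMeasure ℝ, Tendsto ν U (𝓝 ν₀) ∧ HalfPlaneMarkovKrein c ρ ν₀ := by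
  have hprob : ∀ i, IsProbabilityMeasure (ρ.map (a i)) :=
    fun i => Measure.isProbabilityMeasure_map (ha i).aemeasurable
  have hκ : 0 < 1 - (2 : ℝ) ^ (-(c / 2)) := by
    have := Real.rpow_lt_one_of_one_lt_of_neg (one_lt_two (α := ℝ)) (show -(c / 2) < 0 by linarith)
    linarith
  -- The bound does not depend on `i`, because `|a i s| ≤ |s|` bounds the logarithmic integral of
  -- each image measure by that of `ρ`.
  have hbound : ∀ i, ∀ y : ℝ, 1 ≤ y → (ν i : Measure ℝ).real {x | y ≤ |x|} ≤
      (1 - Real.exp (-(c / 2) * ∫ s, Real.log (1 + (s / y) ^ 2) ∂ρ)) /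
        (1 - 2 ^ (-(c / 2))) := by
    intro i y hy
    rw [le_div_iff₀' hκ]
    refine ((hν i).measureReal_le hc (integrable_log_comp hρ (ha i) (hle i))
      (by linarith)).trans ?_
    rw [integral_map (ha i).aemeasurable (Measurable.aestronglyMeasurable (by fun_prop))]
    have : ∫ s, Real.log (1 + (a i s / y) ^ 2) ∂ρ ≤ ∫ s, Real.log (1 + (s / y) ^ 2) ∂ρ := by
      have h1 := integrable_log_one_add_div_sq (integrable_log_comp hρ (ha i) (hle i)) hy
      rw [integrable_map_measure (Measurable.aestronglyMeasurable (by fun_prop))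
        (ha i).aemeasurable] at h1
      refine integral_mono h1 (integrable_log_one_add_div_sq hρ hy) fun s => ?_
      have h2 : (a i s / y) ^ 2 ≤ (s / y) ^ 2 := by
        rw [div_pow, div_pow]
        have := sq_le_sq.2 (hle i s)
        gcongr
      exact Real.log_le_log (by positivity) (by linarith)
    have h2 : -(c / 2) * ∫ s, Real.log (1 + (s / y) ^ 2) ∂ρ ≤
        -(c / 2) * ∫ s, Real.log (1 + (a i s / y) ^ 2) ∂ρ :=
      mul_le_mul_of_nonpos_left this (by linarith)
    linarith [Real.exp_le_exp.2 h2]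
  have htend : Tendsto (fun y : ℝ =>
      (1 - Real.exp (-(c / 2) * ∫ s, Real.log (1 + (s / y) ^ 2) ∂ρ)) /
        (1 - 2 ^ (-(c / 2)))) atTop (𝓝 0) := by
    have h1 := ((((tendsto_integral_log_one_add_div_sq hρ).const_mul (-(c / 2))).rexp).const_sub
      1).div_const (1 - 2 ^ (-(c / 2)))
    simpa using h1
  have htight : IsTightMeasureSet {((μ : ProbabilityMeasure ℝ) : Measure ℝ) | μ ∈ Set.range ν} := by
    rw [isTightMeasureSet_iff_exists_isCompact_measure_compl_le]
    intro ε hε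
    obtain ⟨δ, hδ0, hδ⟩ : ∃ δ : ℝ, 0 < δ ∧ ENNReal.ofReal δ ≤ ε := by
      rcases eq_or_ne ε ⊤ with rfl | h
      · exact ⟨1, one_pos, le_top⟩
      · exact ⟨ε.toReal, ENNReal.toReal_pos hε.ne' h, ENNReal.ofReal_toReal_le⟩
    obtain ⟨y, hy1, hy2⟩ := ((eventually_ge_atTop 1).and (htend.eventually_lt_const hδ0)).exists
    refine ⟨Set.Icc (-y) y, isCompact_Icc, ?_⟩
    rintro _ ⟨_, ⟨i, rfl⟩, rfl⟩
    refine le_trans (measure_mono (t := {x | y ≤ |x|}) ?_) (le_trans ?_ hδ)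
    · intro x hx
      rw [Set.mem_compl_iff, Set.mem_Icc, ← abs_le, not_le] at hx
      exact hx.le
    · rw [← ofReal_measureReal]
      exact ENNReal.ofReal_le_ofReal ((hbound i y hy1).trans hy2.le)
  -- Prokhorov's theorem. An ultrafilter takes the place of a convergent subsequence.
  obtain ⟨ν₀, -, hν₀⟩ := (isCompact_closure_of_isTightMeasureSet htight).ultrafilter_le_nhds
    (U.map ν) (by
      rw [le_principal_iff]
      exact mem_of_superset (univ_mem' fun i => ⟨i, rfl⟩ : ν ⁻¹' Set.range ν ∈ U) subset_closure)
  have hν₀' : Tendsto ν U (𝓝 ν₀) := hν₀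
  refine ⟨ν₀, hν₀', fun w hw => ?_⟩
  -- For fixed `w` the kernel is bounded and continuous in `x`, so weak convergence applies to it;
  -- the potential of `ρ` needs dominated convergence instead.
  have t1 : Tendsto (fun i => ∫ x : ℝ, negPow c (w + x * Complex.I) ∂(ν i : Measure ℝ)) U
      (𝓝 (∫ x : ℝ, negPow c (w + x * Complex.I) ∂(ν₀ : Measure ℝ))) := by
    have hcont : Continuous fun x : ℝ => negPow c (w + x * Complex.I) :=
      continuous_iff_continuousAt.2 fun x =>
        (differentiableAt_negPow c (Or.inl (by simpa using hw))).continuousAt.comp (by fun_prop)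
    exact (ProbabilityMeasure.tendsto_iff_forall_integral_rclike_tendsto ℂ).1 hν₀'
      (BoundedContinuousFunction.ofNormedAddCommGroup _ hcont _
        (fun x => norm_negPow_add_mul_I_le hc.le hw x))
  have t2 : Tendsto (fun i => ∫ s : ℝ, Complex.log (w + s * Complex.I) ∂(ρ.map (a i))) l
      (𝓝 (∫ s : ℝ, Complex.log (w + s * Complex.I) ∂ρ)) := by
    simp_rw [fun i => integral_map (ha i).aemeasurable (μ := ρ)
      (f := fun s : ℝ => Complex.log (w + s * Complex.I))
      (Measurable.aestronglyMeasurable (by fun_prop))]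
    refine tendsto_integral_filter_of_dominated_convergence
      (fun s => |Real.log w.re| + Real.log (2 * (1 + ‖w‖)) + Real.pi + Real.log (1 + s ^ 2))
      (Eventually.of_forall fun i => Measurable.aestronglyMeasurable
        (by have := ha i; fun_prop)) ?_ ((integrable_const _).add hρ) ?_
    · refine Eventually.of_forall fun i => Eventually.of_forall fun s => ?_
      refine (norm_log_add_mul_I_le hw _).trans ?_
      have : Real.log (1 + a i s ^ 2) ≤ Real.log (1 + s ^ 2) :=
        Real.log_le_log (by positivity) (by linarith [sq_le_sq.2 (hle i s)])
      linarith
    · refine Eventually.of_forall fun s => ?_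
      refine Tendsto.clog ?_ (Or.inl (by simpa using hw))
      exact (((Complex.continuous_ofReal.tendsto s).comp (hlim s)).mul_const _).const_add _
  have t3 := ((t2.mono_left hU).const_mul (-(c : ℂ))).cexp
  refine tendsto_nhds_unique t1 (t3.congr fun i => ?_)
  exact (hν i w hw).symm

/-! ### Existence and domination in the convex order -/

theorem integral_comp_simpleFunc {E : Type*} [NormedAddCommGroup E] [NormedSpace ℝ E]
    [CompleteSpace E] (ρ : Measure ℝ) [IsFiniteMeasure ρ] (a : SimpleFunc ℝ ℝ) (g : ℝ → E) :
    ∫ s, g (a s) ∂ρ = ∑ y ∈ a.range, ρ.real (a ⁻¹' {y}) • g y := by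
  have h : ∀ s, g (a s) = ∑ y ∈ a.range, (a ⁻¹' {y}).indicator (fun _ => g y) s := by
    intro s
    rw [Finset.sum_eq_single_of_mem (a s) (a.mem_range_self s)]
    · simp
    · intro y _ hy
      rw [Set.indicator_of_notMem (by simpa using hy.symm)]
  simp_rw [h]
  rw [integral_finsetSum _ fun y _ => (integrable_const _).indicator (a.measurableSet_fiber y)]
  exact Finset.sum_congr rfl fun y _ => integral_indicator_const _ (a.measurableSet_fiber y)

/-- The image of `ρ` under a simple function is finitely supported, and the finite case applies with
weights `c` times the masses of the fibres, which sum to `c`. -/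
theorem exists_markovKrein_simpleFunc {c : ℝ} (hc : 0 < c) (ρ : Measure ℝ)
    [IsProbabilityMeasure ρ] (a : SimpleFunc ℝ ℝ) :
    ∃ ν : ProbabilityMeasure ℝ, HalfPlaneMarkovKrein c (ρ.map a) ν ∧
      ∀ f : ℝ → ℝ, ConvexOn ℝ Set.univ f → Continuous f → (∀ x, 0 ≤ f x) →
        ∫⁻ x, ENNReal.ofReal (f x) ∂(ν : Measure ℝ) ≤ ∫⁻ s, ENNReal.ofReal (f (a s)) ∂ρ := by
  set q : ℝ → ℝ := fun y => ρ.real (a ⁻¹' {y}) with hq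
  have hq0 : ∀ y, 0 ≤ q y := fun y => measureReal_nonneg
  -- Null fibres are dropped, since beta parameters must be positive.
  set S := a.range.filter (fun y => 0 < q y) with hS
  have hsum : ∀ {E : Type} [AddCommMonoid E] (g : ℝ → E), (∀ y, q y = 0 → g y = 0) →
      ∑ y ∈ S, g y = ∑ y ∈ a.range, g y := by
    intro E _ g hg
    refine Finset.sum_filter_of_ne fun y _ h => ?_
    exact lt_of_le_of_ne (hq0 y) fun h0 => h (hg y h0.symm)
  have hqsum : ∑ y ∈ S, q y = 1 := by
    rw [hsum q fun _ h => h]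
    have := integral_comp_simpleFunc ρ a (fun _ => (1 : ℝ))
    simpa [hq] using this.symm
  have hSne : S.Nonempty := by
    by_contra h
    rw [Finset.not_nonempty_iff_eq_empty] at h
    rw [h] at hqsum
    simp at hqsum
  obtain ⟨ν, h1, h2, h3⟩ := exists_markovKrein_finset hSne (fun y => c * q y) id
    (fun y hy => mul_pos hc (Finset.mem_filter.1 hy).2)
  rw [← Finset.mul_sum, hqsum, mul_one] at h2 h3
  refine ⟨⟨ν, h1⟩, fun w hw => ?_, fun f hf hfc hf0 => ?_⟩
  · refine (h2 w hw).trans ?_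
    rw [integral_map a.measurable.aemeasurable (Measurable.aestronglyMeasurable (by fun_prop))]
    rw [integral_comp_simpleFunc ρ a (fun s : ℝ => Complex.log (w + s * Complex.I)),
      ← hsum _ (fun y hy => by rw [show ρ.real (a ⁻¹' {y}) = 0 from hy, zero_smul]),
      Finset.mul_sum, ← Finset.sum_neg_distrib]
    congr 1
    refine Finset.sum_congr rfl fun y _ => ?_
    rw [Complex.real_smul, id]
    push_cast
    ring
  · have hfm := hfc.measurable
    have e := SimpleFunc.map_lintegral (fun s => ENNReal.ofReal (f s)) a (μ := ρ)
    rw [← SimpleFunc.lintegral_eq_lintegral] at e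
    have e2 : ∫⁻ s, ENNReal.ofReal (f (a s)) ∂ρ =
        ∑ y ∈ a.range, ENNReal.ofReal (q y) * ENNReal.ofReal (f y) := by
      refine Eq.trans (lintegral_congr fun s => ?_) (e.trans ?_)
      · rfl
      · refine Finset.sum_congr rfl fun y _ => ?_
        rw [hq, ofReal_measureReal, mul_comm]
    have h4 := h3 f hf hfc hf0
    simp_rw [ENNReal.ofReal_mul hc.le, mul_assoc, id] at h4
    rw [← Finset.mul_sum, hsum _ (fun y hy => by simp [hy]), ← e2] at h4
    exact (ENNReal.mul_le_mul_iff_right (by simpa using hc) ENNReal.ofReal_ne_top).1 h4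

/-- Rounding towards `0` by simple functions. -/
theorem exists_simpleFunc_tendsto_id :
    ∃ a : ℕ → SimpleFunc ℝ ℝ, (∀ n s, ∃ t ∈ Set.Icc (0 : ℝ) 1, a n s = t * s) ∧
      ∀ s, Tendsto (fun n => a n s) atTop (𝓝 s) := by
  -- The positive and negative parts of `s` are approximated from below, so their difference lies
  -- between `0` and `s`. This is what the tail bounds and the convexity estimates require.
  set p : ℕ → SimpleFunc ℝ ℝ := fun n =>
    (SimpleFunc.eapprox (fun s : ℝ => ENNReal.ofReal s) n).map ENNReal.toReal with hp
  set q : ℕ → SimpleFunc ℝ ℝ := fun n =>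
    (SimpleFunc.eapprox (fun s : ℝ => ENNReal.ofReal (-s)) n).map ENNReal.toReal with hq
  have bound : ∀ f : ℝ → ENNReal, Measurable f → (∀ s, f s ≠ ⊤) → ∀ n s,
      0 ≤ (SimpleFunc.eapprox f n s).toReal ∧
        (SimpleFunc.eapprox f n s).toReal ≤ (f s).toReal := by
    intro f hf hft n s
    refine ⟨ENNReal.toReal_nonneg, ENNReal.toReal_mono (hft s) ?_⟩
    rw [← SimpleFunc.iSup_eapprox_apply hf s]
    exact le_iSup (fun n => SimpleFunc.eapprox f n s) n
  refine ⟨fun n => p n - q n, fun n s => ?_, fun s => ?_⟩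
  · have hP := bound (fun s : ℝ => ENNReal.ofReal s) (by fun_prop) (by simp) n s
    have hQ := bound (fun s : ℝ => ENNReal.ofReal (-s)) (by fun_prop) (by simp) n s
    have e : (p n - q n) s = (SimpleFunc.eapprox (fun s : ℝ => ENNReal.ofReal s) n s).toReal -
        (SimpleFunc.eapprox (fun s : ℝ => ENNReal.ofReal (-s)) n s).toReal := rfl
    rw [e]
    generalize (SimpleFunc.eapprox (fun s : ℝ => ENNReal.ofReal s) n s).toReal = P at hP
    generalize (SimpleFunc.eapprox (fun s : ℝ => ENNReal.ofReal (-s)) n s).toReal = Q at hQ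
    rw [ENNReal.toReal_ofReal'] at hP hQ
    rcases lt_trichotomy s 0 with hs | rfl | hs
    · rw [max_eq_right hs.le] at hP
      rw [max_eq_left (by linarith)] at hQ
      have : P = 0 := le_antisymm hP.2 hP.1
      refine ⟨-Q / s, ⟨div_nonneg_of_nonpos (by linarith) hs.le, ?_⟩, ?_⟩
      · rw [div_le_one_of_neg hs]; linarith
      · rw [div_mul_cancel₀ _ hs.ne, this]; ring
    · simp at hP hQ
      exact ⟨0, by simp, by linarith [le_antisymm hP.2 hP.1, le_antisymm hQ.2 hQ.1]⟩
    · rw [max_eq_left hs.le] at hP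
      rw [max_eq_right (by linarith)] at hQ
      have : Q = 0 := le_antisymm hQ.2 hQ.1
      refine ⟨P / s, ⟨div_nonneg hP.1 hs.le, ?_⟩, ?_⟩
      · rw [div_le_one hs]; linarith
      · rw [div_mul_cancel₀ _ hs.ne', this]; ring
  · have h1 := (ENNReal.tendsto_toReal (by simp)).comp
      (SimpleFunc.tendsto_eapprox (f := fun s : ℝ => ENNReal.ofReal s) (by fun_prop) s)
    have h2 := (ENNReal.tendsto_toReal (by simp)).comp
      (SimpleFunc.tendsto_eapprox (f := fun s : ℝ => ENNReal.ofReal (-s)) (by fun_prop) s)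
    have h3 := h1.sub h2
    rw [ENNReal.toReal_ofReal', ENNReal.toReal_ofReal'] at h3
    have e : max s 0 - max (-s) 0 = s := by
      rcases le_total 0 s with h | h
      · rw [max_eq_left h, max_eq_right (by linarith)]; ring
      · rw [max_eq_right h, max_eq_left (by linarith)]; ring
    rw [e] at h3
    exact h3

/-- Weak limits do not increase integrals of nonnegative continuous functions. -/
theorem lintegral_le_of_tendsto {ι : Type*} {l : Filter ι} [l.NeBot]
    {ν : ι → ProbabilityMeasure ℝ} {ν₀ : ProbabilityMeasure ℝ} (h : Tendsto ν l (𝓝 ν₀))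
    {f : ℝ → ℝ} (hf : Continuous f) {C : ι → ENNReal} {C₀ : ENNReal}
    (hC : ∀ i, ∫⁻ x, ENNReal.ofReal (f x) ∂(ν i : Measure ℝ) ≤ C i) (hC₀ : Tendsto C l (𝓝 C₀)) :
    ∫⁻ x, ENNReal.ofReal (f x) ∂(ν₀ : Measure ℝ) ≤ C₀ := by
  have hm : Measurable f := hf.measurable
  -- Cut off at height `K`, the function is bounded and continuous, so weak convergence applies;
  -- monotone convergence then removes `K`.
  have hK : ∀ K : ℕ, ∫⁻ x, min (ENNReal.ofReal (f x)) K ∂(ν₀ : Measure ℝ) ≤ C₀ := by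
    intro K
    let g : BoundedContinuousFunction ℝ NNReal := BoundedContinuousFunction.mkOfBound
      ⟨fun x => min (f x).toNNReal K, by fun_prop⟩ K (fun x y => by
        rw [NNReal.dist_eq, abs_le]
        have h1 : (0 : ℝ) ≤ (min (f x).toNNReal (K : NNReal) : NNReal) := NNReal.coe_nonneg _
        have h2 : (0 : ℝ) ≤ (min (f y).toNNReal (K : NNReal) : NNReal) := NNReal.coe_nonneg _
        have h3 : ((min (f x).toNNReal (K : NNReal) : NNReal) : ℝ) ≤ K := by
          exact_mod_cast min_le_right _ _
        have h4 : ((min (f y).toNNReal (K : NNReal) : NNReal) : ℝ) ≤ K := by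
          exact_mod_cast min_le_right _ _
        change -(K : ℝ) ≤ ((min (f x).toNNReal (K : NNReal) : NNReal) : ℝ) -
            ((min (f y).toNNReal (K : NNReal) : NNReal) : ℝ) ∧
          ((min (f x).toNNReal (K : NNReal) : NNReal) : ℝ) -
            ((min (f y).toNNReal (K : NNReal) : NNReal) : ℝ) ≤ K
        constructor <;> linarith)
    have hg : ∀ x, (g x : ENNReal) = min (ENNReal.ofReal (f x)) K := fun x => by
      change ((min (f x).toNNReal (K : NNReal) : NNReal) : ENNReal) = _
      rw [ENNReal.coe_min]; simp [ENNReal.ofReal]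
    have t := (ProbabilityMeasure.tendsto_iff_forall_lintegral_tendsto.1 h) g
    simp_rw [hg] at t
    exact le_of_tendsto_of_tendsto' t hC₀ fun i =>
      (lintegral_mono fun x => min_le_left _ _).trans (hC i)
  refine le_of_tendsto' (lintegral_tendsto_of_tendsto_of_monotone
    (f := fun (K : ℕ) x => min (ENNReal.ofReal (f x)) (K : ENNReal))
    (fun K => Measurable.aemeasurable (by fun_prop))
    (Eventually.of_forall fun x K L hKL => min_le_min le_rfl (by exact_mod_cast hKL))
    (Eventually.of_forall fun x => ?_)) hK
  refine tendsto_const_nhds.congr' ?_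
  obtain ⟨N, hN⟩ := ENNReal.exists_nat_gt (ENNReal.ofReal_ne_top (r := f x))
  filter_upwards [eventually_ge_atTop N] with K hK
  rw [min_eq_left]
  exact hN.le.trans (by exact_mod_cast hK)

/-- Existence of the Markov-Krein transform, and its domination by `ρ` in the convex order. -/
theorem exists_halfPlaneMarkovKrein {c : ℝ} (hc : 0 < c) {ρ : Measure ℝ}
    [IsProbabilityMeasure ρ] (hρ : Integrable (fun x : ℝ => Real.log (1 + x ^ 2)) ρ) :
    ∃ ν : ProbabilityMeasure ℝ, HalfPlaneMarkovKrein c ρ ν ∧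
      ∀ f : ℝ → ℝ, ConvexOn ℝ Set.univ f → Continuous f → (∀ x, 0 ≤ f x) →
        ∫⁻ x, ENNReal.ofReal (f x) ∂(ν : Measure ℝ) ≤ ∫⁻ s, ENNReal.ofReal (f s) ∂ρ := by
  obtain ⟨a, ha1, ha2⟩ := exists_simpleFunc_tendsto_id
  choose ν h1 h2 using fun n => exists_markovKrein_simpleFunc hc ρ (a n)
  obtain ⟨ν₀, hν₀, hMK⟩ := exists_tendsto_halfPlaneMarkovKrein hc hρ (l := atTop)
    (fun n => (a n).measurable) (fun n s => by
      obtain ⟨t, ht, e⟩ := ha1 n s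
      rw [e, abs_mul, abs_of_nonneg ht.1]
      exact mul_le_of_le_one_left (abs_nonneg _) ht.2) ha2 h1 (Ultrafilter.of atTop)
    (Ultrafilter.of_le _)
  refine ⟨ν₀, hMK, fun f hf hfc hf0 => ?_⟩
  have hfm := hfc.measurable
  rcases eq_or_ne (∫⁻ s, ENNReal.ofReal (f s) ∂ρ) ⊤ with htop | htop
  · rw [htop]; exact le_top
  refine lintegral_le_of_tendsto hν₀ hfc (fun n => h2 n f hf hfc hf0) ?_
  refine Tendsto.mono_left ?_ (Ultrafilter.of_le atTop)
  -- As `a n s = t s` with `0 ≤ t ≤ 1`, convexity bounds `f (a n s)` by `f s + f 0`.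
  refine tendsto_lintegral_of_dominated_convergence
    (fun s => ENNReal.ofReal (f s) + ENNReal.ofReal (f 0))
    (fun n => by have := (a n).measurable; fun_prop) (fun n => Eventually.of_forall fun s => ?_)
    ?_ (Eventually.of_forall fun s => ?_)
  · obtain ⟨t, ht, e⟩ := ha1 n s
    dsimp only
    rw [e, ← ENNReal.ofReal_add (hf0 _) (hf0 _)]
    refine ENNReal.ofReal_le_ofReal ?_
    have h := hf.2 (Set.mem_univ s) (Set.mem_univ 0) ht.1 (sub_nonneg.2 ht.2) (by ring)
    simp only [smul_eq_mul, mul_zero, add_zero] at h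
    nlinarith [hf0 s, hf0 0, ht.1, ht.2, mul_le_of_le_one_left (hf0 s) ht.2,
      mul_nonneg ht.1 (hf0 0)]
  · rw [lintegral_add_left (by fun_prop), lintegral_const]
    simp [htop]
  · exact ENNReal.tendsto_ofReal ((hfc.tendsto s).comp (ha2 s))

/-! ### Uniqueness and consequences of the convex order -/

theorem HalfPlaneMarkovKrein.unique {c : ℝ} (hc : 0 < c) {ρ ν₁ ν₂ : Measure ℝ}
    [IsProbabilityMeasure ν₁] [IsProbabilityMeasure ν₂] (h₁ : HalfPlaneMarkovKrein c ρ ν₁)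
    (h₂ : HalfPlaneMarkovKrein c ρ ν₂) : ν₁ = ν₂ :=
  eq_of_integral_negPow_eq hc fun w hw => (h₁ w hw).trans (h₂ w hw).symm

/-- By uniqueness `ν` is the measure constructed from beta mixtures, so it inherits the convex
order. -/
theorem HalfPlaneMarkovKrein.lintegral_le {c : ℝ} (hc : 0 < c) {ρ ν : Measure ℝ}
    [IsProbabilityMeasure ρ] [IsProbabilityMeasure ν]
    (hρ : Integrable (fun x : ℝ => Real.log (1 + x ^ 2)) ρ) (h : HalfPlaneMarkovKrein c ρ ν)
    {f : ℝ → ℝ} (hf : ConvexOn ℝ Set.univ f) (hfc : Continuous f) (hf0 : ∀ x, 0 ≤ f x) :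
    ∫⁻ x, ENNReal.ofReal (f x) ∂ν ≤ ∫⁻ s, ENNReal.ofReal (f s) ∂ρ := by
  obtain ⟨ν', h1, h2⟩ := exists_halfPlaneMarkovKrein hc hρ
  rw [h.unique hc h1]
  exact h2 f hf hfc hf0

theorem convexOn_exp_mul (r : ℝ) : ConvexOn ℝ Set.univ fun x : ℝ => Real.exp (x * r) := by
  exact convexOn_exp.comp_linearMap (LinearMap.mulRight ℝ r)

/-- The convex function `(e ^ (x r) - K)⁺`. -/
theorem convexOn_max_exp_sub (r K : ℝ) :
    ConvexOn ℝ Set.univ fun x : ℝ => max (Real.exp (x * r) - K) 0 :=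
  ((convexOn_exp_mul r).sub (concaveOn_const K convex_univ)).sup (convexOn_const 0 convex_univ)

theorem HalfPlaneMarkovKrein.integrable_exp {c : ℝ} (hc : 0 < c) {ρ ν : Measure ℝ}
    [IsProbabilityMeasure ρ] [IsProbabilityMeasure ν]
    (hρ : Integrable (fun x : ℝ => Real.log (1 + x ^ 2)) ρ) (h : HalfPlaneMarkovKrein c ρ ν)
    {r : ℝ} (hr : Integrable (fun x : ℝ => Real.exp (x * r)) ρ) :
    Integrable (fun x : ℝ => Real.exp (x * r)) ν := by
  refine ⟨Measurable.aestronglyMeasurable (by fun_prop), ?_⟩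
  rw [hasFiniteIntegral_iff_ofReal (Eventually.of_forall fun x => (Real.exp_pos _).le)]
  refine (h.lintegral_le hc hρ (convexOn_exp_mul r) (by fun_prop)
    fun x => (Real.exp_pos _).le).trans_lt ?_
  exact (hasFiniteIntegral_iff_ofReal (Eventually.of_forall fun x => (Real.exp_pos _).le)).1 hr.2

/-- The convex function `(|x| - M)⁺` has integral `0` for `ρ`, hence also for `ν`. -/
theorem HalfPlaneMarkovKrein.ae_abs_le {c : ℝ} (hc : 0 < c) {ρ ν : Measure ℝ}
    [IsProbabilityMeasure ρ] [IsProbabilityMeasure ν]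
    (hρ : Integrable (fun x : ℝ => Real.log (1 + x ^ 2)) ρ) (h : HalfPlaneMarkovKrein c ρ ν)
    {M : ℝ} (hM : ∀ᵐ s ∂ρ, |s| ≤ M) : ∀ᵐ x ∂ν, |x| ≤ M := by
  have hconv : ConvexOn ℝ Set.univ fun x : ℝ => max (|x| - M) 0 :=
    ((convexOn_norm (E := ℝ) convex_univ).sub (concaveOn_const M convex_univ)).sup
      (convexOn_const 0 convex_univ)
  have h1 := h.lintegral_le hc hρ hconv (by fun_prop) fun x => le_max_right _ _
  have h2 : ∫⁻ s, ENNReal.ofReal (max (|s| - M) 0) ∂ρ = 0 := by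
    rw [lintegral_eq_zero_iff (by fun_prop)]
    filter_upwards [hM] with s hs
    simp [hs]
  rw [h2, nonpos_iff_eq_zero, lintegral_eq_zero_iff (by fun_prop)] at h1
  filter_upwards [h1] with x hx
  simpa using hx

/-! ### Truncation and convergence of exponential moments -/

/-- Projection of the line onto `[-|M|, |M|]`. -/
noncomputable def clamp (M s : ℝ) : ℝ := max (-|M|) (min |M| s)

@[fun_prop]
theorem measurable_clamp (M : ℝ) : Measurable (clamp M) := by unfold clamp; fun_prop

theorem clamp_eq_self {M s : ℝ} (h : |s| ≤ |M|) : clamp M s = s := by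
  rw [abs_le] at h
  rw [clamp, min_eq_right h.2, max_eq_right h.1]

theorem clamp_of_le {M s : ℝ} (h : |M| ≤ s) : clamp M s = |M| := by
  rw [clamp, min_eq_left h, max_eq_right (by linarith [abs_nonneg M])]

theorem clamp_of_le_neg {M s : ℝ} (h : s ≤ -|M|) : clamp M s = -|M| := by
  rw [clamp, max_eq_left]
  exact (min_le_right _ _).trans h

/-- Valid for every real `M` thanks to the absolute value in `clamp`, so the truncations form a
family indexed by all of `ℝ`, as the compactness theorem wants. -/
theorem exists_clamp_eq_mul (M s : ℝ) : ∃ t ∈ Set.Icc (0 : ℝ) 1, clamp M s = t * s := by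
  have hM := abs_nonneg M
  rcases le_or_gt |s| |M| with h | h
  · exact ⟨1, by simp, by rw [clamp_eq_self h, one_mul]⟩
  · have hs : 0 < |s| := hM.trans_lt h
    refine ⟨|M| / |s|, ⟨by positivity, (div_le_one hs).2 h.le⟩, ?_⟩
    rcases lt_abs.1 h with h' | h'
    · rw [clamp_of_le h'.le, abs_of_pos (hM.trans_lt h'), div_mul_cancel₀ _ (hM.trans_lt h').ne']
    · have : s < 0 := by linarith
      rw [clamp_of_le_neg (by linarith), abs_of_neg this]
      have := this.ne
      field_simp

theorem abs_clamp_le (M s : ℝ) : |clamp M s| ≤ |s| := by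
  obtain ⟨t, ht, e⟩ := exists_clamp_eq_mul M s
  rw [e, abs_mul, abs_of_nonneg ht.1]
  exact mul_le_of_le_one_left (abs_nonneg _) ht.2

theorem abs_clamp_le_abs (M s : ℝ) : |clamp M s| ≤ |M| :=
  abs_le.2 ⟨le_max_left _ _, max_le (by linarith [abs_nonneg M]) (min_le_left _ _)⟩

theorem tendsto_clamp (s : ℝ) : Tendsto (fun M => clamp M s) atTop (𝓝 s) := by
  refine tendsto_const_nhds.congr' ?_
  filter_upwards [eventually_ge_atTop |s|] with M hM
  exact (clamp_eq_self (hM.trans (le_abs_self M))).symm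

open scoped Classical in
-- As an image of `ρ` under maps that tend to the identity, the truncation falls under
-- `exists_tendsto_halfPlaneMarkovKrein`.
theorem truncMeasure_eq_map (ρ : Measure ℝ) {M : ℝ} (hM : 0 < M) :
    truncMeasure ρ M = ρ.map (clamp M) := by
  have hMa : |M| = M := abs_of_pos hM
  ext s hs
  rw [Measure.map_apply (measurable_clamp M) hs, truncMeasure]
  have hd1 : Disjoint (Set.Iic (-M)) (Set.Ioo (-M) M) :=
    Set.disjoint_left.2 fun x hx hx' => absurd hx'.1 (not_lt.2 hx)
  have hd2 : Disjoint (Set.Iic (-M) ∪ Set.Ioo (-M) M) (Set.Ici M) := by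
    rw [Set.disjoint_left]
    rintro x (hx | hx) hx'
    · rw [Set.mem_Iic] at hx; rw [Set.mem_Ici] at hx'; linarith
    · exact absurd hx.2 (not_lt.2 hx')
  have hu : Set.Iic (-M) ∪ Set.Ioo (-M) M ∪ Set.Ici M = Set.univ := by
    rw [Set.Iic_union_Ioo_eq_Iio (by linarith), Set.Iio_union_Ici]
  have e1 : (clamp M ⁻¹' s) ∩ Set.Iic (-M) = if -M ∈ s then Set.Iic (-M) else ∅ := by
    split_ifs with h
    · refine Set.inter_eq_right.2 fun x hx => ?_
      rw [Set.mem_preimage, clamp_of_le_neg (by rwa [hMa]), hMa]; exact h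
    · refine Set.eq_empty_of_forall_notMem fun x hx => h ?_
      have := hx.1
      rwa [Set.mem_preimage, clamp_of_le_neg (by rw [hMa]; exact hx.2), hMa] at this
  have e3 : (clamp M ⁻¹' s) ∩ Set.Ici M = if M ∈ s then Set.Ici M else ∅ := by
    split_ifs with h
    · refine Set.inter_eq_right.2 fun x hx => ?_
      rw [Set.mem_preimage, clamp_of_le (by rwa [hMa]), hMa]; exact h
    · refine Set.eq_empty_of_forall_notMem fun x hx => h ?_
      have := hx.1
      rwa [Set.mem_preimage, clamp_of_le (by rw [hMa]; exact hx.2), hMa] at this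
  have e2 : (clamp M ⁻¹' s) ∩ Set.Ioo (-M) M = s ∩ Set.Ioo (-M) M := by
    ext x
    refine and_congr_left fun hx => ?_
    rw [Set.mem_preimage, clamp_eq_self]
    rw [hMa, abs_le]; exact ⟨hx.1.le, hx.2.le⟩
  have hpre := measurable_clamp M hs
  rw [← Set.inter_univ (clamp M ⁻¹' s), ← hu, Set.inter_union_distrib_left,
    measure_union (hd2.mono Set.inter_subset_right Set.inter_subset_right)
      (hpre.inter measurableSet_Ici), Set.inter_union_distrib_left,
    measure_union (hd1.mono Set.inter_subset_right Set.inter_subset_right)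
      (hpre.inter measurableSet_Ioo), e1, e2, e3]
  simp only [Measure.coe_add, Pi.add_apply, Measure.coe_smul, Pi.smul_apply, smul_eq_mul,
    Measure.dirac_apply' _ hs, Measure.restrict_apply hs]
  congr 1
  · congr 1
    by_cases h : -M ∈ s <;> simp [h]
  · by_cases h : M ∈ s <;> simp [h]

/-- For `0 ≤ t ≤ 1`, convexity and `f 0 = 0` give `f (t s) ≤ t f s ≤ f s`. The functions `(e ^ (x r)
- K)⁺` vanish at `0` as soon as `K ≥ 1`. -/
theorem lintegral_clamp_le {ρ : Measure ℝ} {f : ℝ → ℝ} (hf : ConvexOn ℝ Set.univ f)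
    (hfc : Continuous f) (hf0 : ∀ x, 0 ≤ f x) (h0 : f 0 = 0) (M : ℝ) :
    ∫⁻ s, ENNReal.ofReal (f s) ∂(ρ.map (clamp M)) ≤ ∫⁻ s, ENNReal.ofReal (f s) ∂ρ := by
  have hfm := hfc.measurable
  rw [lintegral_map (by fun_prop) (measurable_clamp M)]
  refine lintegral_mono fun s => ENNReal.ofReal_le_ofReal ?_
  obtain ⟨t, ht, e⟩ := exists_clamp_eq_mul M s
  have h := hf.2 (Set.mem_univ s) (Set.mem_univ 0) ht.1 (sub_nonneg.2 ht.2) (by ring)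
  simp only [smul_eq_mul, mul_zero, add_zero, h0] at h
  rw [e]
  exact h.trans (mul_le_of_le_one_left (hf0 s) ht.2)

/-- Cutting off `e ^ (x u)` at modulus `K`. -/
theorem norm_cexp_sub_cutoff (u : ℂ) {K : ℝ} (hK : 0 < K) (x : ℝ) :
    ‖Complex.exp (x * u) * ((min 1 (K / Real.exp (x * u.re)) : ℝ) : ℂ)‖ ≤ K ∧
    ‖Complex.exp (x * u) -
      Complex.exp (x * u) * ((min 1 (K / Real.exp (x * u.re)) : ℝ) : ℂ)‖ =
      max (Real.exp (x * u.re) - K) 0 := by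
  have hE := Real.exp_pos (x * u.re)
  have hn : ‖Complex.exp (x * u)‖ = Real.exp (x * u.re) := by
    rw [Complex.norm_exp, Complex.re_ofReal_mul]
  constructor
  · rw [norm_mul, hn, Complex.norm_real, Real.norm_of_nonneg (le_min zero_le_one (by positivity))]
    calc Real.exp (x * u.re) * min 1 (K / Real.exp (x * u.re))
        ≤ Real.exp (x * u.re) * (K / Real.exp (x * u.re)) := by gcongr; exact min_le_right _ _
      _ = K := by field_simp
  · rw [show ∀ a : ℂ, ∀ b : ℝ, a - a * b = a * ((1 - b : ℝ) : ℂ) by intros; push_cast; ring,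
      norm_mul, hn, Complex.norm_real, Real.norm_of_nonneg (sub_nonneg.2 (min_le_left _ _))]
    rcases le_total (Real.exp (x * u.re)) K with h | h
    · rw [min_eq_left ((one_le_div hE).2 h), max_eq_right (by linarith)]; simp
    · rw [min_eq_right ((div_le_one hE).2 h), max_eq_left (by linarith)]
      field_simp

theorem norm_integral_cexp_sub_cutoff_le {ν : Measure ℝ} [IsProbabilityMeasure ν] {u : ℂ}
    (hν : Integrable (fun x : ℝ => Real.exp (x * u.re)) ν) {K : ℝ} (hK : 0 < K) {η : ENNReal}
    (hη : η ≠ ⊤) (h : ∫⁻ x, ENNReal.ofReal (max (Real.exp (x * u.re) - K) 0) ∂ν ≤ η) :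
    ‖∫ x : ℝ, Complex.exp (x * u) ∂ν -
      ∫ x : ℝ, Complex.exp (x * u) * ((min 1 (K / Real.exp (x * u.re)) : ℝ) : ℂ) ∂ν‖ ≤
      η.toReal := by
  have hi : Integrable (fun x : ℝ => Complex.exp (x * u)) ν :=
    hν.mono' (Measurable.aestronglyMeasurable (by fun_prop)) (Eventually.of_forall fun x => by
      rw [Complex.norm_exp, Complex.re_ofReal_mul])
  rw [← integral_sub hi (Integrable.of_bound (Measurable.aestronglyMeasurable (by fun_prop)) K
    (Eventually.of_forall fun x => (norm_cexp_sub_cutoff u hK x).1))]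
  refine (norm_integral_le_integral_norm _).trans ?_
  simp_rw [fun x => (norm_cexp_sub_cutoff u hK x).2]
  rw [integral_eq_lintegral_of_nonneg_ae
    (f := fun x => max (Real.exp (x * u.re) - K) 0) (Eventually.of_forall fun x => le_max_right _ _)
    (Measurable.aestronglyMeasurable (by fun_prop))]
  exact ENNReal.toReal_mono hη h

/-- Exponential moments of the Markov-Krein transforms of truncations converge. -/
theorem tendsto_integral_cexp_truncation {c : ℝ} (hc : 0 < c) {ρ : Measure ℝ}
    [IsProbabilityMeasure ρ] (hρ : Integrable (fun x : ℝ => Real.log (1 + x ^ 2)) ρ)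
    {ν : Measure ℝ} [IsProbabilityMeasure ν] (hν : HalfPlaneMarkovKrein c ρ ν)
    {νM : ℝ → ProbabilityMeasure ℝ}
    (hνM : ∀ M, HalfPlaneMarkovKrein c (ρ.map (clamp M)) (νM M)) {u : ℂ}
    (hu : Integrable (fun x : ℝ => Real.exp (x * u.re)) ρ) :
    Tendsto (fun M => ∫ x : ℝ, Complex.exp (x * u) ∂(νM M : Measure ℝ)) atTop
      (𝓝 (∫ x : ℝ, Complex.exp (x * u) ∂ν)) := by
  have hprob : ∀ M, IsProbabilityMeasure (ρ.map (clamp M)) :=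
    fun M => Measure.isProbabilityMeasure_map (measurable_clamp M).aemeasurable
  have hlogM : ∀ M, Integrable (fun x : ℝ => Real.log (1 + x ^ 2)) (ρ.map (clamp M)) :=
    fun M => integrable_log_comp hρ (measurable_clamp M) (abs_clamp_le M)
  -- By the convex order, for `K ≥ 1` this quantity of `ρ` alone bounds the cutoff error for `ν` and
  -- for all truncations at once: uniform integrability.
  set η : ℝ → ENNReal := fun K => ∫⁻ x, ENNReal.ofReal (max (Real.exp (x * u.re) - K) 0) ∂ρ
    with hη
  have hη_top : ∀ K, 0 ≤ K → η K ≠ ⊤ := by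
    intro K hK
    refine ne_top_of_le_ne_top ((hasFiniteIntegral_iff_ofReal
      (Eventually.of_forall fun x => (Real.exp_pos _).le)).1 hu.2).ne (lintegral_mono fun x => ?_)
    refine ENNReal.ofReal_le_ofReal (max_le (by linarith) (Real.exp_pos _).le)
  have hη_lim : Tendsto η atTop (𝓝 0) := by
    rw [← lintegral_zero (μ := ρ)]
    refine tendsto_lintegral_filter_of_dominated_convergence
      (fun x => ENNReal.ofReal (Real.exp (x * u.re)))
      (Eventually.of_forall fun K => by fun_prop) ?_
      ((hasFiniteIntegral_iff_ofReal
        (Eventually.of_forall fun x => (Real.exp_pos _).le)).1 hu.2).ne ?_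
    · filter_upwards [eventually_ge_atTop 0] with K hK
      exact Eventually.of_forall fun x =>
        ENNReal.ofReal_le_ofReal (max_le (by linarith) (Real.exp_pos _).le)
    · refine Eventually.of_forall fun x => tendsto_const_nhds.congr' ?_
      filter_upwards [eventually_ge_atTop (Real.exp (x * u.re))] with K hK
      simp [hK]
  have hcont : ∀ K : ℝ, Continuous fun x : ℝ => max (Real.exp (x * u.re) - K) 0 :=
    fun K => by fun_prop
  have hνη : ∀ K, ∫⁻ x, ENNReal.ofReal (max (Real.exp (x * u.re) - K) 0) ∂ν ≤ η K := fun K =>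
    hν.lintegral_le hc hρ (convexOn_max_exp_sub _ K) (hcont K) fun x => le_max_right _ _
  have hνMη : ∀ M K, 1 ≤ K →
      ∫⁻ x, ENNReal.ofReal (max (Real.exp (x * u.re) - K) 0) ∂(νM M : Measure ℝ) ≤ η K :=
    fun M K hK => ((hνM M).lintegral_le hc (hlogM M) (convexOn_max_exp_sub _ K) (hcont K)
      fun x => le_max_right _ _).trans
      (lintegral_clamp_le (convexOn_max_exp_sub _ K) (hcont K) (fun x => le_max_right _ _)
        (by simp [hK]) M)
  have huM : ∀ M, Integrable (fun x : ℝ => Real.exp (x * u.re)) (ρ.map (clamp M)) := by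
    intro M
    rw [integrable_map_measure (Measurable.aestronglyMeasurable (by fun_prop))
      (measurable_clamp M).aemeasurable]
    refine Integrable.of_bound (Measurable.aestronglyMeasurable (by fun_prop))
      (Real.exp (|M| * |u.re|)) (Eventually.of_forall fun x => ?_)
    rw [Function.comp_apply, Real.norm_of_nonneg (Real.exp_pos _).le, Real.exp_le_exp]
    refine (le_abs_self _).trans ?_
    rw [abs_mul]
    exact mul_le_mul_of_nonneg_right (abs_clamp_le_abs M x) (abs_nonneg _)
  -- Along each ultrafilter the measures have a weak limit in correspondence with `ρ`, and
  -- uniqueness identifies it with `ν`.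
  rw [tendsto_iff_ultrafilter]
  intro U hU
  obtain ⟨ν₀, hlim, hν₀⟩ := exists_tendsto_halfPlaneMarkovKrein hc hρ measurable_clamp
    abs_clamp_le tendsto_clamp hνM U hU
  have hνeq : (ν₀ : Measure ℝ) = ν := hν₀.unique hc hν
  rw [Metric.tendsto_nhds]
  intro ε hε
  have hη_real : Tendsto (fun K => (η K).toReal) atTop (𝓝 0) := by
    exact (ENNReal.tendsto_toReal ENNReal.zero_ne_top).comp hη_lim
  obtain ⟨K, hK1, hK2⟩ := ((eventually_ge_atTop (1 : ℝ)).and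
    (hη_real.eventually_lt_const (show 0 < ε / 3 by positivity))).exists
  have hK0 : 0 < K := by linarith
  have ht : Tendsto (fun M => ∫ x : ℝ, Complex.exp (x * u) *
      ((min 1 (K / Real.exp (x * u.re)) : ℝ) : ℂ) ∂(νM M : Measure ℝ)) U
      (𝓝 (∫ x : ℝ, Complex.exp (x * u) *
      ((min 1 (K / Real.exp (x * u.re)) : ℝ) : ℂ) ∂ν)) := by
    rw [← hνeq]
    exact (ProbabilityMeasure.tendsto_iff_forall_integral_rclike_tendsto ℂ).1 hlim
      (BoundedContinuousFunction.ofNormedAddCommGroup _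
        (by
          refine Continuous.mul (by fun_prop) (Complex.continuous_ofReal.comp ?_)
          exact continuous_const.min (continuous_const.div (by fun_prop)
            fun x => (Real.exp_pos _).ne')) K
        (fun x => (norm_cexp_sub_cutoff u hK0 x).1))
  filter_upwards [Metric.tendsto_nhds.1 ht (ε / 3) (by positivity)] with M hM
  have b1 := norm_integral_cexp_sub_cutoff_le ((hνM M).integrable_exp hc (hlogM M) (huM M)) hK0
    (hη_top K hK0.le) (hνMη M K hK1)
  have b2 := norm_integral_cexp_sub_cutoff_le (hν.integrable_exp hc hρ hu) hK0
    (hη_top K hK0.le) (hνη K)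
  rw [← dist_eq_norm] at b1 b2
  rw [dist_comm] at b2
  have := dist_triangle4 (∫ x : ℝ, Complex.exp (x * u) ∂(νM M : Measure ℝ))
    (∫ x : ℝ, Complex.exp (x * u) *
      ((min 1 (K / Real.exp (x * u.re)) : ℝ) : ℂ) ∂(νM M : Measure ℝ))
    (∫ x : ℝ, Complex.exp (x * u) * ((min 1 (K / Real.exp (x * u.re)) : ℝ) : ℂ) ∂ν)
    (∫ x : ℝ, Complex.exp (x * u) ∂ν)
  linarith

/-! ### Laplace inversion on a vertical line -/

theorem integrable_negPow_line {c δ : ℝ} (hc : 1 < c) (hδ : 0 < δ) :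
    Integrable (fun y : ℝ => negPow c (δ + y * Complex.I)) := by
  have h := (integrable_rpow_neg_one_add_norm_sq (E := ℝ) (μ := volume) (r := c)
    (by simpa using hc)).const_mul ((min 1 δ) ^ (-c))
  refine h.mono' (Measurable.aestronglyMeasurable (by fun_prop)) (Eventually.of_forall fun y => ?_)
  have hm : 0 < min 1 δ := lt_min one_pos hδ
  have h1 : 0 < (1 + y ^ 2 : ℝ) := by positivity
  have h2 : min 1 δ * (1 + y ^ 2) ^ (1 / 2 : ℝ) ≤ ‖(δ : ℂ) + y * Complex.I‖ := by
    rw [Complex.norm_add_mul_I, ← Real.sqrt_eq_rpow]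
    refine Real.le_sqrt_of_sq_le ?_
    rw [mul_pow, Real.sq_sqrt h1.le]
    have a1 : (min 1 δ) ^ 2 ≤ 1 := by
      simpa using pow_le_pow_left₀ hm.le (min_le_left 1 δ) 2
    have a2 : (min 1 δ) ^ 2 ≤ δ ^ 2 := pow_le_pow_left₀ hm.le (min_le_right 1 δ) 2
    nlinarith [sq_nonneg y]
  refine (norm_negPow_le (by linarith) (by positivity) h2).trans (le_of_eq ?_)
  rw [Real.mul_rpow hm.le (Real.rpow_nonneg h1.le _), ← Real.rpow_mul h1.le, Real.norm_eq_abs,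
    sq_abs]
  ring_nf

/-- Laplace inversion for `w ^ (-c)` along a vertical line. -/
theorem integral_line_cexp_mul_negPow {c δ τ : ℝ} (hc : 1 < c) (hδ : 0 < δ) (hτ : 0 < τ) :
    ∫ y : ℝ, Complex.exp (τ * (δ + y * Complex.I)) * negPow c (δ + y * Complex.I) =
      ((2 * Real.pi * τ ^ (c - 1) / Real.Gamma c : ℝ) : ℂ) := by
  have hc0 : 0 < c := by linarith
  have hpi := Real.pi_pos
  have hΓ := Real.Gamma_pos_of_pos hc0
  -- By Euler's integral the Fourier transform of `G`, extended by `0`, is `Γ(c) (δ + 2 π i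
  -- ξ)^(-c)`. It is integrable because `c > 1`, and the claim is Fourier inversion at `τ`.
  set G : ℝ → ℂ := fun r => Complex.exp (δ * (-(r : ℂ))) * ((r ^ (c - 1) : ℝ) : ℂ) with hG
  set g : ℝ → ℂ := (Set.Ioi (0 : ℝ)).indicator G with hg
  have hδre : 0 < (δ : ℂ).re := by simpa using hδ
  have hgi : Integrable g := by
    rw [hg, integrable_indicator_iff measurableSet_Ioi]
    exact integrableOn_rpow_mul_cexp hc0 hδre
  have hF : ∀ ξ : ℝ, FourierTransform.fourier g ξ =
      Real.Gamma c * negPow c (δ + (2 * Real.pi * ξ : ℝ) * Complex.I) := by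
    intro ξ
    rw [Real.fourier_real_eq_integral_exp_smul, ← integral_rpow_mul_cexp hc0 (by simpa using hδ),
      ← integral_indicator measurableSet_Ioi]
    refine integral_congr_ae (Eventually.of_forall fun r => ?_)
    simp only [hg, Set.indicator_apply]
    split_ifs with hr
    · simp only [hG, smul_eq_mul]
      rw [← mul_assoc, ← Complex.exp_add]
      push_cast
      ring_nf
    · simp
  have hFi : Integrable (FourierTransform.fourier g) := by
    have h1 := (integrable_negPow_line hc hδ).const_mul (Real.Gamma c : ℂ)
    have h2 := h1.comp_mul_left' (R := 2 * Real.pi) (by positivity)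
    exact h2.congr (Eventually.of_forall fun ξ => (hF ξ).symm)
  have hcont : ContinuousAt g τ := by
    have h1 : ContinuousAt G τ := by
      have hp : ContinuousAt (fun r : ℝ => r ^ (c - 1)) τ :=
        Real.continuousAt_rpow_const _ _ (Or.inl hτ.ne')
      exact ContinuousAt.mul (by fun_prop) (Complex.continuous_ofReal.continuousAt.comp hp)
    refine h1.congr ?_
    filter_upwards [lt_mem_nhds hτ] with x hx
    rw [hg, Set.indicator_of_mem (by exact hx)]
  have hinv := hgi.fourierInv_fourier_eq hFi hcont
  rw [Real.fourierInv_eq', hg, Set.indicator_of_mem (by exact hτ)] at hinv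
  have e : ∀ ξ : ℝ, Complex.exp (((2 * Real.pi * inner ℝ ξ τ : ℝ) : ℂ) * Complex.I) •
      FourierTransform.fourier g ξ = (Real.Gamma c * Complex.exp (-(τ * δ)) : ℂ) *
        (fun y : ℝ => Complex.exp (τ * (δ + y * Complex.I)) * negPow c (δ + y * Complex.I))
          (2 * Real.pi * ξ) := by
    intro ξ
    rw [hF]
    have : Complex.exp (((2 * Real.pi * inner ℝ ξ τ : ℝ) : ℂ) * Complex.I) =
        Complex.exp (-(τ * δ)) *
          Complex.exp (τ * (δ + ((2 * Real.pi * ξ : ℝ) : ℂ) * Complex.I)) := by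
      rw [← Complex.exp_add]
      simp only [RCLike.inner_apply, conj_trivial]
      push_cast
      ring_nf
    rw [this, smul_eq_mul]
    ring
  change ∫ ξ : ℝ, Complex.exp (((2 * Real.pi * inner ℝ ξ τ : ℝ) : ℂ) * Complex.I) •
      FourierTransform.fourier g ξ = G τ at hinv
  simp_rw [e] at hinv
  have hcomp := Measure.integral_comp_mul_left (fun y : ℝ =>
    Complex.exp (τ * (δ + y * Complex.I)) * negPow c (δ + y * Complex.I)) (2 * Real.pi)
  rw [integral_const_mul, hcomp, abs_of_pos (by positivity), hG,
    Complex.real_smul] at hinv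
  have hE : Complex.exp (δ * (-(τ : ℂ))) = Complex.exp (-(τ * δ)) := by ring_nf
  beta_reduce at hinv
  rw [hE] at hinv
  have hE0 := Complex.exp_ne_zero (-(τ * δ : ℂ))
  have hΓ' : (Real.Gamma c : ℂ) ≠ 0 := by exact_mod_cast hΓ.ne'
  have hpi' : (Real.pi : ℂ) ≠ 0 := by exact_mod_cast hpi.ne'
  push_cast at hinv ⊢
  field_simp at hinv
  rw [eq_div_iff hΓ', mul_comm]
  exact hinv

theorem integral_line_cexp_mul_negPow_sub {c δ τ : ℝ} (hc : 1 < c) (hτ : 0 < τ) {ζ : ℂ}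
    (hζ : ζ.re < δ) :
    Integrable (fun y : ℝ => Complex.exp (τ * (δ + y * Complex.I)) *
      negPow c (δ + y * Complex.I - ζ)) ∧
    ∫ y : ℝ, Complex.exp (τ * (δ + y * Complex.I)) * negPow c (δ + y * Complex.I - ζ) =
      Complex.exp (τ * ζ) * ((2 * Real.pi * τ ^ (c - 1) / Real.Gamma c : ℝ) : ℂ) := by
  have hδ : 0 < δ - ζ.re := by linarith
  have e0 : ∀ y : ℝ, (δ : ℂ) + y * Complex.I - ζ =
      ((δ - ζ.re : ℝ) : ℂ) + ((y - ζ.im : ℝ) : ℂ) * Complex.I := fun y => by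
    apply Complex.ext <;> simp
  have e1 : ∀ y : ℝ, Complex.exp (τ * (δ + y * Complex.I)) * negPow c (δ + y * Complex.I - ζ) =
      Complex.exp (τ * ζ) * (fun y : ℝ => Complex.exp (τ * (((δ - ζ.re : ℝ) : ℂ) + y * Complex.I)) *
        negPow c (((δ - ζ.re : ℝ) : ℂ) + y * Complex.I)) (y - ζ.im) := by
    intro y
    dsimp only
    rw [← mul_assoc, ← Complex.exp_add, ← e0]
    ring_nf
  constructor
  · have h1 : Integrable (fun y : ℝ => Complex.exp (τ * (((δ - ζ.re : ℝ) : ℂ) + y * Complex.I)) *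
        negPow c (((δ - ζ.re : ℝ) : ℂ) + y * Complex.I)) := by
      refine (integrable_negPow_line hc hδ).bdd_mul (c := Real.exp (τ * (δ - ζ.re)))
        (Measurable.aestronglyMeasurable (by fun_prop)) (Eventually.of_forall fun y => ?_)
      simp [Complex.norm_exp]
    simp_rw [e1]
    exact (h1.comp_sub_right ζ.im).const_mul _
  · simp_rw [e1]
    rw [integral_const_mul, integral_sub_right_eq_self (fun y : ℝ =>
      Complex.exp (τ * (((δ - ζ.re : ℝ) : ℂ) + y * Complex.I)) *
        negPow c (((δ - ζ.re : ℝ) : ℂ) + y * Complex.I)),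
      integral_line_cexp_mul_negPow hc hδ hτ]

/-! ### Deformation of Hankel loops -/

theorem integrableOn_horizontal {F : ℂ → ℂ} {a τ C h : ℝ} (hτ : 0 < τ)
    (hd : ∀ x : ℝ, x ≤ a → DifferentiableAt ℂ F (x + h * Complex.I))
    (hb : ∀ x : ℝ, x ≤ a → ‖F (x + h * Complex.I)‖ ≤ C * Real.exp (τ * x)) :
    IntegrableOn (fun x : ℝ => F (x + h * Complex.I)) (Set.Iic a) := by
  refine Integrable.mono' ((integrableOn_exp_mul_Iic hτ a).const_mul C) ?_ ?_
  · refine ContinuousOn.aestronglyMeasurable (fun x hx => ?_) measurableSet_Iic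
    refine ContinuousAt.continuousWithinAt ?_
    exact ContinuousAt.comp (f := fun x : ℝ => (x : ℂ) + h * Complex.I)
      (hd x hx).continuousAt (by fun_prop)
  · exact (ae_restrict_iff' measurableSet_Iic).2 (Eventually.of_forall fun x hx => hb x hx)

/-- Moving a horizontal half-line up or down. -/
theorem integral_horizontal_sub {F : ℂ → ℂ} {a τ C h k : ℝ} (hτ : 0 < τ)
    (hd : ∀ w : ℂ, w.re ≤ a → w.im ∈ Set.uIcc h k → DifferentiableAt ℂ F w)
    (hb : ∀ w : ℂ, w.re ≤ a → w.im ∈ Set.uIcc h k → ‖F w‖ ≤ C * Real.exp (τ * w.re)) :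
    (∫ x in Set.Iic a, F (x + h * Complex.I)) - (∫ x in Set.Iic a, F (x + k * Complex.I)) +
      Complex.I * ∫ y in h..k, F (a + y * Complex.I) = 0 := by
  have hint : ∀ v ∈ Set.uIcc h k, IntegrableOn (fun x : ℝ => F (x + v * Complex.I)) (Set.Iic a) :=
    fun v hv => integrableOn_horizontal (C := C) hτ
      (fun x hx => hd _ (by simpa using hx) (by simpa using hv))
      (fun x hx => by simpa using hb (x + v * Complex.I) (by simpa using hx) (by simpa using hv))
  -- Cauchy's theorem on a rectangle; its left side at abscissa `R` disappears as `R → -∞` because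
  -- of the factor `e^(τ R)`.
  have hrect : ∀ R : ℝ, R ≤ a →
      (∫ x in R..a, F (x + h * Complex.I)) - (∫ x in R..a, F (x + k * Complex.I)) +
      Complex.I * (∫ y in h..k, F (a + y * Complex.I)) -
      Complex.I * (∫ y in h..k, F (R + y * Complex.I)) = 0 := by
    intro R hR
    have := Complex.integral_boundary_rect_eq_zero_of_differentiableOn F
      (R + h * Complex.I) (a + k * Complex.I) (fun w hw => by
        obtain ⟨h1, h2⟩ := hw
        simp only [Set.mem_preimage, Complex.add_re, Complex.ofReal_re, Complex.mul_re,
          Complex.I_re, mul_zero, Complex.ofReal_im, Complex.I_im, mul_one, sub_self, add_zero,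
          Complex.add_im, Complex.mul_im, zero_add] at h1 h2
        rw [Set.uIcc_of_le hR] at h1
        exact (hd w h1.2 h2).differentiableWithinAt)
    simpa using this
  have t1 := intervalIntegral_tendsto_integral_Iic a (hint h Set.left_mem_uIcc)
    (tendsto_id (x := atBot))
  have t2 := intervalIntegral_tendsto_integral_Iic a (hint k Set.right_mem_uIcc)
    (tendsto_id (x := atBot))
  have t3 : Tendsto (fun R : ℝ => ∫ y in h..k, F (R + y * Complex.I)) atBot (𝓝 0) := by
    have hexp : Tendsto (fun R : ℝ => C * Real.exp (τ * R) * |k - h|) atBot (𝓝 0) := by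
      have := ((Real.tendsto_exp_atBot.comp (tendsto_id.const_mul_atBot hτ)).const_mul
        C).mul_const |k - h|
      simpa using this
    refine squeeze_zero_norm' ?_ hexp
    filter_upwards [eventually_le_atBot a] with R hR
    refine intervalIntegral.norm_integral_le_of_norm_le_const fun y hy => ?_
    simpa using hb (R + y * Complex.I) (by simpa using hR)
      (by simpa using Set.uIoc_subset_uIcc hy)
  have t4 := ((t1.sub t2).add_const
    (Complex.I * ∫ y in h..k, F (a + y * Complex.I))).sub (t3.const_mul Complex.I)
  rw [mul_zero, sub_zero] at t4
  refine tendsto_nhds_unique t4 (tendsto_const_nhds.congr' ?_)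
  filter_upwards [eventually_le_atBot a] with R hR
  exact (hrect R hR).symm

theorem hankelIntegral_one (a b : ℝ) (F : ℂ → ℂ) :
    hankelIntegral 1 a b F = (∫ x in Set.Iic a, F (x + (-b : ℝ) * Complex.I)) +
      Complex.I * (∫ y in (-b)..b, F (a + y * Complex.I)) -
      ∫ x in Set.Iic a, F (x + b * Complex.I) := by
  simp [hankelIntegral, sub_eq_add_neg]

theorem hankelIntegral_eq_mul (ω : ℂ) (a b : ℝ) (f : ℂ → ℂ) :
    hankelIntegral ω a b f = ω * hankelIntegral 1 a b (fun w => f (ω * w)) := by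
  simp [hankelIntegral]

theorem hankelIntegrable_iff (ω : ℂ) (a b : ℝ) (f : ℂ → ℂ) :
    HankelIntegrable ω a b f ↔ HankelIntegrable 1 a b (fun w => f (ω * w)) := by
  simp [HankelIntegrable]

/-- Opening a Hankel loop into a vertical line. -/
theorem tendsto_vertical_hankelIntegral {F : ℂ → ℂ} {a b τ m C c : ℝ} (hc : 0 < c) (hτ : 0 < τ)
    (hC : 0 ≤ C) (hm : 0 ≤ m) (hmb : m < b)
    (hd : ∀ w : ℂ, w.re ≤ a → b ≤ |w.im| → DifferentiableAt ℂ F w)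
    (hb : ∀ w : ℂ, w.re ≤ a → b ≤ |w.im| →
      ‖F w‖ ≤ C * (|w.im| - m) ^ (-c) * Real.exp (τ * w.re))
    (hv : ∀ p q : ℝ, IntervalIntegrable (fun y : ℝ => F (a + y * Complex.I)) volume p q) :
    Tendsto (fun p : ℝ × ℝ => Complex.I * ∫ y in (-p.1)..p.2, F (a + y * Complex.I))
      (atTop ×ˢ atTop) (𝓝 (hankelIntegral 1 a b F)) := by
  set L : ℝ → ℂ := fun h => ∫ x in Set.Iic a, F (x + h * Complex.I) with hL
  have hb0 : 0 < b := by linarith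
  have hb' : ∀ w : ℂ, w.re ≤ a → b ≤ |w.im| →
      ‖F w‖ ≤ C * (b - m) ^ (-c) * Real.exp (τ * w.re) := by
    intro w h1 h2
    refine (hb w h1 h2).trans ?_
    have : (|w.im| - m) ^ (-c) ≤ (b - m) ^ (-c) :=
      Real.rpow_le_rpow_of_nonpos (by linarith) (by linarith) (by linarith)
    gcongr
  -- Power decay in the height, for any `c > 0`, suffices to push the horizontal sides to infinity.
  -- The resulting integral over the vertical line converges, possibly only as an improper integral.
  have hLle : ∀ h : ℝ, b ≤ |h| → ‖L h‖ ≤ C * (|h| - m) ^ (-c) * (Real.exp (τ * a) / τ) := by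
    intro h hh
    rw [← integral_exp_mul_Iic hτ, ← integral_const_mul]
    refine norm_integral_le_of_norm_le ((integrableOn_exp_mul_Iic hτ a).const_mul _) ?_
    refine (ae_restrict_iff' measurableSet_Iic).2 (Eventually.of_forall fun x hx => ?_)
    simpa using hb (x + h * Complex.I) (by simpa using hx) (by simpa using hh)
  have hzero : Tendsto (fun B : ℝ => C * (B - m) ^ (-c) * (Real.exp (τ * a) / τ)) atTop
      (𝓝 0) := by
    have h1 : Tendsto (fun B : ℝ => B - m) atTop atTop :=
      tendsto_atTop_add_const_right _ (-m) tendsto_id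
    have := (((tendsto_rpow_neg_atTop hc).comp h1).const_mul C).mul_const (Real.exp (τ * a) / τ)
    simpa using this
  have hup : Tendsto L atTop (𝓝 0) := by
    refine squeeze_zero_norm' ?_ hzero
    filter_upwards [eventually_ge_atTop b] with B hB
    have := hLle B (hB.trans (le_abs_self B))
    rwa [abs_of_nonneg (by linarith)] at this
  have hdown : Tendsto (fun A : ℝ => L (-A)) atTop (𝓝 0) := by
    refine squeeze_zero_norm' ?_ hzero
    filter_upwards [eventually_ge_atTop b] with A hA
    have := hLle (-A) (by rw [abs_neg]; exact hA.trans (le_abs_self A))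
    rwa [abs_neg, abs_of_nonneg (by linarith)] at this
  have key : ∀ A B : ℝ, b ≤ A → b ≤ B →
      Complex.I * ∫ y in (-A)..B, F (a + y * Complex.I) =
        hankelIntegral 1 a b F - L (-A) + L B := by
    intro A B hA hB
    have s1 := integral_horizontal_sub (F := F) (a := a) (h := -A) (k := -b) hτ
      (fun w h1 h2 => hd w h1 (by
        rw [Set.uIcc_of_le (by linarith)] at h2
        rw [abs_of_nonpos (by linarith [h2.2])]; linarith [h2.2]))
      (fun w h1 h2 => hb' w h1 (by
        rw [Set.uIcc_of_le (by linarith)] at h2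
        rw [abs_of_nonpos (by linarith [h2.2])]; linarith [h2.2]))
    have s2 := integral_horizontal_sub (F := F) (a := a) (h := b) (k := B) hτ
      (fun w h1 h2 => hd w h1 (by
        rw [Set.uIcc_of_le (by linarith)] at h2
        exact h2.1.trans (le_abs_self _)))
      (fun w h1 h2 => hb' w h1 (by
        rw [Set.uIcc_of_le (by linarith)] at h2
        exact h2.1.trans (le_abs_self _)))
    rw [← intervalIntegral.integral_add_adjacent_intervals (hv (-A) b) (hv b B),
      ← intervalIntegral.integral_add_adjacent_intervals (hv (-A) (-b)) (hv (-b) b),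
      hankelIntegral_one]
    simp only [hL]
    linear_combination s1 + s2
  have ht : Tendsto (fun p : ℝ × ℝ => hankelIntegral 1 a b F - L (-p.1) + L p.2)
      (atTop ×ˢ atTop) (𝓝 (hankelIntegral 1 a b F)) := by
    have hc := tendsto_const_nhds (x := hankelIntegral 1 a b F)
      (f := (atTop : Filter ℝ) ×ˢ (atTop : Filter ℝ))
    have := (hc.sub (hdown.comp tendsto_fst)).add (hup.comp tendsto_snd)
    simpa using this
  refine ht.congr' ?_
  filter_upwards [(eventually_ge_atTop b).prod_mk (eventually_ge_atTop b)] with p hp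
  exact (key p.1 p.2 hp.1 hp.2).symm

/-- Moving the vertical side of a Hankel loop. -/
theorem hankelIntegral_one_eq_of_differentiableAt {F : ℂ → ℂ} {a a' b : ℝ}
    (hd : ∀ w : ℂ, w.re ∈ Set.uIcc a a' → |w.im| ≤ b → DifferentiableAt ℂ F w) (hb : 0 ≤ b)
    (h1 : ∀ d, IntegrableOn (fun x : ℝ => F (x + (-b : ℝ) * Complex.I)) (Set.Iic d))
    (h2 : ∀ d, IntegrableOn (fun x : ℝ => F (x + b * Complex.I)) (Set.Iic d)) :
    hankelIntegral 1 a b F = hankelIntegral 1 a' b F := by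
  have := Complex.integral_boundary_rect_eq_zero_of_differentiableOn F
    (a + (-b : ℝ) * Complex.I) (a' + b * Complex.I) (fun w hw => by
      obtain ⟨h1, h2⟩ := hw
      simp only [Set.mem_preimage, Complex.add_re, Complex.ofReal_re, Complex.mul_re,
        Complex.I_re, mul_zero, Complex.ofReal_im, Complex.I_im, mul_one, sub_self, add_zero,
        Complex.add_im, Complex.mul_im, zero_add] at h1 h2
      rw [Set.uIcc_of_le (by linarith)] at h2
      exact (hd w h1 (abs_le.2 h2)).differentiableWithinAt)
  have e1 := intervalIntegral.integral_Iic_sub_Iic (h1 a) (h1 a')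
  have e2 := intervalIntegral.integral_Iic_sub_Iic (h2 a) (h2 a')
  rw [hankelIntegral_one, hankelIntegral_one]
  simp only [Complex.add_re, Complex.ofReal_re, Complex.mul_re,
        Complex.I_re, mul_zero, Complex.ofReal_im, Complex.I_im, mul_one, sub_self, add_zero,
        Complex.add_im, Complex.mul_im, zero_add, smul_eq_mul] at this
  linear_combination -this - e1 + e2

/-! ### Hankel's formula -/

/-- Differentiating `e^(v γ)` in `v` produces a factor `γ`, which turns `γ^(-(c+1))` into `γ^(-c)`.
On the three sides of the loop this lowers the exponent in Hankel's formula by one. -/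
theorem hasDerivAt_integral_cexp_mul_negPow {μ : Measure ℝ} {γ : ℝ → ℂ} (hγ : Measurable γ)
    {D r : ℝ} (hr : 0 < r) (hre : ∀ᵐ x ∂μ, (γ x).re ≤ D) (him : ∀ᵐ x ∂μ, |(γ x).im| ≤ D)
    (hdist : ∀ᵐ x ∂μ, r ≤ ‖γ x‖)
    (hint : ∀ ε : ℝ, 0 < ε → Integrable (fun x => Real.exp (ε * (γ x).re)) μ)
    {c : ℝ} (hc : 0 ≤ c) {u : ℂ} (hu : 0 < u.re) :
    Integrable (fun x => Complex.exp (u * γ x) * negPow c (γ x)) μ ∧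
    HasDerivAt (fun v : ℂ => ∫ x, Complex.exp (v * γ x) * negPow (c + 1) (γ x) ∂μ)
      (∫ x, Complex.exp (u * γ x) * negPow c (γ x) ∂μ) u := by
  have hk : ∀ d : ℝ, 0 ≤ d → ∀ ε : ℝ, 0 < ε →
      Integrable (fun x => Real.exp (ε * (γ x).re) * ‖negPow d (γ x)‖) μ := by
    intro d hd ε hε
    refine (hint ε hε).mul_bdd (c := r ^ (-d)) (Measurable.aestronglyMeasurable (by fun_prop)) ?_
    filter_upwards [hdist] with x hx
    rw [norm_norm]
    exact norm_negPow_le hd hr hx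
  refine ⟨(hasDerivAt_integral_cexp_mul hγ (by fun_prop) hre him (hk c hc) hu).1, ?_⟩
  have h := (hasDerivAt_integral_cexp_mul hγ (k := fun x => negPow (c + 1) (γ x)) (by fun_prop)
    hre him (hk (c + 1) (by linarith)) hu).2
  refine h.congr_deriv (integral_congr_ae ?_)
  filter_upwards [hdist] with x hx
  rw [← mul_negPow_add_one c (norm_pos_iff.1 (hr.trans_le hx))]
  ring

theorem sub_le_norm_horizontal_sub {ζ : ℂ} {b : ℝ} (x : ℝ) :
    |b| - |ζ.im| ≤ ‖(x : ℂ) + b * Complex.I - ζ‖ := by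
  have h1 := Complex.abs_im_le_norm ((x : ℂ) + b * Complex.I - ζ)
  have h2 := abs_sub_abs_le_abs_sub b ζ.im
  simp at h1
  linarith

theorem sub_le_norm_vertical_sub {ζ : ℂ} {a : ℝ} (y : ℝ) :
    a - ζ.re ≤ ‖(a : ℂ) + y * Complex.I - ζ‖ := by
  simpa using Complex.re_le_norm ((a : ℂ) + y * Complex.I - ζ)

theorem hasDerivAt_horizontal {c a h : ℝ} (hc : 0 ≤ c) {u ζ : ℂ} (hu : 0 < u.re)
    (hh : |ζ.im| < |h|) :
    IntegrableOn (fun x : ℝ => Complex.exp (u * (x + h * Complex.I - ζ)) *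
      negPow c (x + h * Complex.I - ζ)) (Set.Iic a) ∧
    HasDerivAt (fun v : ℂ => ∫ x in Set.Iic a, Complex.exp (v * (x + h * Complex.I - ζ)) *
      negPow (c + 1) (x + h * Complex.I - ζ))
      (∫ x in Set.Iic a, Complex.exp (u * (x + h * Complex.I - ζ)) *
        negPow c (x + h * Complex.I - ζ)) u := by
  refine hasDerivAt_integral_cexp_mul_negPow (γ := fun x : ℝ => (x : ℂ) + h * Complex.I - ζ)
    (by fun_prop) (D := max (a - ζ.re) |h - ζ.im|) (r := |h| - |ζ.im|) (by linarith) ?_ ?_ ?_ ?_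
    hc hu
  · refine (ae_restrict_iff' measurableSet_Iic).2 (Eventually.of_forall fun x hx => ?_)
    rw [Set.mem_Iic] at hx
    simp [hx]
  · exact Eventually.of_forall fun x => by simp
  · exact Eventually.of_forall fun x => sub_le_norm_horizontal_sub x
  · intro ε hε
    refine ((integrableOn_exp_mul_Iic hε a).mul_const (Real.exp (-(ε * ζ.re)))).congr
      (Eventually.of_forall fun x => ?_)
    dsimp only
    rw [← Real.exp_add]
    simp
    ring

theorem hasDerivAt_vertical {c a b : ℝ} (hc : 0 ≤ c) {u ζ : ℂ} (hu : 0 < u.re)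
    (ha : ζ.re < a) (hb : 0 ≤ b) :
    IntervalIntegrable (fun y : ℝ => Complex.exp (u * (a + y * Complex.I - ζ)) *
      negPow c (a + y * Complex.I - ζ)) volume (-b) b ∧
    HasDerivAt (fun v : ℂ => ∫ y in (-b)..b, Complex.exp (v * (a + y * Complex.I - ζ)) *
      negPow (c + 1) (a + y * Complex.I - ζ))
      (∫ y in (-b)..b, Complex.exp (u * (a + y * Complex.I - ζ)) *
        negPow c (a + y * Complex.I - ζ)) u := by
  simp_rw [intervalIntegrable_iff_integrableOn_Ioc_of_le (show -b ≤ b by linarith),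
    intervalIntegral.integral_of_le (show -b ≤ b by linarith)]
  refine hasDerivAt_integral_cexp_mul_negPow (γ := fun y : ℝ => (a : ℂ) + y * Complex.I - ζ)
    (by fun_prop) (D := max (a - ζ.re) (b + |ζ.im|)) (r := a - ζ.re) (by linarith) ?_ ?_ ?_ ?_
    hc hu
  · exact Eventually.of_forall fun x => by simp
  · refine (ae_restrict_iff' measurableSet_Ioc).2 (Eventually.of_forall fun y hy => ?_)
    have h1 : |y| ≤ b := abs_le.2 ⟨hy.1.le, hy.2⟩
    have h2 := abs_sub y ζ.im
    simp only [Complex.sub_im, Complex.add_im, Complex.ofReal_im, Complex.mul_im,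
      Complex.ofReal_re, Complex.I_im, Complex.I_re, mul_one, mul_zero, add_zero, zero_add]
    exact le_max_of_le_right (by linarith)
  · exact Eventually.of_forall fun x => sub_le_norm_vertical_sub x
  · intro ε hε
    simp

theorem hankelIntegrable_cexp_mul_negPow_sub {c a b : ℝ} (hc : 0 ≤ c) {u ζ : ℂ} (hu : 0 < u.re)
    (ha : ζ.re < a) (hb : |ζ.im| < b) :
    HankelIntegrable 1 a b (fun w => Complex.exp (u * (w - ζ)) * negPow c (w - ζ)) ∧
    HasDerivAt (fun v : ℂ =>
      hankelIntegral 1 a b (fun w => Complex.exp (v * (w - ζ)) * negPow (c + 1) (w - ζ)))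
      (hankelIntegral 1 a b (fun w => Complex.exp (u * (w - ζ)) * negPow c (w - ζ))) u := by
  have hb0 : 0 ≤ b := (abs_nonneg _).trans hb.le
  have hb1 : |ζ.im| < |b| := by rwa [abs_of_nonneg hb0]
  have h1 := hasDerivAt_horizontal (a := a) (h := -b) hc hu (by rwa [abs_neg])
  have h2 := hasDerivAt_vertical hc hu ha hb0
  have h3 := hasDerivAt_horizontal (a := a) (h := b) hc hu hb1
  constructor
  · refine ⟨?_, ?_, ?_⟩
    · simpa [sub_eq_add_neg] using h1.1
    · simpa using h2.1
    · simpa using h3.1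
  · simp_rw [hankelIntegral_one]
    exact (h1.2.add (h2.2.const_mul _)).sub h3.2

theorem sub_mem_slitPlane {w ζ : ℂ} (h : ζ.re < w.re ∨ |ζ.im| < |w.im|) :
    w - ζ ∈ Complex.slitPlane := by
  rcases h with h | h
  · exact Or.inl (by simpa using h)
  · refine Or.inr fun h0 => ?_
    rw [Complex.sub_im, sub_eq_zero] at h0
    rw [h0] at h
    exact lt_irrefl _ h

theorem differentiableAt_negPow_sub (c : ℝ) {w ζ : ℂ} (h : w - ζ ∈ Complex.slitPlane) :
    DifferentiableAt ℂ (fun w => negPow c (w - ζ)) w :=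
  differentiableAt_comp_sub_const.2 (differentiableAt_negPow c h)

/-- The loop opens into the line `Re w = a`, where for `c > 1` the integral converges absolutely and
Laplace inversion evaluates it. -/
theorem hankelIntegral_ofReal_of_one_lt {c a b τ : ℝ} (hc : 1 < c) (hτ : 0 < τ) {ζ : ℂ}
    (ha : ζ.re < a) (hb : |ζ.im| < b) :
    hankelIntegral 1 a b (fun w => Complex.exp (τ * (w - ζ)) * negPow c (w - ζ)) =
      2 * Real.pi * Complex.I / Real.Gamma c * ((τ ^ (c - 1) : ℝ) : ℂ) := by
  have hline := integral_line_cexp_mul_negPow_sub hc hτ ha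
  have e : ∀ w : ℂ, Complex.exp (τ * (w - ζ)) = Complex.exp (-(τ * ζ)) * Complex.exp (τ * w) :=
    fun w => by rw [← Complex.exp_add]; ring_nf
  have ht := tendsto_vertical_hankelIntegral
    (F := fun w => Complex.exp (τ * (w - ζ)) * negPow c (w - ζ)) (a := a) (b := b) (τ := τ)
    (m := |ζ.im|) (C := Real.exp (-(τ * ζ.re))) (c := c) (by linarith) hτ (Real.exp_pos _).le
    (abs_nonneg _) hb (fun w _ h2 => by
      exact DifferentiableAt.mul (by fun_prop)
        (differentiableAt_negPow_sub c (sub_mem_slitPlane (Or.inr (hb.trans_le h2)))))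
    (fun w _ h2 => by
      rw [norm_mul, Complex.norm_exp]
      have h3 := sub_le_norm_horizontal_sub (ζ := ζ) (b := w.im) w.re
      rw [Complex.re_add_im] at h3
      have h4 := norm_negPow_le (c := c) (by linarith) (by linarith) h3
      have h5 : Real.exp ((τ : ℂ) * (w - ζ)).re = Real.exp (-(τ * ζ.re)) * Real.exp (τ * w.re) := by
        rw [← Real.exp_add]; simp; ring
      rw [h5]
      calc Real.exp (-(τ * ζ.re)) * Real.exp (τ * w.re) * ‖negPow c (w - ζ)‖
          ≤ Real.exp (-(τ * ζ.re)) * Real.exp (τ * w.re) * (|w.im| - |ζ.im|) ^ (-c) := by gcongr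
        _ = _ := by ring)
    (fun p q => by
      have := (hline.1.const_mul (Complex.exp (-(τ * ζ)))).intervalIntegrable (a := p) (b := q)
      simpa only [e, mul_assoc] using this)
  have ht2 : Tendsto (fun p : ℝ × ℝ => Complex.I * ∫ y in (-p.1)..p.2,
      Complex.exp (τ * (a + y * Complex.I - ζ)) * negPow c (a + y * Complex.I - ζ))
      (atTop ×ˢ atTop) (𝓝 (Complex.I * (Complex.exp (-(τ * ζ)) * (Complex.exp (τ * ζ) *
        ((2 * Real.pi * τ ^ (c - 1) / Real.Gamma c : ℝ) : ℂ))))) := by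
    have hi := hline.1.const_mul (Complex.exp (-(τ * ζ)))
    rw [← hline.2, ← integral_const_mul]
    simp_rw [e, mul_assoc]
    exact (intervalIntegral_tendsto_integral hi (tendsto_neg_atTop_atBot.comp tendsto_fst)
      tendsto_snd).const_mul Complex.I
  rw [tendsto_nhds_unique ht ht2, ← mul_assoc (Complex.exp _), ← Complex.exp_add]
  simp
  ring

theorem hasDerivAt_cpow_const_of_re_pos {c : ℝ} {z : ℂ} (hz : 0 < z.re) :
    HasDerivAt (fun v : ℂ => v ^ (c : ℂ)) (c * z ^ ((c : ℂ) - 1)) z := by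
  simpa using (hasDerivAt_id z).cpow_const (c := (c : ℂ)) (Or.inl hz)

/-- Hankel's formula, for `c > 1`. -/
theorem hankelIntegral_of_one_lt {c a b : ℝ} (hc : 1 < c) {u ζ : ℂ} (hu : 0 < u.re)
    (ha : ζ.re < a) (hb : |ζ.im| < b) :
    hankelIntegral 1 a b (fun w => Complex.exp (u * (w - ζ)) * negPow c (w - ζ)) =
      2 * Real.pi * Complex.I / Real.Gamma c * u ^ ((c : ℂ) - 1) := by
  refine eqOn_re_pos_of_eq_ofReal
    (f := fun v => hankelIntegral 1 a b (fun w => Complex.exp (v * (w - ζ)) * negPow c (w - ζ)))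
    (g := fun v => 2 * Real.pi * Complex.I / Real.Gamma c * v ^ ((c : ℂ) - 1)) ?_ ?_ ?_ hu
  · intro z hz
    have h := (hankelIntegrable_cexp_mul_negPow_sub (c := c - 1) (by linarith) hz ha
      hb).2.differentiableAt
    simpa only [sub_add_cancel] using h
  · intro z hz
    have := (hasDerivAt_cpow_const_of_re_pos (c := c - 1) hz).differentiableAt
    push_cast at this
    exact this.const_mul _
  · intro x hx
    rw [hankelIntegral_ofReal_of_one_lt hc hx ha hb, Complex.ofReal_cpow hx.le]
    push_cast
    rfl

/-- Hankel's formula. -/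
theorem hankelIntegral_cexp_mul_negPow_sub {c a b : ℝ} (hc : 0 < c) {u ζ : ℂ} (hu : 0 < u.re)
    (ha : ζ.re < a) (hb : |ζ.im| < b) :
    hankelIntegral 1 a b (fun w => Complex.exp (u * (w - ζ)) * negPow c (w - ζ)) =
      2 * Real.pi * Complex.I / Real.Gamma c * u ^ ((c : ℂ) - 1) := by
  have h1 := (hankelIntegrable_cexp_mul_negPow_sub hc.le hu ha hb).2
  have h2 : HasDerivAt (fun v : ℂ => 2 * Real.pi * Complex.I / Real.Gamma (c + 1) * v ^ (c : ℂ))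
      (2 * Real.pi * Complex.I / Real.Gamma (c + 1) * (c * u ^ ((c : ℂ) - 1))) u :=
    (hasDerivAt_cpow_const_of_re_pos hu).const_mul _
  -- The formula is known for `c + 1 > 1` near `u`. Equating the derivatives of its two sides gives
  -- it for `c`, since `Γ(c + 1) = c Γ(c)`.
  have h3 := h1.unique (h2.congr_of_eventuallyEq (by
    filter_upwards [isOpen_re_pos.mem_nhds hu] with v hv
    rw [hankelIntegral_of_one_lt (by linarith) hv ha hb]
    push_cast
    rw [add_sub_cancel_right]))
  have hΓ : (Real.Gamma c : ℂ) ≠ 0 := by exact_mod_cast (Real.Gamma_pos_of_pos hc).ne'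
  have hc' : (c : ℂ) ≠ 0 := by exact_mod_cast hc.ne'
  rw [h3, Real.Gamma_add_one hc.ne']
  push_cast
  field_simp

/-! ### The rotated loop and the branch of the logarithm -/

theorem norm_contourSign (u : ℂ) : ‖contourSign u‖ = 1 := by
  unfold contourSign
  split_ifs <;> simp

theorem re_mul_contourSign_pos {u : ℂ} (hu : u ≠ 0) : 0 < (u * contourSign u).re := by
  unfold contourSign
  split_ifs with h1 h2 h3
  · simpa using h1
  · simpa using h2
  · simpa using h3
  · have hre : u.re = 0 := le_antisymm (not_lt.1 h1) (not_lt.1 h2)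
    have him : u.im ≠ 0 := fun h => hu (Complex.ext hre h)
    simpa using lt_of_le_of_ne (not_lt.1 h3) him

theorem norm_div_contourSign (u : ℂ) (s : ℝ) : ‖(s : ℂ) / contourSign u‖ = |s| := by
  rw [norm_div, norm_contourSign, Complex.norm_real, div_one, Real.norm_eq_abs]

theorem abs_re_div_contourSign_le (u : ℂ) (s : ℝ) : |((s : ℂ) / contourSign u).re| ≤ |s| :=
  (Complex.abs_re_le_norm _).trans (norm_div_contourSign u s).le

theorem abs_im_div_contourSign_le (u : ℂ) (s : ℝ) : |((s : ℂ) / contourSign u).im| ≤ |s| :=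
  (Complex.abs_im_le_norm _).trans (norm_div_contourSign u s).le

/-- The phase by which the rotated loop differs from the unrotated one. -/
noncomputable def hankelPhase (c : ℝ) (u : ℂ) : ℂ :=
  Complex.exp (-(c : ℂ) * (Complex.log (u * contourSign u) - Complex.log u))

/-- With `ω = contourSign u`, the phase `e^(-c (log (u ω) - log u))` converts `ω (u ω)^(c-1)` into
the principal power `u^(c-1)`. This is the purpose of the normalisation of `branchLog`. -/
theorem hankelFactor_mul {c : ℝ} (hc : 0 < c) {u : ℂ} (hu : u ≠ 0) :
    hankelFactor c u * (contourSign u * hankelPhase c u *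
      (2 * Real.pi * Complex.I / Real.Gamma c * (u * contourSign u) ^ ((c : ℂ) - 1))) = 1 := by
  have hω := contourSign_ne_zero u
  have hu' := mul_ne_zero hu hω
  have hΓ : (Real.Gamma c : ℂ) ≠ 0 := by exact_mod_cast (Real.Gamma_pos_of_pos hc).ne'
  have hpi : (Real.pi : ℂ) ≠ 0 := by exact_mod_cast Real.pi_pos.ne'
  have hpow : u ^ ((c : ℂ) - 1) ≠ 0 := by simp [Complex.cpow_eq_zero_iff, hu]
  have key : contourSign u * hankelPhase c u * (u * contourSign u) ^ ((c : ℂ) - 1) =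
      u ^ ((c : ℂ) - 1) := by
    rw [Complex.cpow_def_of_ne_zero hu', Complex.cpow_def_of_ne_zero hu, hankelPhase, mul_assoc,
      ← Complex.exp_add,
      show -(c : ℂ) * (Complex.log (u * contourSign u) - Complex.log u) +
        Complex.log (u * contourSign u) * (c - 1) =
        Complex.log u * (c - 1) + (Complex.log u - Complex.log (u * contourSign u)) by ring,
      Complex.exp_add, Complex.exp_sub, Complex.exp_log hu, Complex.exp_log hu']
    field_simp
  rw [hankelFactor]
  calc _ = (contourSign u * hankelPhase c u * (u * contourSign u) ^ ((c : ℂ) - 1)) /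
        u ^ ((c : ℂ) - 1) := by field_simp
    _ = 1 := by rw [key, div_self hpow]

theorem integrable_log_sub_div {ρ : Measure ℝ} [IsFiniteMeasure ρ] {M : ℝ}
    (hM : ∀ᵐ s ∂ρ, |s| ≤ M) {u w : ℂ}
    (hw : ∀ s : ℝ, |s| ≤ M → w - s / contourSign u ∈ Complex.slitPlane) :
    Integrable (fun s : ℝ => Complex.log (w - s / contourSign u)) ρ := by
  have hc : ContinuousOn (fun s : ℝ => Complex.log (w - s / contourSign u)) (Set.Icc (-M) M) := by
    intro s hs
    refine ContinuousAt.continuousWithinAt ?_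
    exact ContinuousAt.clog (by fun_prop) (hw s (abs_le.2 hs))
  obtain ⟨C, hC⟩ := isCompact_Icc.exists_bound_of_continuousOn hc
  refine Integrable.of_bound (Measurable.aestronglyMeasurable (by fun_prop)) C ?_
  filter_upwards [hM] with s hs
  exact hC s (abs_le.1 hs)

/-- At `z = ω w` the rotated branch is the principal logarithm of `w - s/ω` plus a constant, which
comes out of the integral because `ρ` has mass one. -/
theorem hankelIntegrand_mul {c : ℝ} {ρ : Measure ℝ} [IsProbabilityMeasure ρ] {u w : ℂ}
    (hint : Integrable (fun s : ℝ => Complex.log (w - s / contourSign u)) ρ) :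
    hankelIntegrand c u ρ (contourSign u * w) = hankelPhase c u *
      (Complex.exp (u * contourSign u * w) *
        Complex.exp (-(c : ℂ) * ∫ s : ℝ, Complex.log (w - s / contourSign u) ∂ρ)) := by
  have hω := contourSign_ne_zero u
  have e : ∀ s : ℝ, branchLog u (contourSign u * w - s) =
      Complex.log (w - s / contourSign u) +
        (Complex.log (u * contourSign u) - Complex.log u) := fun s => by
    rw [branchLog, sub_div, mul_div_cancel_left₀ _ hω, add_sub_assoc]
  simp_rw [hankelIntegrand, e]
  rw [integral_add hint (integrable_const _), integral_const, probReal_univ, one_smul,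
    hankelPhase, ← Complex.exp_add, ← Complex.exp_add]
  generalize (∫ s : ℝ, Complex.log (w - s / contourSign u) ∂ρ) = J
  ring_nf

/-- The Markov-Krein identity for the rotated branch of the logarithm, outside of the cut. -/
theorem IsMarkovKrein.exp_integral_log_sub_div {c : ℝ} {ρ ν : Measure ℝ}
    [IsProbabilityMeasure ρ] [IsProbabilityMeasure ν] (h : IsMarkovKrein c ρ ν) {M : ℝ}
    (hM : ∀ᵐ s ∂ρ, |s| ≤ M) (hMν : ∀ᵐ s ∂ν, |s| ≤ M) {u w : ℂ}
    (hw : ∀ s : ℝ, |s| ≤ M → w - s / contourSign u ∈ Complex.slitPlane)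
    (him : (contourSign u * w).im ≠ 0) :
    Complex.exp (-(c : ℂ) * ∫ s : ℝ, Complex.log (w - s / contourSign u) ∂ρ) =
      ∫ x : ℝ, negPow c (w - x / contourSign u) ∂ν := by
  have hω := contourSign_ne_zero u
  set z := contourSign u * w with hz
  have hzs : ∀ s : ℝ, z - s ∈ Complex.slitPlane := fun s => Or.inr (by simpa using him)
  have e : ∀ s : ℝ, w - s / contourSign u = (z - s) / contourSign u := fun s => by
    rw [hz]; field_simp
  -- The arguments of the two logarithms are proportional and avoid the cut for all `s` in `[-M,
  -- M]`, so the difference has zero derivative in `s`. The constant contributes the same factor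
  -- `e^(-c k)` to both sides.
  obtain ⟨k, hk⟩ : ∃ k : ℂ, ∀ s : ℝ, |s| ≤ M →
      Complex.log (w - s / contourSign u) = Complex.log (z - s) + k := by
    set d : ℝ → ℂ := fun s => Complex.log (w - s / contourSign u) - Complex.log (z - s) with hd
    have hder : ∀ s : ℝ, |s| ≤ M → HasDerivAt d 0 s := by
      intro s hs
      have h1 : HasDerivAt (fun s : ℝ => w - (s : ℂ) / contourSign u) (-(1 / contourSign u)) s := by
        simpa using ((Complex.ofRealCLM.hasDerivAt (x := s)).div_const (contourSign u)).const_sub w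
      have h2 : HasDerivAt (fun s : ℝ => z - (s : ℂ)) (-1) s := by
        simpa using (Complex.ofRealCLM.hasDerivAt (x := s)).const_sub z
      refine ((h1.clog_real (hw s hs)).sub (h2.clog_real (hzs s))).congr_deriv ?_
      rw [e]
      have h3 := Complex.slitPlane_ne_zero (hzs s)
      field_simp
      ring
    refine ⟨d (-M), fun s hs => ?_⟩
    have := constant_of_has_deriv_right_zero (f := d) (a := -M) (b := M)
      (fun s hs => (hder s (abs_le.2 hs)).continuousAt.continuousWithinAt)
      (fun s hs => (hder s (abs_le.2 ⟨hs.1, hs.2.le⟩)).hasDerivWithinAt) s (abs_le.1 hs)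
    rw [← this, hd]
    ring
  have hint := integrable_log_sub_div hM hw
  have h1 : ∫ s : ℝ, Complex.log (z - s) ∂ρ =
      (∫ s : ℝ, Complex.log (w - s / contourSign u) ∂ρ) - k := by
    have : ∫ s : ℝ, Complex.log (z - s) ∂ρ =
        ∫ s : ℝ, (Complex.log (w - s / contourSign u) - k) ∂ρ := by
      refine integral_congr_ae ?_
      filter_upwards [hM] with s hs
      rw [hk s hs]; ring
    rw [this, integral_sub hint (integrable_const _), integral_const, probReal_univ, one_smul]
  have h2 : ∫ x : ℝ, negPow c (w - x / contourSign u) ∂ν =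
      Complex.exp (-(c : ℂ) * k) * ∫ x : ℝ, 1 / (z - (x : ℂ)) ^ (c : ℂ) ∂ν := by
    rw [← integral_const_mul]
    refine integral_congr_ae ?_
    filter_upwards [hMν] with s hs
    rw [one_div_cpow_eq_negPow c (Complex.slitPlane_ne_zero (hzs s)), negPow, hk s hs, negPow,
      ← Complex.exp_add]
    ring_nf
  rw [h2, h.2 z him, h1, ← Complex.exp_add]
  generalize (∫ s : ℝ, Complex.log (w - s / contourSign u) ∂ρ) = J
  ring_nf

/-! ### The loop formula for compact support -/

/-- Fubini's theorem for one piece of the contour. -/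
theorem integral_piece_swap {c r : ℝ} (hc : 0 ≤ c) (hr : 0 < r) {ν μ : Measure ℝ}
    [IsProbabilityMeasure ν] [SFinite μ] {v ω : ℂ} {γ : ℝ → ℂ} (hγ : Measurable γ)
    (hexp : Integrable (fun y => Complex.exp (v * γ y)) μ)
    (hdist : ∀ᵐ x : ℝ ∂ν, ∀ y : ℝ, r ≤ ‖γ y - (x : ℂ) / ω‖) :
    Integrable (fun y => ∫ x : ℝ, Complex.exp (v * γ y) * negPow c (γ y - x / ω) ∂ν) μ ∧
    Integrable (fun x : ℝ => ∫ y, Complex.exp (v * γ y) * negPow c (γ y - x / ω) ∂μ) ν ∧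
    ∫ y, (∫ x : ℝ, Complex.exp (v * γ y) * negPow c (γ y - x / ω) ∂ν) ∂μ =
      ∫ x : ℝ, (∫ y, Complex.exp (v * γ y) * negPow c (γ y - x / ω) ∂μ) ∂ν := by
  have hI : Integrable (Function.uncurry fun (y x : ℝ) =>
      Complex.exp (v * γ y) * negPow c (γ y - x / ω)) (μ.prod ν) := by
    refine Integrable.mul_bdd (c := r ^ (-c)) (f := fun p : ℝ × ℝ => Complex.exp (v * γ p.1))
      (g := fun p : ℝ × ℝ => negPow c (γ p.1 - p.2 / ω)) (hexp.comp_fst ν)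
      (Measurable.aestronglyMeasurable (by fun_prop)) ?_
    have := (Measure.quasiMeasurePreserving_snd (μ := μ) (ν := ν)).ae hdist
    filter_upwards [this] with p hp
    exact norm_negPow_le hc hr (hp p.1)
  exact ⟨hI.integral_prod_left, hI.integral_prod_right, integral_integral_swap hI⟩

/-- The Markov-Krein identity is available only at non-real `z`, so the integrands are compared
almost everywhere on each side of the loop. -/
theorem hankelIntegral_congr {a b : ℝ} {f g : ℂ → ℂ}
    (h1 : ∀ᵐ x : ℝ, f (x + (-b : ℝ) * Complex.I) = g (x + (-b : ℝ) * Complex.I))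
    (h2 : ∀ᵐ y : ℝ, f (a + y * Complex.I) = g (a + y * Complex.I))
    (h3 : ∀ᵐ x : ℝ, f (x + b * Complex.I) = g (x + b * Complex.I)) :
    (HankelIntegrable 1 a b g → HankelIntegrable 1 a b f) ∧
      hankelIntegral 1 a b f = hankelIntegral 1 a b g := by
  have h1' : ∀ᵐ x : ℝ, f (1 * (x - b * Complex.I)) = g (1 * (x - b * Complex.I)) := by
    simpa [sub_eq_add_neg] using h1
  constructor
  · rintro ⟨g1, g2, g3⟩
    refine ⟨?_, ?_, ?_⟩
    · refine Integrable.congr g1 (ae_restrict_of_ae ?_)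
      filter_upwards [h1'] with x hx using hx.symm
    · refine g2.congr_ae (ae_restrict_of_ae ?_)
      filter_upwards [h2] with y hy
      simpa using hy.symm
    · refine Integrable.congr g3 (ae_restrict_of_ae ?_)
      filter_upwards [h3] with x hx
      simpa using hx.symm
  · rw [hankelIntegral_one, hankelIntegral_one, integral_congr_ae (ae_restrict_of_ae h1),
      integral_congr_ae (ae_restrict_of_ae h3),
      intervalIntegral.integral_congr_ae (h2.mono fun _ h _ => h)]

theorem ae_ne_zero_of_affine {p q : ℝ} (h : p ≠ 0 ∨ q ≠ 0) : ∀ᵐ x : ℝ, p * x + q ≠ 0 := by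
  by_cases hp : p = 0
  · refine Eventually.of_forall fun x => ?_
    simpa [hp] using h
  · have : ∀ᵐ x : ℝ, x ≠ -q / p := Measure.ae_ne _ _
    filter_upwards [this] with x hx h0
    apply hx
    rw [eq_div_iff hp]
    linarith

/-- The Hankel loop formula for compactly supported `ρ`. -/
theorem IsMarkovKrein.hankel {c : ℝ} (hc : 0 < c) {ρ ν : Measure ℝ}
    [IsProbabilityMeasure ρ] [IsProbabilityMeasure ν] (h : IsMarkovKrein c ρ ν) {M : ℝ}
    (hM0 : 0 ≤ M) (hM : ∀ᵐ s ∂ρ, |s| ≤ M) (hMν : ∀ᵐ s ∂ν, |s| ≤ M) {u : ℂ} (hu : u ≠ 0)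
    {a b : ℝ} (ha : M < a) (hb : M < b) :
    HankelIntegrable (contourSign u) a b (hankelIntegrand c u ρ) ∧
    ∫ x : ℝ, Complex.exp (x * u) ∂ν =
      hankelFactor c u * hankelIntegral (contourSign u) a b (hankelIntegrand c u ρ) := by
  have hω := contourSign_ne_zero u
  set ω := contourSign u with hωdef
  set v := u * ω with hv
  have hvre : 0 < v.re := re_mul_contourSign_pos hu
  have hre : ∀ s : ℝ, |s| ≤ M → ((s : ℂ) / ω).re ≤ M := fun s hs =>
    (le_abs_self _).trans ((abs_re_div_contourSign_le u s).trans hs)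
  have him : ∀ s : ℝ, |s| ≤ M → |((s : ℂ) / ω).im| ≤ M := fun s hs =>
    (abs_im_div_contourSign_le u s).trans hs
  set Φ : ℂ → ℝ → ℂ := fun w x => Complex.exp (v * w) * negPow c (w - x / ω) with hΦ
  set F : ℂ → ℂ := fun w => hankelIntegrand c u ρ (ω * w) with hF
  set G : ℂ → ℂ := fun w => hankelPhase c u * ∫ x : ℝ, Φ w x ∂ν with hG
  have hFG : ∀ w : ℂ, (M < w.re ∨ M < |w.im|) → (ω * w).im ≠ 0 → F w = G w := by
    intro w hw hwim
    have hslit : ∀ s : ℝ, |s| ≤ M → w - s / ω ∈ Complex.slitPlane := fun s hs =>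
      sub_mem_slitPlane (hw.imp (fun h => (hre s hs).trans_lt h) (fun h => (him s hs).trans_lt h))
    simp only [hF, hG, hΦ]
    rw [hankelIntegrand_mul (integrable_log_sub_div hM hslit),
      h.exp_integral_log_sub_div hM hMν hslit hwim, integral_const_mul]
  have hω' : ω.re ≠ 0 ∨ ω.im ≠ 0 := by
    by_contra! h0
    exact hω (Complex.ext h0.1 h0.2)
  have hb0 : 0 < b := by linarith
  have ha0 : 0 < a := by linarith
  have hhor : ∀ k : ℝ, |k| = b → ∀ᵐ x : ℝ, F (x + k * Complex.I) = G (x + k * Complex.I) := by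
    intro k hk
    have hk0 : k ≠ 0 := by rintro rfl; simp at hk; linarith
    have h1 : ω.im ≠ 0 ∨ ω.re * k ≠ 0 := hω'.symm.imp_right fun h => mul_ne_zero h hk0
    -- Along a side of the loop, `Im (ω w)` is a nonzero affine function of the parameter, so it
    -- vanishes at most once.
    filter_upwards [ae_ne_zero_of_affine h1] with x hx
    refine hFG _ (Or.inr (by simpa [hk] using hb)) ?_
    rw [Complex.mul_im]
    simpa [add_comm] using hx
  have hver : ∀ᵐ y : ℝ, F (a + y * Complex.I) = G (a + y * Complex.I) := by
    have h1 : ω.re ≠ 0 ∨ ω.im * a ≠ 0 := hω'.imp_right fun h => mul_ne_zero h ha0.ne'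
    filter_upwards [ae_ne_zero_of_affine h1] with y hy
    refine hFG _ (Or.inl (by simpa using ha)) ?_
    rw [Complex.mul_im]
    simpa using hy
  obtain ⟨hcI, hcE⟩ := hankelIntegral_congr (f := F) (g := G) (hhor (-b) (by simp [hb0.le])) hver
    (hhor b (abs_of_pos hb0))
  have hexpH : ∀ k : ℝ, IntegrableOn (fun x : ℝ => Complex.exp (v * (x + k * Complex.I)))
      (Set.Iic a) := by
    intro k
    have h1 := (integrableOn_exp_mul_complex_Iic (a := v) hvre a).const_mul
      (Complex.exp (v * (k * Complex.I)))
    refine h1.congr (Eventually.of_forall fun x => ?_)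
    dsimp only
    rw [← Complex.exp_add]
    ring_nf
  have pH : ∀ k : ℝ, |k| = b → _ := fun k hk =>
    integral_piece_swap (ν := ν) (μ := volume.restrict (Set.Iic a)) hc.le (sub_pos.2 hb) (v := v)
      (ω := ω) (γ := fun x : ℝ => (x : ℂ) + k * Complex.I) (by fun_prop) (hexpH k) (by
        filter_upwards [hMν] with x hx y
        have := sub_le_norm_horizontal_sub (ζ := (x : ℂ) / ω) (b := k) y
        rw [hk] at this
        linarith [him x hx])
  have p1 := pH (-b) (by simp [hb0.le])
  have p3 := pH b (abs_of_pos hb0)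
  have p2 := integral_piece_swap (ν := ν) (μ := volume.restrict (Set.Ioc (-b) b)) hc.le
      (sub_pos.2 ha) (v := v)
      (ω := ω) (γ := fun y : ℝ => (a : ℂ) + y * Complex.I) (by fun_prop)
      ((by fun_prop : Continuous fun y : ℝ =>
        Complex.exp (v * (a + y * Complex.I))).integrableOn_Ioc) (by
        filter_upwards [hMν] with x hx y
        have := sub_le_norm_vertical_sub (ζ := (x : ℂ) / ω) (a := a) y
        linarith [hre x hx])
  have hGI : HankelIntegrable 1 a b G := by
    refine ⟨?_, ?_, ?_⟩
    · simpa only [hG, hΦ, IntegrableOn, one_mul, Complex.ofReal_neg, neg_mul, ← sub_eq_add_neg]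
        using p1.1.const_mul (hankelPhase c u)
    · rw [intervalIntegrable_iff_integrableOn_Ioc_of_le (by linarith)]
      simpa only [hG, hΦ, IntegrableOn, one_mul] using p2.1.const_mul (hankelPhase c u)
    · simpa only [hG, hΦ, IntegrableOn, one_mul] using p3.1.const_mul (hankelPhase c u)
  have hGE : hankelIntegral 1 a b G = hankelPhase c u *
      ∫ x : ℝ, hankelIntegral 1 a b (fun w => Φ w x) ∂ν := by
    simp_rw [hankelIntegral_one, intervalIntegral.integral_of_le (show -b ≤ b by linarith)]
    have e := integral_sub (p1.2.1.add (p2.2.1.const_mul Complex.I)) p3.2.1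
    simp only [Pi.add_apply] at e
    have e' := integral_add p1.2.1 (p2.2.1.const_mul Complex.I)
    rw [integral_const_mul Complex.I] at e'
    rw [← p1.2.2, ← p2.2.2] at e'
    rw [e', ← p3.2.2] at e
    simp only [hG, hΦ, integral_const_mul (hankelPhase c u)]
    rw [e]
    ring
  -- Since `v x / ω = u x`, one has `e^(v w) = e^(x u) e^(v (w - x/ω))`, and Hankel's formula
  -- applies with `ζ = x/ω`, which the loop encloses.
  have hinner : ∀ᵐ x ∂ν, hankelIntegral 1 a b (fun w => Φ w x) =
      Complex.exp (x * u) * (2 * Real.pi * Complex.I / Real.Gamma c * v ^ ((c : ℂ) - 1)) := by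
    filter_upwards [hMν] with x hx
    rw [← hankelIntegral_cexp_mul_negPow_sub hc hvre (a := a) (b := b) (ζ := (x : ℂ) / ω)
      ((hre x hx).trans_lt ha) ((him x hx).trans_lt hb)]
    have e : ∀ w : ℂ, Φ w x = Complex.exp (x * u) *
        (Complex.exp (v * (w - x / ω)) * negPow c (w - x / ω)) := by
      intro w
      rw [← mul_assoc, ← Complex.exp_add]
      simp only [hΦ, hv]
      congr 2
      field_simp
      ring
    simp_rw [e, hankelIntegral_one, integral_const_mul, intervalIntegral.integral_const_mul]
    ring
  refine ⟨(hankelIntegrable_iff _ _ _ _).2 (hcI hGI), ?_⟩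
  have hfin : hankelIntegral ω a b (hankelIntegrand c u ρ) =
      (ω * hankelPhase c u * (2 * Real.pi * Complex.I / Real.Gamma c * v ^ ((c : ℂ) - 1))) *
        ∫ x : ℝ, Complex.exp (x * u) ∂ν := by
    rw [hankelIntegral_eq_mul, show (fun w => hankelIntegrand c u ρ (ω * w)) = F from rfl, hcE,
      hGE, integral_congr_ae hinner, integral_mul_const]
    ring
  rw [hfin, ← mul_assoc, hankelFactor_mul hc hu, one_mul]

/-! ### Imaginary `u`: lines instead of loops -/

theorem contourSign_I_mul {t : ℝ} (ht : t ≠ 0) :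
    contourSign (Complex.I * t) = -Complex.I * Real.sign t := by
  rcases lt_or_gt_of_ne ht with h | h
  · simp [contourSign, Real.sign_of_neg h, h.le]
  · simp [contourSign, Real.sign_of_pos h, h]

theorem sign_mul_self_of_ne_zero {t : ℝ} (ht : t ≠ 0) : Real.sign t * Real.sign t = 1 := by
  rcases lt_or_gt_of_ne ht with h | h
  · simp [Real.sign_of_neg h]
  · simp [Real.sign_of_pos h]

theorem contourSign_I_mul_mul_I {t : ℝ} (ht : t ≠ 0) :
    contourSign (Complex.I * t) * Complex.I = Real.sign t := by
  rw [contourSign_I_mul ht]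
  linear_combination -(Real.sign t : ℂ) * Complex.I_mul_I

theorem div_contourSign_I_mul {t : ℝ} (ht : t ≠ 0) (s : ℝ) :
    (s : ℂ) / contourSign (Complex.I * t) = ((Real.sign t * s : ℝ) : ℂ) * Complex.I := by
  have h : (Real.sign t : ℂ) * Real.sign t = 1 := by exact_mod_cast sign_mul_self_of_ne_zero ht
  rw [div_eq_iff (contourSign_ne_zero _), contourSign_I_mul ht]
  push_cast
  linear_combination (-(s : ℂ)) * h + (Real.sign t : ℂ) * s * Real.sign t * Complex.I_mul_I

theorem I_mul_mul_contourSign {t : ℝ} (ht : t ≠ 0) :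
    Complex.I * t * contourSign (Complex.I * t) = ((|t| : ℝ) : ℂ) := by
  have h : t * Real.sign t = |t| := by
    rcases lt_or_gt_of_ne ht with h | h
    · simp [Real.sign_of_neg h, abs_of_neg h]
    · simp [Real.sign_of_pos h, abs_of_pos h]
  rw [contourSign_I_mul ht, ← h]
  push_cast
  linear_combination (-(t : ℂ)) * Real.sign t * Complex.I_mul_I

theorem linePoint_eq_contourSign_mul {t : ℝ} (ht : t ≠ 0) (δ y : ℝ) :
    linePoint t δ y =
      contourSign (Complex.I * t) * (δ + ((Real.sign t * y : ℝ) : ℂ) * Complex.I) := by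
  have h : (Real.sign t : ℂ) * Real.sign t = 1 := by exact_mod_cast sign_mul_self_of_ne_zero ht
  rw [linePoint, contourSign_I_mul ht]
  push_cast
  linear_combination (-(y : ℂ)) * h + (Real.sign t : ℂ) * y * Real.sign t * Complex.I_mul_I

/-- Rotation carries the vertical line to the horizontal one. For `t < 0` it reverses the parameter,
which swaps the two end points; this is harmless because they tend to infinity independently. -/
theorem hasLineIntegral_of_tendsto_vertical {t δ : ℝ} (ht : t ≠ 0) {f : ℂ → ℂ} {J : ℂ}
    (h : Tendsto (fun p : ℝ × ℝ => Complex.I * ∫ y in (-p.1)..p.2,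
      f (contourSign (Complex.I * t) * (δ + y * Complex.I))) (atTop ×ˢ atTop) (𝓝 J)) :
    HasLineIntegral t δ f (contourSign (Complex.I * t) * J) := by
  have h' := h.const_mul (contourSign (Complex.I * t))
  simp_rw [← mul_assoc, contourSign_I_mul_mul_I ht] at h'
  unfold HasLineIntegral
  simp_rw [linePoint_eq_contourSign_mul ht]
  rcases lt_or_gt_of_ne ht with hs | hs
  · have hsw : Tendsto (Prod.swap : ℝ × ℝ → ℝ × ℝ) (atTop ×ˢ atTop) (atTop ×ˢ atTop) := by
      exact tendsto_snd.prodMk tendsto_fst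
    refine (h'.comp hsw).congr fun p => ?_
    have := intervalIntegral.integral_comp_neg (a := -p.1) (b := p.2)
      (fun y : ℝ => f (contourSign (Complex.I * t) * (δ + y * Complex.I)))
    simp only [neg_neg] at this
    simp [Real.sign_of_neg hs] at this ⊢
    rw [this]
  · simpa [Real.sign_of_pos hs] using h'

theorem differentiableAt_integral_log_sub {ρ : Measure ℝ} [IsFiniteMeasure ρ] {ζ : ℝ → ℂ}
    (hζ : Measurable ζ) {w₀ : ℂ} {ε : ℝ} (hε : 0 < ε)
    (hb : ∀ᵐ s ∂ρ, ∀ w ∈ Metric.ball w₀ ε, w - ζ s ∈ Complex.slitPlane ∧ ε ≤ ‖w - ζ s‖)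
    (hint : Integrable (fun s => Complex.log (w₀ - ζ s)) ρ) :
    DifferentiableAt ℂ (fun w => ∫ s, Complex.log (w - ζ s) ∂ρ) w₀ := by
  refine (hasDerivAt_integral_of_dominated_loc_of_deriv_le (bound := fun _ => 1 / ε)
    (F' := fun w s => 1 / (w - ζ s)) (Metric.ball_mem_nhds w₀ hε)
    (Eventually.of_forall fun w => Measurable.aestronglyMeasurable (by fun_prop)) hint
    (Measurable.aestronglyMeasurable (by fun_prop)) ?_ (integrable_const _) ?_).2.differentiableAt
  · filter_upwards [hb] with s hs w hw
    rw [norm_div, norm_one]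
    exact one_div_le_one_div_of_le hε (hs w hw).2
  · filter_upwards [hb] with s hs w hw
    exact ((hasDerivAt_id w).sub_const (ζ s)).clog (hs w hw).1

/-- Outside of a horizontal strip that contains `ζ`, the exponential of the log potential
decays like a power. -/
theorem norm_exp_integral_log_sub_le {c : ℝ} (hc : 0 ≤ c) {ρ : Measure ℝ} [IsProbabilityMeasure ρ]
    {ζ : ℝ → ℂ} {w : ℂ} {r : ℝ} (hr : 0 < r) (hb : ∀ᵐ s ∂ρ, r ≤ ‖w - ζ s‖)
    (hint : Integrable (fun s => Complex.log (w - ζ s)) ρ) :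
    ‖Complex.exp (-(c : ℂ) * ∫ s, Complex.log (w - ζ s) ∂ρ)‖ ≤ r ^ (-c) := by
  have e := integral_re hint
  have hi := hint.re
  rw [RCLike.re_eq_complex_re] at e hi
  have h1 : Real.log r ≤ (∫ s, Complex.log (w - ζ s) ∂ρ).re := by
    rw [← e]
    have : ∫ _, Real.log r ∂ρ = Real.log r := by simp
    rw [← this]
    refine integral_mono_ae (integrable_const _) hi ?_
    filter_upwards [hb] with s hs
    rw [Complex.log_re]
    exact Real.log_le_log hr hs
  rw [Complex.norm_exp, Real.rpow_def_of_pos hr, Real.exp_le_exp]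
  simp only [Complex.mul_re, Complex.neg_re, Complex.ofReal_re, Complex.neg_im, Complex.ofReal_im]
  nlinarith

/-- For imaginary `u` and compactly supported `ρ`, the Hankel loop can be opened into a line. -/
theorem hasLineIntegral_hankelIntegral {c : ℝ} (hc : 0 < c) {ρ : Measure ℝ}
    [IsProbabilityMeasure ρ] {M : ℝ} (hM0 : 0 ≤ M) (hM : ∀ᵐ s ∂ρ, |s| ≤ M) {t : ℝ} (ht : t ≠ 0)
    {δ : ℝ} (hδ : 0 < δ) {a b : ℝ} (ha : M < a) (hb : M < b) :
    HasLineIntegral t δ (hankelIntegrand c (Complex.I * t) ρ)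
      (hankelIntegral (contourSign (Complex.I * t)) a b
        (hankelIntegrand c (Complex.I * t) ρ)) := by
  set u : ℂ := Complex.I * t with hu
  set ζ : ℝ → ℂ := fun s => (s : ℂ) / contourSign u with hζ
  have hζm : Measurable ζ := by fun_prop
  -- The singularities lie on the imaginary axis, so `F` is holomorphic on the whole half-plane `Re
  -- w > 0`, and `δ` may be smaller than `M`.
  have hre : ∀ s, (ζ s).re = 0 := fun s => by simp [hζ, hu, div_contourSign_I_mul ht]
  have him : ∀ s : ℝ, |s| ≤ M → |(ζ s).im| ≤ M := fun s hs =>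
    (abs_im_div_contourSign_le u s).trans hs
  have hslit : ∀ w : ℂ, (0 < w.re ∨ M < |w.im|) → ∀ s : ℝ, |s| ≤ M →
      w - ζ s ∈ Complex.slitPlane := fun w hw s hs =>
    sub_mem_slitPlane (hw.imp (fun h => by rwa [hre]) (fun h => (him s hs).trans_lt h))
  have hint : ∀ w : ℂ, (0 < w.re ∨ M < |w.im|) →
      Integrable (fun s => Complex.log (w - ζ s)) ρ := fun w hw =>
    integrable_log_sub_div hM (hslit w hw)
  have hdist : ∀ (w : ℂ) (s : ℝ), |s| ≤ M → |w.im| - M ≤ ‖w - ζ s‖ := by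
    intro w s hs
    have h1 := Complex.abs_im_le_norm (w - ζ s)
    have h2 := abs_sub_abs_le_abs_sub w.im (ζ s).im
    rw [Complex.sub_im] at h1
    linarith [him s hs]
  set F : ℂ → ℂ := fun w => hankelIntegrand c u ρ (contourSign u * w) with hF
  have hFeq : ∀ w : ℂ, (0 < w.re ∨ M < |w.im|) → F w = hankelPhase c u *
      (Complex.exp (u * contourSign u * w) *
        Complex.exp (-(c : ℂ) * ∫ s : ℝ, Complex.log (w - ζ s) ∂ρ)) := fun w hw =>
    hankelIntegrand_mul (hint w hw)
  have hd : ∀ w : ℂ, (0 < w.re ∨ M < |w.im|) → DifferentiableAt ℂ F w := by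
    intro w hw
    have hopen : IsOpen {w : ℂ | 0 < w.re ∨ M < |w.im|} :=
      (isOpen_lt continuous_const Complex.continuous_re).union
        (isOpen_lt continuous_const Complex.continuous_im.abs)
    have hlog : DifferentiableAt ℂ (fun w => ∫ s, Complex.log (w - ζ s) ∂ρ) w := by
      rcases hw with h | h
      · refine differentiableAt_integral_log_sub hζm (half_pos h) ?_ (hint w (Or.inl h))
        filter_upwards [hM] with s hs z hz
        have h1 := (Complex.abs_re_le_norm (z - w)).trans_lt (mem_ball_iff_norm.1 hz)
        rw [Complex.sub_re, abs_lt] at h1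
        refine ⟨hslit z (Or.inl (by linarith)) s hs, ?_⟩
        refine le_trans ?_ (Complex.re_le_norm _)
        rw [Complex.sub_re, hre]
        linarith
      · refine differentiableAt_integral_log_sub hζm (half_pos (sub_pos.2 h)) ?_
          (hint w (Or.inr h))
        filter_upwards [hM] with s hs z hz
        have h1 := (Complex.abs_im_le_norm (z - w)).trans_lt (mem_ball_iff_norm.1 hz)
        have h2 := abs_sub_abs_le_abs_sub w.im z.im
        rw [abs_sub_comm] at h2
        rw [Complex.sub_im] at h1
        exact ⟨hslit z (Or.inr (by linarith)) s hs, by linarith [hdist z s hs]⟩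
    refine DifferentiableAt.congr_of_eventuallyEq ?_
      (eventually_of_mem (hopen.mem_nhds hw) fun z hz => hFeq z hz)
    fun_prop
  have hv : u * contourSign u = ((|t| : ℝ) : ℂ) := I_mul_mul_contourSign ht
  have hbd : ∀ w : ℂ, M < |w.im| →
      ‖F w‖ ≤ ‖hankelPhase c u‖ * (|w.im| - M) ^ (-c) * Real.exp (|t| * w.re) := by
    intro w hw
    have h1 := norm_exp_integral_log_sub_le hc.le (sub_pos.2 hw)
      (hM.mono fun s hs => hdist w s hs) (hint w (Or.inr hw))
    have h2 : ‖Complex.exp (u * contourSign u * w)‖ = Real.exp (|t| * w.re) := by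
      rw [hv, Complex.norm_exp, Complex.re_ofReal_mul]
    rw [hFeq w (Or.inr hw), norm_mul, norm_mul, h2, mul_assoc,
      mul_comm (Real.exp _) ‖_‖]
    gcongr
  have hb0 : 0 < b := hM0.trans_lt hb
  have ha0 : 0 < a := hM0.trans_lt ha
  have hhor : ∀ k : ℝ, |k| = b → ∀ d,
      IntegrableOn (fun x : ℝ => F (x + k * Complex.I)) (Set.Iic d) := by
    intro k hk d
    have hk' : ∀ x : ℝ, |((x : ℂ) + k * Complex.I).im| = b := fun x => by simpa using hk
    refine integrableOn_horizontal (τ := |t|) (C := ‖hankelPhase c u‖ * (b - M) ^ (-c))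
      (abs_pos.2 ht) (fun x _ => hd _ (Or.inr (by rwa [hk']))) (fun x _ => ?_)
    simpa [hk] using hbd (x + k * Complex.I) (by rwa [hk'])
  have key := tendsto_vertical_hankelIntegral (F := F) (a := δ) (b := b) hc (abs_pos.2 ht)
    (norm_nonneg (hankelPhase c u)) hM0 hb
    (fun w _ hw => hd w (Or.inr (hb.trans_le hw))) (fun w _ hw => hbd w (hb.trans_le hw))
    (fun p q => by
      refine Continuous.intervalIntegrable ?_ p q
      refine continuous_iff_continuousAt.2 fun y => ?_
      exact ContinuousAt.comp (f := fun y : ℝ => (δ : ℂ) + y * Complex.I)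
        (hd _ (Or.inl (by simpa using hδ))).continuousAt (by fun_prop))
  -- The vertical side moves from `δ` to `a` inside `Re w > 0`; opening the loop at `δ` thus gives
  -- the value of the loop at `a`.
  rw [← hankelIntegral_one_eq_of_differentiableAt (a := a) (a' := δ) (F := F) (fun w hw _ =>
    hd w (Or.inl ((lt_min ha0 hδ).trans_le hw.1))) hb0.le (hhor (-b) (by simp [hb0.le]))
    (hhor b (abs_of_pos hb0))] at key
  rw [hankelIntegral_eq_mul]
  exact hasLineIntegral_of_tendsto_vertical ht key

theorem integrable_log_sub_mul_I {ρ : Measure ℝ} [IsFiniteMeasure ρ]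
    (hρ : Integrable (fun x : ℝ => Real.log (1 + x ^ 2)) ρ) {w : ℂ} (hw : 0 < w.re) :
    Integrable (fun s : ℝ => Complex.log (w - s * Complex.I)) ρ := by
  have hre : ∀ s : ℝ, 0 < (w - s * Complex.I).re := fun s => by simpa using hw
  refine (integrable_log_add_mul_I hρ (w := starRingEnd ℂ w) (by simpa using hw)).mono
    (Measurable.aestronglyMeasurable (by fun_prop)) (Eventually.of_forall fun s => ?_)
  rw [conj_add_mul_I, log_conj_of_re_pos (hre s), RCLike.norm_conj]

/-- For `c > 1` the inversion formula holds on a line, without any truncation. -/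
theorem HalfPlaneMarkovKrein.integral_cexp_eq_lineIntegral {c : ℝ} (hc : 1 < c) {ρ ν : Measure ℝ}
    [IsProbabilityMeasure ρ] [IsProbabilityMeasure ν]
    (hρ : Integrable (fun x : ℝ => Real.log (1 + x ^ 2)) ρ) (h : HalfPlaneMarkovKrein c ρ ν)
    {t : ℝ} (ht : t ≠ 0) {δ : ℝ} (hδ : 0 < δ) :
    Integrable (fun y : ℝ => hankelIntegrand c (Complex.I * t) ρ (linePoint t δ y)) ∧
    ∫ x : ℝ, Complex.exp (x * (Complex.I * t)) ∂ν =
      hankelFactor c (Complex.I * t) *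
        lineIntegral t δ (hankelIntegrand c (Complex.I * t) ρ) := by
  have hu0 : Complex.I * (t : ℂ) ≠ 0 := by simp [ht]
  set u : ℂ := Complex.I * t with hu
  have hv : u * contourSign u = ((|t| : ℝ) : ℂ) := I_mul_mul_contourSign ht
  have hdiv : ∀ s : ℝ, (s : ℂ) / contourSign u = ((Real.sign t * s : ℝ) : ℂ) * Complex.I :=
    div_contourSign_I_mul ht
  -- For imaginary `u` the rotated identity is the half-plane identity itself or its conjugate, so
  -- no bound on the supports is needed.
  have hw : ∀ w : ℂ, 0 < w.re → hankelIntegrand c u ρ (contourSign u * w) = hankelPhase c u *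
      ∫ x : ℝ, Complex.exp (((|t| : ℝ) : ℂ) * w) * negPow c (w - x / contourSign u) ∂ν := by
    intro w hw
    rcases lt_or_gt_of_ne ht with hs | hs
    · have e : ∀ s : ℝ, w - s / contourSign u = w + s * Complex.I := fun s => by
        simp [hdiv, Real.sign_of_neg hs]
      rw [hankelIntegrand_mul (by simpa only [e] using integrable_log_add_mul_I hρ hw), hv,
        integral_const_mul]
      simp only [e]
      rw [h w hw]
    · have e : ∀ s : ℝ, w - s / contourSign u = w - s * Complex.I := fun s => by
        simp [hdiv, Real.sign_of_pos hs]
      rw [hankelIntegrand_mul (by simpa only [e] using integrable_log_sub_mul_I hρ hw), hv,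
        integral_const_mul]
      simp only [e]
      rw [h.integral_negPow_sub hw]
  set Ψ : ℝ → ℝ → ℂ := fun y x => Complex.exp (((|t| : ℝ) : ℂ) * (δ + y * Complex.I)) *
    negPow c (δ + y * Complex.I - x / contourSign u) with hΨ
  have hline : ∀ x : ℝ, Integrable (fun y => Ψ y x) ∧ ∫ y, Ψ y x = Complex.exp (x * u) *
      ((2 * Real.pi * |t| ^ (c - 1) / Real.Gamma c : ℝ) : ℂ) := by
    intro x
    have h1 := integral_line_cexp_mul_negPow_sub hc (abs_pos.2 ht) (δ := δ)
      (ζ := (x : ℂ) / contourSign u) (by simpa [hdiv] using hδ)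
    refine ⟨h1.1, h1.2.trans ?_⟩
    rw [← hv]
    congr 2
    have := contourSign_ne_zero u
    field_simp
  -- Changing `x` only translates `‖Ψ y x‖` in `y`. Its integral over the line is constant in `x`,
  -- so Fubini's theorem applies for every probability measure `ν`.
  have hnorm : ∀ x : ℝ, ∫ y, ‖Ψ y x‖ = ∫ y, ‖Ψ y 0‖ := by
    intro x
    have e : ∀ y : ℝ, ‖Ψ y x‖ = ‖Ψ (y - Real.sign t * x) 0‖ := by
      intro y
      simp only [hΨ, norm_mul, hdiv, Complex.norm_exp, Complex.re_ofReal_mul]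
      congr 2
      · simp
      · push_cast
        ring_nf
    simp_rw [e]
    exact integral_sub_right_eq_self (fun y => ‖Ψ y 0‖) (Real.sign t * x)
  have hI : Integrable (Function.uncurry Ψ) (volume.prod ν) := by
    refine (integrable_prod_iff' (Measurable.aestronglyMeasurable ?_)).2
      ⟨Eventually.of_forall fun x => (hline x).1, ?_⟩
    · simp only [hΨ, Function.uncurry_def]
      fun_prop
    · simp only [Function.uncurry_apply_pair, hnorm]
      exact integrable_const _
  have hF : ∀ y : ℝ, hankelIntegrand c u ρ (contourSign u * (δ + y * Complex.I)) =
      hankelPhase c u * ∫ x, Ψ y x ∂ν := fun y => hw _ (by simpa using hδ)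
  have hFI : Integrable (fun y : ℝ =>
      hankelIntegrand c u ρ (contourSign u * (δ + y * Complex.I))) := by
    simp_rw [hF]
    exact hI.integral_prod_left.const_mul _
  have hlp : Integrable (fun y : ℝ => hankelIntegrand c u ρ (linePoint t δ y)) ∧
      ∫ y : ℝ, hankelIntegrand c u ρ (linePoint t δ y) =
        ∫ y : ℝ, hankelIntegrand c u ρ (contourSign u * (δ + y * Complex.I)) := by
    simp_rw [linePoint_eq_contourSign_mul ht]
    rcases lt_or_gt_of_ne ht with hs | hs
    · simp only [Real.sign_of_neg hs, neg_one_mul]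
      exact ⟨hFI.comp_neg, integral_neg_eq_self (fun y : ℝ =>
        hankelIntegrand c u ρ (contourSign u * (δ + y * Complex.I))) volume⟩
    · simp only [Real.sign_of_pos hs, one_mul]
      exact ⟨hFI, rfl⟩
  refine ⟨hlp.1, ?_⟩
  have hpow : (u * contourSign u) ^ ((c : ℂ) - 1) = ((|t| ^ (c - 1) : ℝ) : ℂ) := by
    rw [hv, Complex.ofReal_cpow (abs_nonneg t)]
    push_cast
    rfl
  have hfac := hankelFactor_mul (by linarith : 0 < c) hu0
  rw [lineIntegral, hlp.2, ← contourSign_I_mul_mul_I ht]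
  simp_rw [hF]
  rw [integral_const_mul, integral_integral_swap hI]
  simp_rw [(hline _).2]
  rw [integral_mul_const]
  rw [hpow] at hfac
  rw [← hu]
  push_cast at hfac ⊢
  linear_combination (-∫ x : ℝ, Complex.exp (x * u) ∂ν) * hfac

/-! ### The main theorem -/

theorem ae_abs_le_of_measure_compl_Icc {ρ : Measure ℝ} {M : ℝ} (h : ρ (Set.Icc (-M) M)ᶜ = 0) :
    ∀ᵐ s ∂ρ, |s| ≤ M := by
  filter_upwards [measure_eq_zero_iff_ae_notMem.1 h] with s hs
  exact abs_le.2 (Set.notMem_compl_iff.1 hs)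

theorem mainTheorem3 (c : ℝ) (hc : 0 < c) (ρ : Measure ℝ) [IsProbabilityMeasure ρ]
    (hρ : Integrable (fun x : ℝ => Real.log (1 + x ^ 2)) ρ) :
    (∃! ν : Measure ℝ, IsMarkovKrein c ρ ν) ∧
    ∀ ν : Measure ℝ, IsMarkovKrein c ρ ν →
      ∀ u : ℂ, u ≠ 0 → Integrable (fun x : ℝ => Real.exp (x * u.re)) ρ →
        -- the left side converges
        Integrable (fun x : ℝ => Complex.exp (x * u)) ν ∧
        -- the formula with the limit
        (∀ a b : ℝ → ℝ, (∀ M : ℝ, 0 < M → M < a M ∧ M < b M) →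
          (∀ M : ℝ, 0 < M →
            HankelIntegrable (contourSign u) (a M) (b M)
              (hankelIntegrand c u (truncMeasure ρ M))) ∧
          Tendsto
            (fun M : ℝ => hankelFactor c u *
              hankelIntegral (contourSign u) (a M) (b M)
                (hankelIntegrand c u (truncMeasure ρ M)))
            atTop (𝓝 (∫ x : ℝ, Complex.exp (x * u) ∂ν))) ∧
        -- the formula for compactly supported measures
        (∀ M : ℝ, 0 ≤ M → ρ (Set.Icc (-M) M)ᶜ = 0 → ∀ a b : ℝ, M < a → M < b →
          HankelIntegrable (contourSign u) a b (hankelIntegrand c u ρ) ∧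
          ∫ x : ℝ, Complex.exp (x * u) ∂ν =
            hankelFactor c u * hankelIntegral (contourSign u) a b (hankelIntegrand c u ρ)) ∧
        -- imaginary `u`
        (∀ t : ℝ, t ≠ 0 → u = Complex.I * t → ∀ δ : ℝ, 0 < δ →
          -- the contour in both formulas can be deformed to a line
          (∀ M : ℝ, 0 < M → ∀ a b : ℝ, M < a → M < b →
            HasLineIntegral t δ (hankelIntegrand c u (truncMeasure ρ M))
              (hankelIntegral (contourSign u) a b
                (hankelIntegrand c u (truncMeasure ρ M)))) ∧
          (∀ M : ℝ, 0 ≤ M → ρ (Set.Icc (-M) M)ᶜ = 0 → ∀ a b : ℝ, M < a → M < b →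
            HasLineIntegral t δ (hankelIntegrand c u ρ)
              (hankelIntegral (contourSign u) a b (hankelIntegrand c u ρ))) ∧
          -- for `c > 1` no truncation is needed
          (1 < c →
            Integrable (fun y : ℝ => hankelIntegrand c u ρ (linePoint t δ y)) ∧
            ∫ x : ℝ, Complex.exp (x * u) ∂ν =
              hankelFactor c u * lineIntegral t δ (hankelIntegrand c u ρ))) := by
  have hclampI : ∀ M, Integrable (fun x : ℝ => Real.log (1 + x ^ 2)) (ρ.map (clamp M)) :=
    fun M => integrable_log_comp hρ (measurable_clamp M) (abs_clamp_le M)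
  have hclampP : ∀ M, IsProbabilityMeasure (ρ.map (clamp M)) :=
    fun M => Measure.isProbabilityMeasure_map (measurable_clamp M).aemeasurable
  have hclampM : ∀ M, 0 < M → ∀ᵐ s ∂(ρ.map (clamp M)), |s| ≤ M := fun M hM => by
    rw [ae_map_iff (measurable_clamp M).aemeasurable (measurableSet_le (by fun_prop) (by fun_prop))]
    refine Eventually.of_forall fun s => ?_
    simpa [abs_of_pos hM] using abs_clamp_le_abs M s
  refine ⟨?_, fun ν hν u hu hexp => ?_⟩
  · obtain ⟨ν, hν, -⟩ := exists_halfPlaneMarkovKrein hc hρ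
    refine ⟨ν, (isMarkovKrein_iff hρ).2 ⟨inferInstance, hν⟩, fun ν' hν' => ?_⟩
    obtain ⟨hp, hν'⟩ := (isMarkovKrein_iff hρ).1 hν'
    exact hν'.unique hc hν
  obtain ⟨hp, hh⟩ := (isMarkovKrein_iff hρ).1 hν
  refine ⟨?_, fun a b hab => ?_, fun M hM0 hM a b ha hb => ?_, fun t ht hut δ hδ => ?_⟩
  · refine (hh.integrable_exp hc hρ hexp).mono (Measurable.aestronglyMeasurable (by fun_prop))
      (Eventually.of_forall fun x => ?_)
    rw [Complex.norm_exp, Complex.re_ofReal_mul, Real.norm_eq_abs, abs_of_pos (Real.exp_pos _)]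
  · choose νM hνM _ using fun M => exists_halfPlaneMarkovKrein hc (hclampI M)
    have key : ∀ M : ℝ, 0 < M → _ := fun M hM =>
      ((isMarkovKrein_iff (hclampI M)).2 ⟨inferInstance, hνM M⟩).hankel hc hM.le (hclampM M hM)
        ((hνM M).ae_abs_le hc (hclampI M) (hclampM M hM)) hu (hab M hM).1 (hab M hM).2
    refine ⟨fun M hM => ?_, ?_⟩
    · rw [truncMeasure_eq_map ρ hM]
      exact (key M hM).1
    · refine (tendsto_integral_cexp_truncation hc hρ hh hνM hexp).congr' ?_
      filter_upwards [eventually_gt_atTop 0] with M hM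
      rw [truncMeasure_eq_map ρ hM]
      exact (key M hM).2
  · have hM' := ae_abs_le_of_measure_compl_Icc hM
    exact hν.hankel hc hM0 hM' (hh.ae_abs_le hc hρ hM') hu ha hb
  · subst hut
    refine ⟨fun M hM a b ha hb => ?_, fun M hM0 hM a b ha hb => ?_, fun hc1 => ?_⟩
    · rw [truncMeasure_eq_map ρ hM]
      exact hasLineIntegral_hankelIntegral hc hM.le (hclampM M hM) ht hδ ha hb
    · exact hasLineIntegral_hankelIntegral hc hM0 (ae_abs_le_of_measure_compl_Icc hM) ht hδ ha hb
    · exact hh.integral_cexp_eq_lineIntegral hc1 hρ ht hδ
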